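/- **Setting.** Consider a discounted MDP with measurable state space $\mathcal S$, finite action space $\mathcal A$, transition kernel $\mathcal P$, initial law $\zeta$, discount factor $\gamma\in(0,1)$ and a (possibly random) reward with $|r|\le Q_{\max}$, $Q_{\max}>0$. State-action pairs are identified with unit vectors of $\mathbb R^d$, $d\ge 2$, through a measurable map $(s,a)\mapsto x(s,a)\in\mathbb R^d$, $\|x(s,a)\|_2=1$; we write $(s,a)$ for $x(s,a)$. For a policy $\pi$ let $\nu_\pi=(1-\gamma)\sum_{t\ge0}\gamma^t\,\mathbb P(S_t\in\cdot)$ and $\sigma_\pi=(1-\gamma)\sum_{t\ge0}\gamma^t\,\mathbb P((S_t,A_t)\in\cdot)$ be its visitation measures, $J(\pi)=(1-\gamma)\,\mathbb E\sum_{t\ge0}\gamma^t r(S_t,A_t)$, and let $\pi^*$ maximize $J$ over all policies. Let $m\ge1$, $R>1$, $\tau>0$. Initialize independently $[W_{\rm init}]_r\sim N(0,I_d/d)$ and $b_r\sim{\rm Unif}\{-1,1\}$, $r=1,\dots,m$, and write $\mathbb E_{\rm init}$ for the expectation. For $\theta\in\mathbb R^{md}$ with blocks $[\theta]_r\in\mathbb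 R^d$ put $$f((s,a);\theta)=\frac1{\sqrt m}\sum_{r=1}^m b_r\max\{(s,a)^\top[\theta]_r,0\},\qquad [\phi_\theta]_r(s,a)=\frac{b_r}{\sqrt m}\mathbf 1\{(s,a)^\top[\theta]_r>0\}\,(s,a),\qquad \pi_\theta(a\mid s)\propto\exp\bigl(\tau f((s,a);\theta)\bigr),$$ and $\mathcal B=\{\theta:\|\theta-W_{\rm init}\|_2\le R\}$. A point $\hat\theta\in\mathcal B$ is stationary if $\theta\mapsto J(\pi_\theta)$ is differentiable at $\hat\theta$ and $\nabla_\theta J(\pi_{\hat\theta})^\top(\theta-\hat\theta)\le0$ for all $\theta\in\mathcal B$. Let $\mathcal F_{R,\infty}$ be the set of functions $$(s,a)\mapsto f((s,a);W_{\rm init})+\int\mathbf 1\{w^\top(s,a)>0\}\,(s,a)^\top\iota(w)\,d\mu(w),\qquad \mu=N(0,I_d/d),\ \ \iota:\mathbb R^d\to\mathbb R^d\text{ measurable},\ \ \|\iota(w)\|_\infty\le R/\sqrt d\ \ \forall w.$$ **Regularity assumption.** There is a constant $c>0$ such that for all policies $\pi,\tilde\pi$, all $y\in\mathbb R^d\setminus\{0\}$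 and all $u>0$, the event $\{|y^\top(s,a)|\le u\}$ has probability at most $c\,u/\|y\|_2$ when $s\sim\nu_\pi$, $a\sim\tilde\pi(\cdot\mid s)$, and also when $s\sim\varrho_\pi$, $a\sim\tilde\pi(\cdot\mid s)$, where $\varrho_\pi$ is a stationary state distribution of the Markov chain induced by $\pi$. **Theorem (Global Optimality of Stationary Point).** There is a constant $C>0$ depending only on $d$, $c$ and $Q_{\max}$ such that, in the above setting and under the regularity assumption, the following holds. Let $\hat\theta$ be a (measurable) random parameter that is almost surely a stationary point, suppose that almost surely $\sigma_{\pi^*}\ll\sigma_{\pi_{\hat\theta}}$, and put $$u_{\hat\theta}(s,a)=\frac{d\sigma_{\pi^*}}{d\sigma_{\pi_{\hat\theta}}}(s,a)-\frac{d\nu_{\pi^*}}{d\nu_{\pi_{\hat\theta}}}(s)+\phi_{\hat\theta}(s,a)^\top\hat\theta .$$ Then $J(\pi^*)-J(\pi_{\hat\theta})$ is integrable, and: 1. if almost surely $u_{\hat\theta}\in\mathcal F_{R,\infty}$ (up to equality $\sigma_{\pi_{\hat\theta}}$-a.e.), then $$(1-\gamma)\,\mathbb E_{\rm init}\bigl[J(\pi^*)-J(\pi_{\hat\theta})\bigr]\le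 C\,R^{3/2}m^{-1/4};$$ 2. without this membership assumption, $$(1-\gamma)\,\mathbb E_{\rm init}\bigl[J(\pi^*)-J(\pi_{\hat\theta})\bigr]\le C\,R^{3/2}m^{-1/4}+2Q_{\max}\,\mathbb E_{\rm init}\Bigl[\bigl\|\Pi_{\mathcal F_{R,\infty}}u_{\hat\theta}-u_{\hat\theta}\bigr\|_{L^2(\sigma_{\pi_{\hat\theta}})}\Bigr],$$ where $\Pi_{\mathcal F_{R,\infty}}$ is the projection onto $\mathcal F_{R,\infty}$ with respect to the $L^2(\sigma_{\pi_{\hat\theta}})$-norm (the last expectation may be $+\infty$). -/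

import Mathlib

open MeasureTheory ProbabilityTheory
open scoped ENNReal NNReal Gradient

noncomputable section

/-! ### Discounted Markov decision processes -/

/-- A discounted Markov decision process with state space `S` and action space `A`. The reward is
allowed to be random: `reward (s, a)` is the law of the reward received for action `a` at `s`. -/
structure MDP (S A : Type*) [MeasurableSpace S] [MeasurableSpace A] where
  /-- transition kernel -/
  trans : Kernel (S × A) S
  trans_markov : IsMarkovKernel trans
  /-- law of the initial state -/
  init : Measure S
  init_prob : IsProbabilityMeasure init
  /-- law of the (possibly random) reward -/
  reward : Kernel (S × A) ℝ
  reward_markov : IsMarkovKernel reward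
  /-- discount factor -/
  discount : ℝ
  discount_pos : 0 < discount
  discount_lt_one : discount < 1

namespace MDP

variable {S A : Type*} [MeasurableSpace S] [MeasurableSpace A]

/-- Rewards are bounded by `Q` in absolute value. -/
def RewardBound (M : MDP S A) (Q : ℝ) : Prop :=
  ∀ p : S × A, ∀ᵐ y ∂(M.reward p), |y| ≤ Q

/-- Transition kernel of the Markov chain on `S` induced by the policy `π`. -/
def stateKernel (M : MDP S A) (π : Kernel S A) : Kernel S S :=
  M.trans ∘ₖ (Kernel.id ×ₖ π)

/-- Law of the state `S_t` under the policy `π`. -/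
def stateLaw (M : MDP S A) (π : Kernel S A) : ℕ → Measure S
  | 0 => M.init
  | t + 1 => (M.stateLaw π t).bind (M.stateKernel π)

/-- Law of the pair `(S_t, A_t)` under the policy `π`. -/
def stateActionLaw (M : MDP S A) (π : Kernel S A) (t : ℕ) : Measure (S × A) :=
  (M.stateLaw π t) ⊗ₘ π

/-- State visitation measure `ν_π = (1 - γ) ∑ γ^t P(S_t ∈ ·)`. -/
def stateVisit (M : MDP S A) (π : Kernel S A) : Measure S :=
  Measure.sum fun t : ℕ =>
    ENNReal.ofReal ((1 - M.discount) * M.discount ^ t) • M.stateLaw π t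

/-- State-action visitation measure `σ_π = (1 - γ) ∑ γ^t P((S_t, A_t) ∈ ·)`. -/
def visit (M : MDP S A) (π : Kernel S A) : Measure (S × A) :=
  Measure.sum fun t : ℕ =>
    ENNReal.ofReal ((1 - M.discount) * M.discount ^ t) • M.stateActionLaw π t

/-- Expected total reward `J(π) = (1 - γ) ∑ γ^t E[r(S_t, A_t)]`. -/
def totalReward (M : MDP S A) (π : Kernel S A) : ℝ :=
  (1 - M.discount) * ∑' t : ℕ, M.discount ^ t * ∫ p, (∫ y, y ∂(M.reward p)) ∂(M.stateActionLaw π t)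

/-- `π` maximizes the expected total reward over all policies. -/
def IsOptimal (M : MDP S A) (π : Kernel S A) : Prop :=
  IsMarkovKernel π ∧ ∀ π' : Kernel S A, IsMarkovKernel π' → M.totalReward π' ≤ M.totalReward π

end MDP

/-! ### Two-layer ReLU networks and energy-based policies -/

/-- Parameters in `ℝ^{md}` with the Euclidean norm, written as `m` blocks of size `d`. -/
abbrev Params (m d : ℕ) := EuclideanSpace ℝ (Fin m × Fin d)

/-- The `r`-th block of a parameter. -/
def block {m d : ℕ} (θ : Params m d) (r : Fin m) : EuclideanSpace ℝ (Fin d) :=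
  WithLp.toLp 2 fun k => θ (r, k)

/-- Two-layer ReLU network `m^{-1/2} ∑ b_r ReLU(xᵀ [W]_r)`. -/
def network {m d : ℕ} (b : Fin m → ℝ) (W : Params m d) (x : EuclideanSpace ℝ (Fin d)) : ℝ :=
  (1 / √(m : ℝ)) * ∑ r, b r * max (inner ℝ x (block W r)) 0

open Classical in
/-- Feature map `[φ_θ]_r(x) = m^{-1/2} b_r 1{xᵀ[θ]_r > 0} x`. -/
def feature {m d : ℕ} (b : Fin m → ℝ) (θ : Params m d) (x : EuclideanSpace ℝ (Fin d)) :
    Params m d :=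
  WithLp.toLp 2 fun rk : Fin m × Fin d =>
    b rk.1 / √(m : ℝ) * (if 0 < inner ℝ x (block θ rk.1) then 1 else 0) * x rk.2

variable {S A : Type*} [MeasurableSpace S] [MeasurableSpace A]

/-- The energy-based policy `π_θ(a | s) ∝ exp(τ f((s, a); θ))` on a finite action space, as the
kernel with this density with respect to the counting measure; `x` embeds `S × A` in `ℝ^d`. -/
def neuralPolicy {m d : ℕ} [Fintype A] [MeasurableSingletonClass A]
    (x : S × A → EuclideanSpace ℝ (Fin d)) (τ : ℝ) (b : Fin m → ℝ) (θ : Params m d) :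
    Kernel S A :=
  Kernel.withDensity (Kernel.const S Measure.count) fun s a =>
    ENNReal.ofReal (Real.exp (τ * network b θ (x (s, a))) /
      ∑ a', Real.exp (τ * network b θ (x (s, a'))))

/-! ### Random initialization -/

/-- Law of a Gaussian vector with independent `N(0, 1/d)` coordinates indexed by `ι`. -/
def gaussianInit (ι : Type*) [Fintype ι] (d : ℕ) : Measure (EuclideanSpace ℝ ι) :=
  (Measure.pi fun _ : ι => gaussianReal 0 (d : ℝ≥0)⁻¹).map (WithLp.toLp 2)

/-- Uniform law on `{-1, 1}`. -/
def signLaw : Measure ℝ :=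
  (2⁻¹ : ℝ≥0∞) • Measure.dirac (-1) + (2⁻¹ : ℝ≥0∞) • Measure.dirac 1

/-- Joint law of the initialization `(W_init, b)`: independent, `[W_init]_r ∼ N(0, I_d / d)` and
`b_r` uniform on `{-1, 1}`. -/
def initLaw (m d : ℕ) : Measure (Params m d × (Fin m → ℝ)) :=
  (gaussianInit (Fin m × Fin d) d).prod (Measure.pi fun _ : Fin m => signLaw)

/-! ### Function class, projection, regularity, stationarity -/

open Classical in
/-- The class `F_{R,∞}`: functions `f_0(s, a) + ∫ 1{wᵀ(s, a) > 0} (s, a)ᵀ ι(w) dμ(w)` with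
`‖ι(w)‖_∞ ≤ R / √d`, where `μ` is the law `N(0, I_d / d)` and `f_0` is the initial network. -/
def FRInfty {m d : ℕ} (x : S × A → EuclideanSpace ℝ (Fin d)) (b : Fin m → ℝ) (W₀ : Params m d)
    (R : ℝ) : Set (S × A → ℝ) :=
  {f | ∃ ι : EuclideanSpace ℝ (Fin d) → EuclideanSpace ℝ (Fin d), Measurable ι ∧
    (∀ w k, |ι w k| ≤ R / √(d : ℝ)) ∧
    ∀ p, f p = network b W₀ (x p) +
      ∫ w, (if 0 < inner ℝ w (x p) then 1 else 0) * inner ℝ (x p) (ι w)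
        ∂(gaussianInit (Fin d) d)}

open Classical in
/-- Projection of `u` onto a class `F` of functions with respect to the `L²(σ)`-norm: an element
of `F` closest to `u` (and `0` if there is none). -/
def l2Proj {X : Type*} [MeasurableSpace X] (σ : Measure X) (F : Set (X → ℝ)) (u : X → ℝ) :
    X → ℝ :=
  if h : ∃ f ∈ F, ∀ g ∈ F, eLpNorm (f - u) 2 σ ≤ eLpNorm (g - u) 2 σ then h.choose else 0

/-- Regularity of the visitation measures and of the stationary state distributions, with
constant `c`: for all policies `π`, `π'`, the law of `x(s, a)` under `π' · ν_π` and under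
`π' · ϱ_π` puts mass at most `c u / ‖y‖` on every slab `{|yᵀ x| ≤ u}`. -/
def RegularVisits {d : ℕ} (M : MDP S A) (x : S × A → EuclideanSpace ℝ (Fin d)) (c : ℝ) : Prop :=
  ∀ π π' : Kernel S A, IsMarkovKernel π → IsMarkovKernel π' →
    ∀ y : EuclideanSpace ℝ (Fin d), y ≠ 0 → ∀ u : ℝ, 0 < u →
      (M.stateVisit π ⊗ₘ π').real {p | |inner ℝ y (x p)| ≤ u} ≤ c * u / ‖y‖ ∧
      ∀ ϱ : Measure S, IsProbabilityMeasure ϱ → Kernel.Invariant (M.stateKernel π) ϱ →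
        (ϱ ⊗ₘ π').real {p | |inner ℝ y (x p)| ≤ u} ≤ c * u / ‖y‖

/-- `θ'` is a stationary point of `θ ↦ J(π_θ)` over the ball of radius `R` around `W₀`. -/
def IsStationaryPoint {m d : ℕ} [Fintype A] [MeasurableSingletonClass A] (M : MDP S A)
    (x : S × A → EuclideanSpace ℝ (Fin d)) (τ : ℝ) (b : Fin m → ℝ) (W₀ : Params m d) (R : ℝ)
    (θ' : Params m d) : Prop :=
  θ' ∈ Metric.closedBall W₀ R ∧
  DifferentiableAt ℝ (fun θ => M.totalReward (neuralPolicy x τ b θ)) θ' ∧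
  ∀ θ ∈ Metric.closedBall W₀ R,
    inner ℝ (∇ (fun θ => M.totalReward (neuralPolicy x τ b θ)) θ') (θ - θ') ≤ 0

/-- `u_θ(s, a) = dσ_{π*}/dσ_{π_θ}(s, a) - dν_{π*}/dν_{π_θ}(s) + φ_θ(s, a)ᵀ θ`. -/
def uFun {m d : ℕ} [Fintype A] [MeasurableSingletonClass A] (M : MDP S A)
    (x : S × A → EuclideanSpace ℝ (Fin d)) (τ : ℝ) (πopt : Kernel S A) (b : Fin m → ℝ)
    (θ : Params m d) : S × A → ℝ := fun p =>
  ((M.visit πopt).rnDeriv (M.visit (neuralPolicy x τ b θ)) p).toReal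
    - ((M.stateVisit πopt).rnDeriv (M.stateVisit (neuralPolicy x τ b θ)) p.1).toReal
    + inner ℝ (feature b θ (x p)) θ

end

/-! Write `θ'` for the stationary point, `π` for its policy, `σ` for its state-action visitation
measure and `Ad` for its advantage. By the performance difference lemma the scaled gap is the mean
of `Ad` under the optimal visitation measure, that is, the `σ`-integral of `Ad` times the density
ratio. Since `Ad` averages to zero under `π` at every state, the ratio of state visitations may be
subtracted for free. The ReLU is positively homogeneous, so `φ_θᵀθ` is the network itself, and the
gap equals `∫ Ad * (u - network θ') dσ`.

Replace `u` by some `f = network W + g` of the class, at the cost of an L¹ error, and compare with a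
competitor `θ = W + v` in the ball. What remains splits into three terms. The first-order term in
the direction `θ - θ'` is nonpositive by stationarity (`IsStationaryPoint.integral_advantage_le`).
The second is the linearization error between `W` and `θ'`: a gate can flip only if `x` lies in a
slab around the hyperplane of an initial block, and regularity bounds the slab probabilities.
Together with a Gaussian small-ball estimate, for which `d ≥ 2` is used, this gives `R^{3/2}
m^{-1/4}`. The third is `∫ Ad * (g - gateLinear W v) dσ`.

The difficulty of the third term is that `θ'`, hence `Ad` and `σ`, depends on `W`, so random-feature
approximation of a fixed `g` is not enough. Duality removes it. With `h(w) = ∫ Ad 1{wᵀx > 0} x dσ`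
the `g` part is at most `R` times the mean of `‖h‖`, while a suitable `v` of norm at most `R` makes
the other part equal to `R` times the empirical root mean square of `‖h‖` over the blocks of `W`. As
`‖h(w)‖²` is a double `σ`-integral of products of two half-space indicators in `w`, the population
and empirical second moments differ by at most a multiple of the largest deviation over pairs of
unit vectors, uniformly in `Ad` and `σ`. Chaining over grids (`exists_pairGate_deviation_bound`)
gives mean deviation of order `m^{-1/2}`, without a logarithm; passing from squares to norms yields
`m^{-1/4}`.

All of this is collected in `exists_gap_bound`, where the error is a function `Ψ` of `W` alone. Its
expectation therefore needs no information about how `θ'` was produced. -/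

noncomputable section

namespace MDP

/-! ### Visitation measures, Bellman equation and performance difference -/

section General

variable {S A : Type*} [MeasurableSpace S] [MeasurableSpace A] (M : MDP S A)

instance : IsMarkovKernel M.trans := M.trans_markov
instance : IsProbabilityMeasure M.init := M.init_prob
instance : IsMarkovKernel M.reward := M.reward_markov

instance (π : Kernel S A) [IsMarkovKernel π] : IsMarkovKernel (M.stateKernel π) := by
  unfold stateKernel; infer_instance

instance isProbabilityMeasure_stateLaw (π : Kernel S A) [IsMarkovKernel π] (t : ℕ) :
    IsProbabilityMeasure (M.stateLaw π t) := by
  induction t with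
  | zero => exact M.init_prob
  | succ t ih => unfold stateLaw; infer_instance

instance (π : Kernel S A) [IsMarkovKernel π] (t : ℕ) :
    IsProbabilityMeasure (M.stateActionLaw π t) := by
  unfold stateActionLaw; infer_instance

lemma one_sub_discount_pos : 0 < 1 - M.discount := sub_pos.2 M.discount_lt_one

lemma hasSum_weight : HasSum (fun t : ℕ => (1 - M.discount) * M.discount ^ t) 1 := by
  have := (hasSum_geometric_of_lt_one M.discount_pos.le M.discount_lt_one).mul_left
    (1 - M.discount)
  rwa [mul_inv_cancel₀ M.one_sub_discount_pos.ne'] at this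

lemma weight_nonneg (t : ℕ) : 0 ≤ (1 - M.discount) * M.discount ^ t :=
  mul_nonneg M.one_sub_discount_pos.le (pow_nonneg M.discount_pos.le t)

lemma tsum_ofReal_weight :
    ∑' t : ℕ, ENNReal.ofReal ((1 - M.discount) * M.discount ^ t) = 1 := by
  rw [← ENNReal.ofReal_tsum_of_nonneg M.weight_nonneg M.hasSum_weight.summable,
    M.hasSum_weight.tsum_eq, ENNReal.ofReal_one]

instance (π : Kernel S A) [IsMarkovKernel π] : IsProbabilityMeasure (M.stateVisit π) := by
  constructor
  simp [stateVisit, Measure.sum_apply, M.tsum_ofReal_weight]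

lemma visit_eq_compProd (π : Kernel S A) [IsMarkovKernel π] :
    M.visit π = M.stateVisit π ⊗ₘ π := by
  unfold visit stateVisit
  rw [Measure.compProd_sum_left]
  simp [Measure.compProd_smul_left, stateActionLaw]

instance (π : Kernel S A) [IsMarkovKernel π] : IsProbabilityMeasure (M.visit π) := by
  rw [visit_eq_compProd]; infer_instance

lemma stateLaw_succ (π : Kernel S A) [IsMarkovKernel π] (t : ℕ) :
    M.stateLaw π (t + 1) = M.trans ∘ₘ M.stateActionLaw π t := by
  rw [stateActionLaw, Measure.compProd_eq_comp_prod, Measure.comp_assoc]; rfl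

lemma integrable_of_abs_le {X : Type*} [MeasurableSpace X] {μ : Measure X} [IsFiniteMeasure μ]
    {g : X → ℝ} {B : ℝ} (hg : Measurable g) (hB : ∀ p, |g p| ≤ B) : Integrable g μ :=
  Integrable.of_bound hg.aestronglyMeasurable B (ae_of_all _ hB)

lemma abs_integral_le_of_abs_le {X : Type*} [MeasurableSpace X] {μ : Measure X}
    [IsProbabilityMeasure μ] {g : X → ℝ} {B : ℝ} (hB : ∀ p, |g p| ≤ B) : |∫ p, g p ∂μ| ≤ B := by
  simpa using norm_integral_le_of_norm_le_const (μ := μ) (f := g) (ae_of_all _ hB)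

lemma integral_comp_measure {X Y : Type*} [MeasurableSpace X] [MeasurableSpace Y]
    (κ : Kernel X Y) [IsMarkovKernel κ] (μ : Measure X) [IsProbabilityMeasure μ] {g : Y → ℝ}
    {B : ℝ} (hg : Measurable g) (hB : ∀ p, |g p| ≤ B) :
    ∫ y, g y ∂(κ ∘ₘ μ) = ∫ x, ∫ y, g y ∂(κ x) ∂μ := by
  rw [Measure.comp_eq_comp_const_apply, Kernel.integral_comp (integrable_of_abs_le hg hB)]
  simp

lemma hasSum_integral_visit (π : Kernel S A) [IsMarkovKernel π] {g : S × A → ℝ} {B : ℝ}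
    (hg : Measurable g) (hB : ∀ p, |g p| ≤ B) :
    HasSum (fun t : ℕ => (1 - M.discount) * M.discount ^ t * ∫ p, g p ∂(M.stateActionLaw π t))
      (∫ p, g p ∂(M.visit π)) := by
  have h := hasSum_integral_measure (integrable_of_abs_le (μ := M.visit π) hg hB)
  simp only [integral_smul_measure, ENNReal.toReal_ofReal (M.weight_nonneg _), smul_eq_mul] at h
  exact h

lemma hasSum_integral_stateVisit (π : Kernel S A) [IsMarkovKernel π] {g : S → ℝ} {B : ℝ}
    (hg : Measurable g) (hB : ∀ p, |g p| ≤ B) :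
    HasSum (fun t : ℕ => (1 - M.discount) * M.discount ^ t * ∫ p, g p ∂(M.stateLaw π t))
      (∫ p, g p ∂(M.stateVisit π)) := by
  have h := hasSum_integral_measure (integrable_of_abs_le (μ := M.stateVisit π) hg hB)
  simp only [integral_smul_measure, ENNReal.toReal_ofReal (M.weight_nonneg _), smul_eq_mul] at h
  exact h

/-- Expected immediate reward. -/
def meanReward (p : S × A) : ℝ := ∫ y, y ∂(M.reward p)

lemma measurable_meanReward : Measurable M.meanReward := by
  have : StronglyMeasurable fun p => ∫ y, y ∂(M.reward p) :=
    (stronglyMeasurable_id (α := ℝ)).integral_kernel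
  exact this.measurable

lemma abs_meanReward_le {Q : ℝ} (h : M.RewardBound Q) (p : S × A) : |M.meanReward p| ≤ Q := by
  simpa [meanReward] using
    norm_integral_le_of_norm_le_const (μ := M.reward p) (f := fun y => y) (h p)

lemma totalReward_eq (π : Kernel S A) [IsMarkovKernel π] {Q : ℝ} (h : M.RewardBound Q) :
    M.totalReward π = ∫ p, M.meanReward p ∂(M.visit π) := by
  rw [← (M.hasSum_integral_visit π M.measurable_meanReward (M.abs_meanReward_le h)).tsum_eq,
    totalReward, ← tsum_mul_left]
  simp only [mul_assoc]
  rfl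

/-- Flow equation for the state visitation measure. -/
lemma integral_stateVisit (π : Kernel S A) [IsMarkovKernel π] {v : S → ℝ} {B : ℝ}
    (hv : Measurable v) (hB : ∀ s, |v s| ≤ B) :
    ∫ s, v s ∂(M.stateVisit π) = (1 - M.discount) * ∫ s, v s ∂M.init
      + M.discount * ∫ p, ∫ s, v s ∂(M.trans p) ∂(M.visit π) := by
  have hm : Measurable fun p => ∫ s, v s ∂(M.trans p) :=
    (hv.stronglyMeasurable.integral_kernel (κ := M.trans)).measurable
  have h1 := M.hasSum_integral_stateVisit π hv hB
  have h2 := (M.hasSum_integral_visit π hm fun p => abs_integral_le_of_abs_le hB).mul_left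
    M.discount
  have h3 : HasSum (fun t : ℕ => (1 - M.discount) * M.discount ^ (t + 1) *
      ∫ p, v p ∂(M.stateLaw π (t + 1)))
      (M.discount * ∫ p, ∫ s, v s ∂(M.trans p) ∂(M.visit π)) := by
    refine h2.congr_fun fun t => ?_
    rw [stateLaw_succ, integral_comp_measure M.trans _ hv hB]
    ring
  have h4 := (hasSum_nat_add_iff (f := fun t : ℕ =>
    (1 - M.discount) * M.discount ^ t * ∫ p, v p ∂(M.stateLaw π t)) 1).1 h3
  rw [h1.unique h4]
  simp [stateLaw]
  ring

lemma integral_visit (π : Kernel S A) [IsMarkovKernel π] {g : S × A → ℝ}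
    (hg : Integrable g (M.visit π)) :
    ∫ p, g p ∂(M.visit π) = ∫ s, ∫ a, g (s, a) ∂(π s) ∂(M.stateVisit π) := by
  rw [visit_eq_compProd] at hg ⊢
  exact Measure.integral_compProd hg

/-- `q` is a bounded measurable solution of the Bellman equation of the policy `π` for the
reward function `r`. -/
structure IsActionValue (π : Kernel S A) (r : S × A → ℝ) (B : ℝ) (q : S × A → ℝ) : Prop where
  measurable : Measurable q
  bound : ∀ p, |q p| ≤ B
  bellman : ∀ p, q p = (1 - M.discount) * r p
    + M.discount * ∫ s, ∫ a, q (s, a) ∂(π s) ∂(M.trans p)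

lemma measurable_integral_policy (π : Kernel S A) [IsMarkovKernel π] {q : S × A → ℝ}
    (hq : Measurable q) : Measurable fun s => ∫ a, q (s, a) ∂(π s) :=
  (hq.stronglyMeasurable.integral_kernel_prod_right' (κ := π)).measurable

/-- The Bellman operator preserves measurability and the bound `B`, and contracts the sup distance
by the discount factor, so its iterates from `0` converge pointwise; dominated convergence passes
the equation to the limit. The factor `1 - γ` in front of the reward is what keeps the bound at `B`
itself. -/
theorem exists_isActionValue (π : Kernel S A) [IsMarkovKernel π] {r : S × A → ℝ} {B : ℝ}
    (hr : Measurable r) (hB : ∀ p, |r p| ≤ B) (hB0 : 0 ≤ B) :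
    ∃ q, M.IsActionValue π r B q := by
  have hγ := M.discount_pos
  have hγ' := M.one_sub_discount_pos
  let T : (S × A → ℝ) → S × A → ℝ := fun q p =>
    (1 - M.discount) * r p + M.discount * ∫ s, ∫ a, q (s, a) ∂(π s) ∂(M.trans p)
  have hTm : ∀ q, Measurable q → Measurable (T q) := fun q hq =>
    (hr.const_mul _).add (((measurable_integral_policy π hq).stronglyMeasurable.integral_kernel
      (κ := M.trans)).measurable.const_mul _)
  have hTb : ∀ q, (∀ p, |q p| ≤ B) → ∀ p, |T q p| ≤ B := fun q hq p => by
    have h1 : |∫ s, ∫ a, q (s, a) ∂(π s) ∂(M.trans p)| ≤ B :=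
      abs_integral_le_of_abs_le fun s => abs_integral_le_of_abs_le fun a => hq _
    calc |T q p| ≤ |(1 - M.discount) * r p| + |M.discount * _| := abs_add_le _ _
      _ ≤ (1 - M.discount) * B + M.discount * B := by
        rw [abs_mul, abs_mul, abs_of_pos hγ, abs_of_pos hγ']
        gcongr
        exact hB p
      _ = B := by ring
  let qs : ℕ → S × A → ℝ := fun n => T^[n] 0
  have hs : ∀ n, qs (n + 1) = T (qs n) := fun n => Function.iterate_succ_apply' T n 0
  have hm : ∀ n, Measurable (qs n) := fun n => by
    induction n with
    | zero => exact measurable_zero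
    | succ n ih => rw [hs]; exact hTm _ ih
  have hb : ∀ n p, |qs n p| ≤ B := fun n => by
    induction n with
    | zero => intro p; simpa [qs] using hB0
    | succ n ih => rw [hs]; exact hTb _ ih
  -- Geometric decay of consecutive differences: the reward cancels and each step gains one factor
  -- of the discount.
  have hdiff : ∀ n p, |qs (n + 1) p - qs n p| ≤ B * M.discount ^ n := fun n => by
    induction n with
    | zero => intro p; simpa [qs] using hb 1 p
    | succ n ih =>
      intro p
      have hi : ∀ k s, Integrable (fun a => qs k (s, a)) (π s) := fun k s =>
        integrable_of_abs_le ((hm k).comp measurable_prodMk_left) fun a => hb k _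
      have hi' : ∀ k, Integrable (fun s => ∫ a, qs k (s, a) ∂(π s)) (M.trans p) := fun k =>
        integrable_of_abs_le (measurable_integral_policy π (hm k)) fun s =>
          abs_integral_le_of_abs_le fun a => hb k _
      have : qs (n + 1 + 1) p - qs (n + 1) p = M.discount *
          ∫ s, ∫ a, (qs (n + 1) (s, a) - qs n (s, a)) ∂(π s) ∂(M.trans p) := by
        conv_lhs => rw [hs (n + 1), hs n]
        simp only [T, ← hs n]
        rw [add_sub_add_left_eq_sub, ← mul_sub, ← integral_sub (hi' _) (hi' _)]
        congr 2
        ext s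
        rw [integral_sub (hi _ _) (hi _ _)]
      rw [this, abs_mul, abs_of_pos hγ, pow_succ, ← mul_assoc, mul_comm]
      gcongr
      exact abs_integral_le_of_abs_le fun s => abs_integral_le_of_abs_le fun a => ih _
  have hc : ∀ p, ∃ l, Filter.Tendsto (fun n => qs n p) Filter.atTop (nhds l) := fun p =>
    cauchySeq_tendsto_of_complete (cauchySeq_of_le_geometric _ B M.discount_lt_one fun n => by
      rw [dist_comm, Real.dist_eq]; exact hdiff n p)
  choose q hq using hc
  refine ⟨q, measurable_of_tendsto_metrizable hm (tendsto_pi_nhds.2 hq),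
    fun p => le_of_tendsto (hq p).abs (Filter.Eventually.of_forall fun n => hb n p), fun p => ?_⟩
  refine tendsto_nhds_unique ((Filter.tendsto_add_atTop_iff_nat 1).2 (hq p)) ?_
  simp only [hs]
  refine tendsto_const_nhds.add (Filter.Tendsto.const_mul _ ?_)
  refine tendsto_integral_of_dominated_convergence (fun _ => B)
    (fun n => (measurable_integral_policy π (hm n)).aestronglyMeasurable)
    (integrable_const _) (fun n => ae_of_all _ fun s => abs_integral_le_of_abs_le fun a => hb n _)
    (ae_of_all _ fun s => ?_)
  exact tendsto_integral_of_dominated_convergence (fun _ => B)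
    (fun n => ((hm n).comp measurable_prodMk_left).aestronglyMeasurable)
    (integrable_const _) (fun n => ae_of_all _ fun a => hb n _) (ae_of_all _ fun a => hq _)

/-- Advantage function of an action-value function. -/
def advantage (π : Kernel S A) (q : S × A → ℝ) (p : S × A) : ℝ := q p - ∫ a, q (p.1, a) ∂(π p.1)

variable {M} {π : Kernel S A} {r q : S × A → ℝ} {B : ℝ}

lemma measurable_advantage [IsMarkovKernel π] (hq : Measurable q) : Measurable (advantage π q) :=
  hq.sub ((measurable_integral_policy π hq).comp measurable_fst)

lemma abs_advantage_le [IsMarkovKernel π] (hq : ∀ p, |q p| ≤ B) (p : S × A) :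
    |advantage π q p| ≤ 2 * B := by
  have h1 := hq p
  have h2 : |∫ a, q (p.1, a) ∂(π p.1)| ≤ B := abs_integral_le_of_abs_le fun a => hq _
  calc _ ≤ |q p| + |∫ a, q (p.1, a) ∂(π p.1)| := abs_sub _ _
    _ ≤ 2 * B := by linarith

lemma integral_advantage_policy [IsMarkovKernel π] (hm : Measurable q) (hq : ∀ p, |q p| ≤ B)
    (π' : Kernel S A) [IsMarkovKernel π'] (s : S) :
    ∫ a, advantage π q (s, a) ∂(π' s) = ∫ a, q (s, a) ∂(π' s) - ∫ a, q (s, a) ∂(π s) := by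
  unfold advantage
  have h : Integrable (fun a => q (s, a)) (π' s) :=
    integrable_of_abs_le (hm.comp measurable_prodMk_left) fun a => hq _
  have hsub := integral_sub h (integrable_const (μ := π' s) (∫ a, q (s, a) ∂(π s)))
  simpa using hsub

/-- Performance difference lemma. -/
theorem IsActionValue.performance_difference [IsMarkovKernel π] (hq : M.IsActionValue π r B q)
    (hr : Measurable r) (hB : ∀ p, |r p| ≤ B) (π' : Kernel S A) [IsMarkovKernel π'] :
    (1 - M.discount) * (∫ p, r p ∂(M.visit π') - ∫ p, r p ∂(M.visit π))
      = ∫ p, advantage π q p ∂(M.visit π') := by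
  have hVm := measurable_integral_policy π hq.measurable
  have hVb : ∀ s, |∫ a, q (s, a) ∂(π s)| ≤ B := fun s =>
    abs_integral_le_of_abs_le fun a => hq.bound _
  -- Integrate the Bellman equation against `M.visit π'` and the flow equation for the value
  -- function of `π`: the two transition terms cancel, leaving the reward and the value at the
  -- initial law.
  have key : ∀ (π' : Kernel S A) [IsMarkovKernel π'], ∫ p, advantage π q p ∂(M.visit π')
      = (1 - M.discount) * ((∫ p, r p ∂(M.visit π')) -
        ∫ s, ∫ a, q (s, a) ∂(π s) ∂M.init) := fun π' _ => by
    have h1 := M.integral_stateVisit π' hVm hVb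
    have hi1 : Integrable (fun p : S × A => ∫ a, q (p.1, a) ∂(π p.1)) (M.visit π') :=
      integrable_of_abs_le (hVm.comp measurable_fst) fun p => hVb _
    have h2 : ∫ p, (∫ a, q (p.1, a) ∂(π p.1)) ∂(M.visit π')
        = ∫ s, ∫ a, q (s, a) ∂(π s) ∂(M.stateVisit π') := by
      rw [integral_visit _ _ hi1]
      simp
    have hi : Integrable (fun p => ∫ s, ∫ a, q (s, a) ∂(π s) ∂(M.trans p)) (M.visit π') :=
      integrable_of_abs_le (hVm.stronglyMeasurable.integral_kernel (κ := M.trans)).measurable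
        fun p => abs_integral_le_of_abs_le hVb
    have h3 : ∫ p, q p ∂(M.visit π') = (1 - M.discount) * ∫ p, r p ∂(M.visit π')
        + M.discount * ∫ p, ∫ s, ∫ a, q (s, a) ∂(π s) ∂(M.trans p) ∂(M.visit π') := by
      rw [← integral_const_mul, ← integral_const_mul,
        ← integral_add ((integrable_of_abs_le hr hB).const_mul _) (hi.const_mul _)]
      exact integral_congr_ae (ae_of_all _ hq.bellman)
    unfold advantage
    rw [integral_sub (integrable_of_abs_le hq.measurable hq.bound)
      hi1, h2, h1, h3]
    ring
  -- Taking `π' = π` in `key`, where the left side vanishes, identifies the initial value with the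
  -- expected reward of `π`.
  have h0 : ∫ p, advantage π q p ∂(M.visit π) = 0 := by
    rw [integral_visit _ _ (integrable_of_abs_le (measurable_advantage hq.measurable)
      (abs_advantage_le hq.bound))]
    simp [integral_advantage_policy hq.measurable hq.bound]
  rw [key π']
  rw [key π] at h0
  have := M.one_sub_discount_pos.ne'
  have h5 : ∫ p, r p ∂(M.visit π) = ∫ s, ∫ a, q (s, a) ∂(π s) ∂M.init := by
    rcases mul_eq_zero.1 h0 with h | h
    · exact absurd h this
    · linarith
  rw [h5]

end General

/-! ### Finite action spaces: dependence of the reward on the policy -/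

section FiniteAction

variable {S A : Type*} [MeasurableSpace S] [MeasurableSpace A]

lemma measurable_policy_real [MeasurableSingletonClass A] (π : Kernel S A) (a : A) :
    Measurable fun s => (π s).real {a} :=
  (Kernel.measurable_coe π (measurableSet_singleton a)).ennreal_toReal

variable [Fintype A]

/-- Total variation distance (up to a factor) of two policies at a state. -/
def policyDist (π π' : Kernel S A) (s : S) : ℝ := ∑ a, |(π' s).real {a} - (π s).real {a}|

lemma policyDist_comm (π π' : Kernel S A) : policyDist π π' = policyDist π' π := by
  ext s; simp [policyDist, abs_sub_comm]

variable [MeasurableSingletonClass A] (M : MDP S A)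

lemma integral_policy (π : Kernel S A) [IsMarkovKernel π] (g : A → ℝ) (s : S) :
    ∫ a, g a ∂(π s) = ∑ a, (π s).real {a} * g a := by
  rw [integral_fintype (Integrable.of_finite)]
  simp

lemma measurable_policyDist (π π' : Kernel S A) : Measurable (policyDist π π') :=
  Finset.measurable_sum _ fun a _ =>
    ((measurable_policy_real π' a).sub (measurable_policy_real π a)).abs

lemma sum_policy_real (π : Kernel S A) [IsMarkovKernel π] (s : S) : ∑ a, (π s).real {a} = 1 := by
  simp

lemma abs_policyDist_le (π π' : Kernel S A) [IsMarkovKernel π] [IsMarkovKernel π'] (s : S) :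
    |policyDist π π' s| ≤ 2 := by
  rw [abs_of_nonneg (Finset.sum_nonneg fun _ _ => abs_nonneg _)]
  calc policyDist π π' s ≤ ∑ a, ((π' s).real {a} + (π s).real {a}) := by
        refine Finset.sum_le_sum fun a _ => abs_sub_le_iff.2 ⟨?_, ?_⟩ <;>
        linarith [measureReal_nonneg (μ := π s) (s := {a}),
          measureReal_nonneg (μ := π' s) (s := {a})]
    _ = 2 := by rw [Finset.sum_add_distrib, sum_policy_real, sum_policy_real]; norm_num

lemma abs_integral_policy_sub_le (π π' : Kernel S A) [IsMarkovKernel π] [IsMarkovKernel π']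
    {g : A → ℝ} {B : ℝ} (hg : ∀ a, |g a| ≤ B) (s : S) :
    |∫ a, g a ∂(π' s) - ∫ a, g a ∂(π s)| ≤ B * policyDist π π' s := by
  rw [integral_policy, integral_policy, ← Finset.sum_sub_distrib, policyDist, Finset.mul_sum]
  refine (Finset.abs_sum_le_sum_abs _ _).trans (Finset.sum_le_sum fun a _ => ?_)
  rw [← sub_mul, abs_mul, mul_comm]
  exact mul_le_mul_of_nonneg_right (hg a) (abs_nonneg _)

/-- By performance difference, the left side is the mean over `s` of the change of `q (s, ·)` when
`π s` is replaced by `π' s`. The state law on the right is that of only one policy, `π'`, so it can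
be held fixed while `π` varies. -/
theorem abs_integral_visit_sub_le (π π' : Kernel S A) [IsMarkovKernel π] [IsMarkovKernel π']
    {r : S × A → ℝ} {B : ℝ} (hr : Measurable r) (hB : ∀ p, |r p| ≤ B) (hB0 : 0 ≤ B) :
    (1 - M.discount) * |∫ p, r p ∂(M.visit π') - ∫ p, r p ∂(M.visit π)|
      ≤ B * ∫ s, policyDist π π' s ∂(M.stateVisit π') := by
  obtain ⟨q, hq⟩ := M.exists_isActionValue π hr hB hB0
  have h := hq.performance_difference hr hB π'
  rw [show ∀ y, (1 - M.discount) * |y| = |(1 - M.discount) * y| from fun y => by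
      rw [abs_mul, abs_of_pos M.one_sub_discount_pos], h,
    integral_visit _ _ (integrable_of_abs_le (measurable_advantage hq.measurable)
      (abs_advantage_le hq.bound)), ← integral_const_mul]
  refine abs_integral_le_integral_abs.trans (integral_mono_of_nonneg
    (ae_of_all _ fun _ => abs_nonneg _) ((integrable_of_abs_le (measurable_policyDist π π')
      (abs_policyDist_le π π')).const_mul _) (ae_of_all _ fun s => ?_))
  simp only [integral_advantage_policy hq.measurable hq.bound]
  exact abs_integral_policy_sub_le π π' (fun a => hq.bound _) s

end FiniteAction

end MDP

open Filter Topology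

/-! ### Softmax -/

section Softmax

variable {A : Type*} [Fintype A]

/-- The softmax distribution. -/
def softmax (g : A → ℝ) (a : A) : ℝ := Real.exp (g a) / ∑ a', Real.exp (g a')

lemma sum_exp_pos [Nonempty A] (g : A → ℝ) : 0 < ∑ a', Real.exp (g a') :=
  Finset.sum_pos (fun _ _ => Real.exp_pos _) Finset.univ_nonempty

lemma softmax_nonneg (g : A → ℝ) (a : A) : 0 ≤ softmax g a :=
  div_nonneg (Real.exp_pos _).le (Finset.sum_nonneg fun _ _ => (Real.exp_pos _).le)

lemma sum_softmax [Nonempty A] (g : A → ℝ) : ∑ a, softmax g a = 1 := by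
  unfold softmax
  rw [← Finset.sum_div, div_self (sum_exp_pos g).ne']

lemma softmax_le_one [Nonempty A] (g : A → ℝ) (a : A) : softmax g a ≤ 1 := by
  rw [← sum_softmax g]
  exact Finset.single_le_sum (fun a _ => softmax_nonneg g a) (Finset.mem_univ a)

lemma softmax_le_exp_mul [Nonempty A] {g g' : A → ℝ} {L : ℝ} (h : ∀ a, |g a - g' a| ≤ L) (a : A) :
    softmax g a ≤ Real.exp (2 * L) * softmax g' a := by
  have h1 : Real.exp (g a) ≤ Real.exp L * Real.exp (g' a) := by
    rw [← Real.exp_add]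
    exact Real.exp_le_exp.2 (by linarith [(abs_le.1 (h a)).2])
  have h2 : Real.exp (-L) * ∑ a', Real.exp (g' a') ≤ ∑ a', Real.exp (g a') := by
    rw [Finset.mul_sum]
    refine Finset.sum_le_sum fun a' _ => ?_
    rw [← Real.exp_add]
    exact Real.exp_le_exp.2 (by linarith [(abs_le.1 (h a')).1])
  unfold softmax
  calc _ ≤ (Real.exp L * Real.exp (g' a)) / (Real.exp (-L) * ∑ a', Real.exp (g' a')) := by
        gcongr
    _ = _ := by
        rw [mul_div_mul_comm, ← Real.exp_sub]
        congr 2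
        ring

lemma abs_softmax_sub_le [Nonempty A] {g g' : A → ℝ} {L : ℝ} (h : ∀ a, |g a - g' a| ≤ L)
    (hL : 2 * L ≤ 1) (a : A) : |softmax g a - softmax g' a| ≤ 4 * L := by
  have hL0 : 0 ≤ L := (abs_nonneg _).trans (h a)
  have h0 : Real.exp (2 * L) - 1 ≤ 4 * L := by
    -- The hypothesis `2 * L ≤ 1` serves to linearize the exponential, `exp x - 1 ≤ 2x`.
    have := Real.abs_exp_sub_one_le (x := 2 * L) (by rwa [abs_of_nonneg (by positivity)])
    rw [abs_of_nonneg (a := 2 * L) (by positivity)] at this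
    linarith [le_abs_self (Real.exp (2 * L) - 1)]
  have h1 := softmax_le_exp_mul h a
  have h2 := softmax_le_exp_mul (g := g') (g' := g) (fun a => by rw [abs_sub_comm]; exact h a) a
  rw [abs_sub_le_iff]
  constructor
  · nlinarith [softmax_le_one g' a, softmax_nonneg g' a]
  · nlinarith [softmax_le_one g a, softmax_nonneg g a]

lemma hasDerivWithinAt_softmax [Nonempty A] {g : ℝ → A → ℝ} {g' : A → ℝ} {s : Set ℝ} {t : ℝ}
    (h : ∀ a, HasDerivWithinAt (fun t => g t a) (g' a) s t) (a : A) :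
    HasDerivWithinAt (fun t => softmax (g t) a)
      (softmax (g t) a * (g' a - ∑ a', softmax (g t) a' * g' a')) s t := by
  have h1 : HasDerivWithinAt (fun t => ∑ a', Real.exp (g t a'))
      (∑ a', Real.exp (g t a') * g' a') s t := HasDerivWithinAt.fun_sum fun a' _ => (h a').exp
  refine ((h a).exp.div h1 (sum_exp_pos _).ne').congr_deriv ?_
  have : ∑ a', softmax (g t) a' * g' a'
      = (∑ a', Real.exp (g t a') * g' a') / ∑ a', Real.exp (g t a') := by
    rw [Finset.sum_div]
    exact Finset.sum_congr rfl fun a' _ => by unfold softmax; ring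
  rw [this, softmax]
  have := (sum_exp_pos (g t)).ne'
  field_simp

end Softmax

/-! ### The network -/

section Network

variable {m d : ℕ}

lemma block_add_smul (θ v : Params m d) (t : ℝ) (r : Fin m) :
    block (θ + t • v) r = block θ r + t • block v r := rfl

lemma block_neg (v : Params m d) (r : Fin m) : block (-v) r = -block v r := rfl

lemma block_sub (θ v : Params m d) (r : Fin m) : block (θ - v) r = block θ r - block v r := rfl

lemma continuous_block (r : Fin m) : Continuous fun θ : Params m d => block θ r := by
  unfold block; fun_prop

lemma continuous_network : Continuous fun z : (Fin m → ℝ) × Params m d × EuclideanSpace ℝ (Fin d)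
    => network z.1 z.2.1 z.2.2 := by
  have := fun r : Fin m => continuous_block (d := d) r
  unfold network
  refine continuous_const.mul (continuous_finsetSum _ fun r _ => ?_)
  exact ((continuous_apply r).comp continuous_fst).mul
    (((continuous_snd.comp continuous_snd).inner
      ((this r).comp (continuous_fst.comp continuous_snd))).max continuous_const)

lemma abs_network_sub_le (b : Fin m → ℝ) (θ θ' : Params m d) (x : EuclideanSpace ℝ (Fin d))
    (hx : ‖x‖ = 1) : |network b θ x - network b θ' x|
      ≤ 1 / √(m : ℝ) * ∑ r, |b r| * ‖block θ r - block θ' r‖ := by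
  unfold network
  rw [← mul_sub, abs_mul, abs_of_nonneg (by positivity), ← Finset.sum_sub_distrib]
  gcongr
  refine (Finset.abs_sum_le_sum_abs _ _).trans (Finset.sum_le_sum fun r _ => ?_)
  rw [← mul_sub, abs_mul]
  gcongr
  refine (abs_max_sub_max_le_abs _ _ _).trans ?_
  rw [← inner_sub_right]
  have h := abs_real_inner_le_norm x (block θ r - block θ' r)
  simpa [hx] using h

/-- One-sided derivative of `t ↦ max (y + t z) 0` at `0`. -/
def reluDeriv (y z : ℝ) : ℝ := if 0 < y then z else if y = 0 then max z 0 else 0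

lemma hasDerivWithinAt_relu (y z : ℝ) :
    HasDerivWithinAt (fun t : ℝ => max (y + t * z) 0) (reluDeriv y z) (Set.Ici 0) 0 := by
  have hlin : HasDerivAt (fun t : ℝ => y + t * z) z 0 := by
    simpa using ((hasDerivAt_id (0 : ℝ)).mul_const z).const_add y
  have hc : ContinuousAt (fun t : ℝ => y + t * z) 0 := hlin.continuousAt
  unfold reluDeriv
  split_ifs with h1 h2
  · refine (hlin.congr_of_eventuallyEq ?_).hasDerivWithinAt
    filter_upwards [hc.eventually (lt_mem_nhds (by simpa using h1))] with t ht
    exact max_eq_left ht.le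
  -- At the kink the map is `t * max z 0`, but only for `t ≥ 0`; hence the derivative from the
  -- right.
  · subst h2
    have : HasDerivWithinAt (fun t : ℝ => t * max z 0) (max z 0) (Set.Ici 0) 0 := by
      simpa using ((hasDerivAt_id (0 : ℝ)).mul_const (max z 0)).hasDerivWithinAt
    refine this.congr (fun t ht => ?_) (by simp)
    rw [zero_add, mul_max_of_nonneg _ _ ht, mul_zero]
  · refine ((hasDerivAt_const (0 : ℝ) (0 : ℝ)).congr_of_eventuallyEq ?_).hasDerivWithinAt
    have h3 : y < 0 := lt_of_le_of_ne (not_lt.1 h1) h2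
    filter_upwards [hc.eventually (gt_mem_nhds (by simpa using h3))] with t ht
    exact max_eq_right (le_of_lt ht)

lemma abs_reluDeriv_le (y z : ℝ) : |reluDeriv y z| ≤ |z| := by
  unfold reluDeriv
  split_ifs
  · exact le_rfl
  · simpa using abs_max_sub_max_le_abs z 0 0
  · simp

/-- Symmetric step function. -/
def halfStep (y : ℝ) : ℝ := if 0 < y then 1 else if y = 0 then 1 / 2 else 0

/-- At the kink `max z 0 - max (-z) 0 = z`. Half the difference of the right derivatives in opposite
directions is thus linear in `z` even there, with slope `1/2`, which is the reason for the middle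
value of `halfStep`. -/
lemma reluDeriv_sub_reluDeriv_neg (y z : ℝ) :
    reluDeriv y z - reluDeriv y (-z) = 2 * (halfStep y * z) := by
  unfold reluDeriv halfStep
  split_ifs
  · ring
  · rcases le_total z 0 with h | h
    · rw [max_eq_right h, max_eq_left (by linarith)]; ring
    · rw [max_eq_left h, max_eq_right (by linarith)]; ring
  · ring

/-- Derivative of the network from the right in the direction `v`. -/
def networkDeriv (b : Fin m → ℝ) (θ v : Params m d) (x : EuclideanSpace ℝ (Fin d)) : ℝ :=
  (1 / √(m : ℝ)) * ∑ r, b r * reluDeriv (inner ℝ x (block θ r)) (inner ℝ x (block v r))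

lemma hasDerivWithinAt_network (b : Fin m → ℝ) (θ v : Params m d)
    (x : EuclideanSpace ℝ (Fin d)) :
    HasDerivWithinAt (fun t : ℝ => network b (θ + t • v) x) (networkDeriv b θ v x)
      (Set.Ici 0) 0 := by
  unfold network networkDeriv
  refine HasDerivWithinAt.const_mul _ (HasDerivWithinAt.fun_sum fun r _ =>
    HasDerivWithinAt.const_mul _ ?_)
  simpa only [block_add_smul, inner_add_right, inner_smul_right] using
    hasDerivWithinAt_relu (inner ℝ x (block θ r)) (inner ℝ x (block v r))

lemma measurable_reluDeriv : Measurable fun z : ℝ × ℝ => reluDeriv z.1 z.2 := by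
  unfold reluDeriv
  refine Measurable.ite (measurableSet_lt measurable_const measurable_fst) measurable_snd
    (Measurable.ite (measurableSet_eq_fun measurable_fst measurable_const)
      (measurable_snd.max measurable_const) measurable_const)

lemma measurable_halfStep : Measurable halfStep := by
  unfold halfStep
  exact Measurable.ite (measurableSet_lt measurable_const measurable_id) measurable_const
    (Measurable.ite (measurableSet_eq_fun measurable_id measurable_const)
      measurable_const measurable_const)

lemma measurable_networkDeriv (b : Fin m → ℝ) (θ v : Params m d) :
    Measurable (networkDeriv b θ v) := by
  unfold networkDeriv
  refine (Finset.measurable_sum _ fun r _ => Measurable.const_mul ?_ _).const_mul _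
  exact measurable_reluDeriv.comp ((measurable_id.inner_const).prodMk (measurable_id.inner_const))

lemma abs_networkDeriv_le (b : Fin m → ℝ) (θ v : Params m d) (x : EuclideanSpace ℝ (Fin d))
    (hx : ‖x‖ = 1) :
    |networkDeriv b θ v x| ≤ 1 / √(m : ℝ) * ∑ r, |b r| * ‖block v r‖ := by
  unfold networkDeriv
  rw [abs_mul, abs_of_nonneg (by positivity)]
  gcongr
  refine (Finset.abs_sum_le_sum_abs _ _).trans (Finset.sum_le_sum fun r _ => ?_)
  rw [abs_mul]
  gcongr
  refine (abs_reluDeriv_le _ _).trans ?_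
  simpa [hx] using abs_real_inner_le_norm x (block v r)

end Network

/-! ### Energy-based policies -/

section Policy

variable {S A : Type*} [MeasurableSpace S] [Fintype A] [MeasurableSpace A]
  [MeasurableSingletonClass A] {m d : ℕ} {x : S × A → EuclideanSpace ℝ (Fin d)}

lemma neuralPolicy_apply (hx : Measurable x) (τ : ℝ) (b : Fin m → ℝ) (θ : Params m d) (s : S) :
    neuralPolicy x τ b θ s = Measure.count.withDensity fun a =>
      ENNReal.ofReal (softmax (fun a => τ * network b θ (x (s, a))) a) := by
  have hn : Measurable fun p : S × A => network b θ (x p) :=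
    (continuous_network.measurable).comp
      (measurable_const.prodMk (measurable_const.prodMk hx))
  have hden : Measurable fun p : S × A => ∑ a', Real.exp (τ * network b θ (x (p.1, a'))) := by
    refine Finset.measurable_sum _ fun a' _ => Real.measurable_exp.comp (Measurable.const_mul ?_ _)
    exact hn.comp (measurable_fst.prodMk measurable_const)
  unfold neuralPolicy
  rw [Kernel.withDensity_apply]
  · rfl
  · exact ((Real.measurable_exp.comp (hn.const_mul _)).div hden).ennreal_ofReal

lemma neuralPolicy_singleton (hx : Measurable x) (τ : ℝ) (b : Fin m → ℝ) (θ : Params m d) (s : S)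
    (a : A) : neuralPolicy x τ b θ s {a}
      = ENNReal.ofReal (softmax (fun a => τ * network b θ (x (s, a))) a) := by
  rw [neuralPolicy_apply hx, withDensity_apply _ (measurableSet_singleton a)]
  simp

lemma neuralPolicy_real (hx : Measurable x) (τ : ℝ) (b : Fin m → ℝ) (θ : Params m d) (s : S)
    (a : A) : (neuralPolicy x τ b θ s).real {a}
      = softmax (fun a => τ * network b θ (x (s, a))) a := by
  rw [measureReal_def, neuralPolicy_singleton hx, ENNReal.toReal_ofReal (softmax_nonneg _ _)]

lemma isMarkovKernel_neuralPolicy [Nonempty A] (hx : Measurable x) (τ : ℝ) (b : Fin m → ℝ)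
    (θ : Params m d) : IsMarkovKernel (neuralPolicy x τ b θ) := by
  refine ⟨fun s => ⟨?_⟩⟩
  have : (Set.univ : Set A) = ↑(Finset.univ : Finset A) := by simp
  rw [this, ← sum_measure_singleton]
  simp only [neuralPolicy_singleton hx]
  rw [← ENNReal.ofReal_sum_of_nonneg fun a _ => softmax_nonneg _ a, sum_softmax,
    ENNReal.ofReal_one]

lemma policyDist_neuralPolicy_le [Nonempty A] (hx : Measurable x) {τ : ℝ} {b b' : Fin m → ℝ}
    {θ θ' : Params m d} {s : S} {L : ℝ}
    (h : ∀ a, |τ * network b' θ' (x (s, a)) - τ * network b θ (x (s, a))| ≤ L) (hL : 2 * L ≤ 1) :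
    MDP.policyDist (neuralPolicy x τ b θ) (neuralPolicy x τ b' θ') s
      ≤ Fintype.card A * (4 * L) := by
  unfold MDP.policyDist
  simp only [neuralPolicy_real hx]
  refine (Finset.sum_le_card_nsmul _ _ (4 * L) fun a _ => ?_).trans (by simp)
  exact abs_softmax_sub_le h hL a

/-- The softmax probabilities are continuous in the parameters at each state, and the change of
reward is bounded by their distance averaged over the visitation measure at the base point `z₀`, so
dominated convergence applies. It is used to make the gap measurable as a function of the random
parameters. -/
theorem continuous_totalReward_neuralPolicy [Nonempty A] (M : MDP S A) {Q : ℝ} (hQ : 0 ≤ Q)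
    (hM : M.RewardBound Q) (hx : Measurable x) (τ : ℝ) :
    Continuous fun z : (Fin m → ℝ) × Params m d =>
      M.totalReward (neuralPolicy x τ z.1 z.2) := by
  have := fun b (θ : Params m d) => isMarkovKernel_neuralPolicy hx τ b θ
  rw [continuous_iff_continuousAt]
  intro z₀
  rw [ContinuousAt, tendsto_iff_dist_tendsto_zero]
  have hlim : Tendsto (fun z : (Fin m → ℝ) × Params m d => (1 - M.discount)⁻¹ *
      (Q * ∫ s, MDP.policyDist (neuralPolicy x τ z.1 z.2) (neuralPolicy x τ z₀.1 z₀.2) s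
        ∂(M.stateVisit (neuralPolicy x τ z₀.1 z₀.2)))) (𝓝 z₀) (𝓝 0) := by
    have : Tendsto (fun z : (Fin m → ℝ) × Params m d =>
      ∫ s, MDP.policyDist (neuralPolicy x τ z.1 z.2) (neuralPolicy x τ z₀.1 z₀.2) s
        ∂(M.stateVisit (neuralPolicy x τ z₀.1 z₀.2))) (𝓝 z₀)
        (𝓝 (∫ s, (0 : ℝ) ∂(M.stateVisit (neuralPolicy x τ z₀.1 z₀.2)))) := by
      refine tendsto_integral_filter_of_dominated_convergence (fun _ => 2)
        (Eventually.of_forall fun z => (MDP.measurable_policyDist _ _).aestronglyMeasurable)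
        (Eventually.of_forall fun z => ae_of_all _ fun s => MDP.abs_policyDist_le _ _ s)
        (integrable_const _) (ae_of_all _ fun s => ?_)
      unfold MDP.policyDist
      simp only [neuralPolicy_real hx]
      have hcn : ∀ a, Continuous fun z : (Fin m → ℝ) × Params m d =>
          network z.1 z.2 (x (s, a)) := fun a =>
        continuous_network.comp
          (continuous_fst.prodMk (continuous_snd.prodMk continuous_const))
      have hc : Continuous fun z : (Fin m → ℝ) × Params m d => ∑ a,
          |softmax (fun a => τ * network z₀.1 z₀.2 (x (s, a))) a -
            softmax (fun a => τ * network z.1 z.2 (x (s, a))) a| := by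
        unfold softmax
        refine continuous_finsetSum _ fun a _ => (continuous_const.sub (Continuous.div ?_ ?_
          fun z => (sum_exp_pos _).ne')).abs
        · exact Real.continuous_exp.comp (continuous_const.mul (hcn a))
        · exact continuous_finsetSum _ fun a' _ =>
            Real.continuous_exp.comp (continuous_const.mul (hcn a'))
      simpa using hc.tendsto z₀
    simpa using (this.const_mul Q).const_mul (1 - M.discount)⁻¹
  refine squeeze_zero (fun _ => dist_nonneg) (fun z => ?_) hlim
  rw [dist_comm, Real.dist_eq, M.totalReward_eq _ hM, M.totalReward_eq _ hM,
    ← div_eq_inv_mul, le_div_iff₀' M.one_sub_discount_pos]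
  exact M.abs_integral_visit_sub_le _ _ M.measurable_meanReward (M.abs_meanReward_le hM) hQ

end Policy

/-- Both sides are the covariance of `q` and `ψ` when `p` is a probability vector; centring may be
moved from the score to the action value, which turns the latter into the advantage. -/
lemma sum_mul_sub_sum_mul {A : Type*} [Fintype A] (p q ψ : A → ℝ) :
    ∑ a, p a * (ψ a - ∑ a', p a' * ψ a') * q a
      = ∑ a, p a * ((q a - ∑ a', p a' * q a') * ψ a) := by
  have h1 : ∑ a, p a * (ψ a - ∑ a', p a' * ψ a') * q a
      = ∑ a, p a * q a * ψ a - (∑ a, p a * q a) * ∑ a', p a' * ψ a' := by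
    rw [Finset.sum_mul, ← Finset.sum_sub_distrib]
    exact Finset.sum_congr rfl fun a _ => by ring
  have h2 : ∑ a, p a * ((q a - ∑ a', p a' * q a') * ψ a)
      = ∑ a, p a * q a * ψ a - (∑ a, p a * q a) * ∑ a', p a' * ψ a' := by
    rw [Finset.mul_sum, ← Finset.sum_sub_distrib]
    exact Finset.sum_congr rfl fun a _ => by ring
  rw [h1, h2]

/-! ### One-sided policy gradient and the first-order condition -/

section PolicyGradient

variable {S A : Type*} [MeasurableSpace S] [Fintype A] [MeasurableSpace A]
  [MeasurableSingletonClass A] {m d : ℕ} {x : S × A → EuclideanSpace ℝ (Fin d)}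

/-- Policy gradient theorem: derivative from the right of the expected total reward. -/
theorem hasDerivWithinAt_totalReward [Nonempty A] (M : MDP S A) {Q : ℝ} (hQ : 0 ≤ Q)
    (hM : M.RewardBound Q) (hx : Measurable x) (hx1 : ∀ p, ‖x p‖ = 1) {τ : ℝ} (hτ : 0 < τ)
    (b : Fin m → ℝ) (θ v : Params m d) {q : S × A → ℝ}
    (hq : M.IsActionValue (neuralPolicy x τ b θ) M.meanReward Q q) :
    HasDerivWithinAt (fun t : ℝ => M.totalReward (neuralPolicy x τ b (θ + t • v)))
      ((1 - M.discount)⁻¹ * (τ * ∫ p, MDP.advantage (neuralPolicy x τ b θ) q p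
        * networkDeriv b θ v (x p) ∂(M.visit (neuralPolicy x τ b θ)))) (Set.Ici 0) 0 := by
  have hMk := fun b (θ : Params m d) => isMarkovKernel_neuralPolicy hx τ b θ
  set π : ℝ → Kernel S A := fun t => neuralPolicy x τ b (θ + t • v) with hπ
  have hπ0 : neuralPolicy x τ b θ = π 0 := by simp [hπ]
  rw [hπ0] at hq ⊢
  have hMk' : ∀ t, IsMarkovKernel (π t) := fun t => hMk _ _
  have hγ := M.one_sub_discount_pos
  set L : ℝ := 1 / √(m : ℝ) * ∑ r, |b r| * ‖block v r‖ with hL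
  have hL0 : 0 ≤ L := by positivity
  have hnet : ∀ t : ℝ, 0 ≤ t → ∀ p,
      |τ * network b (θ + t • v) (x p) - τ * network b (θ + (0 : ℝ) • v) (x p)| ≤ τ * (t * L) := by
    intro t ht p
    rw [← mul_sub, abs_mul, abs_of_pos hτ]
    gcongr
    refine (abs_network_sub_le b _ _ _ (hx1 p)).trans (le_of_eq ?_)
    rw [hL]
    simp only [block_add_smul, zero_smul, add_zero, add_sub_cancel_left, norm_smul,
      Real.norm_eq_abs, abs_of_nonneg ht]
    rw [Finset.mul_sum, Finset.mul_sum, Finset.mul_sum]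
    exact Finset.sum_congr rfl fun r _ => by ring
  set N : ℝ := Fintype.card A * (4 * (τ * L)) with hN
  have hN0 : 0 ≤ N := by positivity
  have hsmall : ∀ᶠ t : ℝ in 𝓝[>] 0, 0 < t ∧ 2 * (τ * (t * L)) ≤ 1 := by
    refine (eventually_mem_nhdsWithin).and ?_
    have hc : Continuous fun t : ℝ => 2 * (τ * (t * L)) := by fun_prop
    have : ∀ᶠ t : ℝ in 𝓝 0, 2 * (τ * (t * L)) < 1 :=
      hc.continuousAt.eventually_lt continuousAt_const (by norm_num)
    exact mem_nhdsWithin_of_mem_nhds (this.mono fun t ht => ht.le)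
  have hdist : ∀ t : ℝ, 0 < t → 2 * (τ * (t * L)) ≤ 1 → ∀ s,
      MDP.policyDist (π 0) (π t) s ≤ t * N := by
    intro t ht h2 s
    refine (policyDist_neuralPolicy_le hx (fun a => hnet t ht.le (s, a)) h2).trans (le_of_eq ?_)
    rw [hN]; ring
  -- Difference quotient of the policy at a state, weighted by the action value of `π 0`. It is
  -- bounded uniformly in small `t > 0` because the softmax changes by at most `t * N`.
  let G : ℝ → S → ℝ := fun t s => t⁻¹ * ∫ a, MDP.advantage (π 0) q (s, a) ∂(π t s)
  have hGm : ∀ t, Measurable (G t) := fun t =>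
    (MDP.measurable_integral_policy (π t) (MDP.measurable_advantage hq.measurable)).const_mul _
  have hGeq : ∀ t s, G t s = t⁻¹ * (∫ a, q (s, a) ∂(π t s) - ∫ a, q (s, a) ∂(π 0 s)) :=
    fun t s => by simp only [G, MDP.integral_advantage_policy hq.measurable hq.bound]
  have hGb : ∀ t : ℝ, 0 < t → 2 * (τ * (t * L)) ≤ 1 → ∀ s, |G t s| ≤ Q * N := by
    intro t ht h2 s
    rw [hGeq, abs_mul, abs_of_pos (inv_pos.2 ht), ← div_eq_inv_mul, div_le_iff₀ ht]
    refine (MDP.abs_integral_policy_sub_le (π 0) (π t) (fun a => hq.bound _) s).trans ?_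
    calc _ ≤ Q * (t * N) := by gcongr; exact hdist t ht h2 s
      _ = _ := by ring
  -- The slope is the mean of `G t` under the visitation measure of `π t`. It is written as the mean
  -- under the fixed measure of `π 0`, which has the gradient as its limit, minus a change of
  -- measure, which vanishes.
  have hslope : ∀ t : ℝ, 0 < t → slope (fun t : ℝ => M.totalReward (π t)) 0 t
      = (1 - M.discount)⁻¹ * (∫ s, G t s ∂(M.stateVisit (π 0)) -
        (∫ s, G t s ∂(M.stateVisit (π 0)) - ∫ s, G t s ∂(M.stateVisit (π t)))) := by
    intro t ht
    have h := hq.performance_difference M.measurable_meanReward (M.abs_meanReward_le hM) (π t)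
    rw [MDP.integral_visit _ _ (MDP.integrable_of_abs_le
      (MDP.measurable_advantage hq.measurable) (MDP.abs_advantage_le hq.bound))] at h
    rw [slope_def_field, M.totalReward_eq _ hM, M.totalReward_eq _ hM, sub_sub_cancel, sub_zero]
    simp only [G]
    rw [integral_const_mul, ← h]
    field_simp
  rw [← hasDerivWithinAt_Ioi_iff_Ici, hasDerivWithinAt_iff_tendsto_slope' (by simp)]
  have hlim1 : Tendsto (fun t : ℝ => ∫ s, G t s ∂(M.stateVisit (π 0))) (𝓝[>] 0)
      (𝓝 (τ * ∫ p, MDP.advantage (π 0) q p * networkDeriv b θ v (x p) ∂(M.visit (π 0)))) := by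
    have hint : Integrable (fun p => MDP.advantage (π 0) q p * networkDeriv b θ v (x p))
        (M.visit (π 0)) := by
      refine MDP.integrable_of_abs_le (B := 2 * Q * L) ((MDP.measurable_advantage hq.measurable).mul
        ((measurable_networkDeriv b θ v).comp hx)) fun p => ?_
      rw [abs_mul]
      exact mul_le_mul (MDP.abs_advantage_le hq.bound p) (abs_networkDeriv_le b θ v _ (hx1 p))
        (abs_nonneg _) (by positivity)
    rw [MDP.integral_visit _ _ hint, ← integral_const_mul]
    refine tendsto_integral_filter_of_dominated_convergence (fun _ => Q * N)
      (Eventually.of_forall fun t => (hGm t).aestronglyMeasurable)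
      (hsmall.mono fun t ht => ae_of_all _ fun s => hGb t ht.1 ht.2 s)
      (integrable_const _) (ae_of_all _ fun s => ?_)
    have hd := fun a => hasDerivWithinAt_softmax
      (g := fun t a => τ * network b (θ + t • v) (x (s, a)))
      (fun a => (hasDerivWithinAt_network b θ v (x (s, a))).const_mul τ) a
    have hd2 := HasDerivWithinAt.fun_sum (u := Finset.univ)
      fun a _ => (hd a).mul_const (q (s, a))
    rw [← hasDerivWithinAt_Ioi_iff_Ici, hasDerivWithinAt_iff_tendsto_slope' (by simp)] at hd2
    convert hd2 using 2
    · rw [hGeq, slope_def_field, sub_zero, div_eq_inv_mul]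
      simp only [MDP.integral_policy, hπ, neuralPolicy_real hx]
    · rw [sum_mul_sub_sum_mul, MDP.integral_policy, Finset.mul_sum]
      refine Finset.sum_congr rfl fun a _ => ?_
      simp only [hπ, neuralPolicy_real hx, MDP.advantage, MDP.integral_policy]
      ring
  have hlim2 : Tendsto (fun t : ℝ => ∫ s, G t s ∂(M.stateVisit (π 0)) -
      ∫ s, G t s ∂(M.stateVisit (π t))) (𝓝[>] 0) (𝓝 0) := by
    have hz : Tendsto (fun t : ℝ => (1 - M.discount)⁻¹ * (Q * N * (t * N))) (𝓝[>] 0) (𝓝 0) := by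
      have hc : Continuous fun t : ℝ => (1 - M.discount)⁻¹ * (Q * N * (t * N)) := by fun_prop
      simpa using (hc.tendsto 0).mono_left nhdsWithin_le_nhds
    refine squeeze_zero_norm' (hsmall.mono fun t ht => ?_) hz
    have hGi : ∀ t', ∫ p, G t p.1 ∂(M.visit (π t')) = ∫ s, G t s ∂(M.stateVisit (π t')) := by
      intro t'
      have hi : Integrable (fun p : S × A => G t p.1) (M.visit (π t')) :=
        MDP.integrable_of_abs_le ((hGm t).comp measurable_fst) fun p => hGb t ht.1 ht.2 p.1
      rw [MDP.integral_visit _ _ hi]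
      simp
    -- `G t` is used as a reward function: it is bounded and the two policies are at distance at
    -- most `t * N`, so the change of measure costs `O(t)`.
    have h := M.abs_integral_visit_sub_le (π t) (π 0) (r := fun p => G t p.1)
      ((hGm t).comp measurable_fst) (fun p => hGb t ht.1 ht.2 p.1) (by positivity)
    rw [hGi, hGi, MDP.policyDist_comm] at h
    rw [Real.norm_eq_abs, ← div_eq_inv_mul, le_div_iff₀' hγ]
    refine h.trans ?_
    gcongr
    refine (le_abs_self _).trans ?_
    refine MDP.abs_integral_le_of_abs_le fun s => ?_
    rw [abs_of_nonneg (Finset.sum_nonneg fun _ _ => abs_nonneg _)]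
    exact hdist t ht.1 ht.2 s
  have := (hlim1.sub hlim2).const_mul (1 - M.discount)⁻¹
  rw [sub_zero] at this
  exact this.congr' (eventually_mem_nhdsWithin.mono fun t ht => (hslope t ht).symm)

/-- Symmetric linearization of the network at `θ`. -/
def halfLinear (b : Fin m → ℝ) (θ v : Params m d) (x : EuclideanSpace ℝ (Fin d)) : ℝ :=
  (1 / √(m : ℝ)) * ∑ r, b r * (halfStep (inner ℝ x (block θ r)) * inner ℝ x (block v r))

lemma networkDeriv_sub_networkDeriv_neg (b : Fin m → ℝ) (θ v : Params m d)
    (x : EuclideanSpace ℝ (Fin d)) :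
    networkDeriv b θ v x - networkDeriv b θ (-v) x = 2 * halfLinear b θ v x := by
  unfold networkDeriv halfLinear
  rw [← mul_sub, ← Finset.sum_sub_distrib, mul_left_comm 2, Finset.mul_sum _ _ (2 : ℝ)]
  congr 1
  refine Finset.sum_congr rfl fun r _ => ?_
  rw [block_neg, inner_neg_right, ← mul_sub, reluDeriv_sub_reluDeriv_neg]
  ring

/-- First-order condition at a stationary point. -/
theorem IsStationaryPoint.integral_advantage_le [Nonempty A] {M : MDP S A} {Q : ℝ} (hQ : 0 ≤ Q)
    (hM : M.RewardBound Q) (hx : Measurable x) (hx1 : ∀ p, ‖x p‖ = 1) {τ : ℝ} (hτ : 0 < τ)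
    {b : Fin m → ℝ} {W₀ θ' : Params m d} {R : ℝ} (h : IsStationaryPoint M x τ b W₀ R θ')
    {q : S × A → ℝ} (hq : M.IsActionValue (neuralPolicy x τ b θ') M.meanReward Q q)
    {θ : Params m d} (hθ : θ ∈ Metric.closedBall W₀ R) :
    ∫ p, MDP.advantage (neuralPolicy x τ b θ') q p * halfLinear b θ' (θ - θ') (x p)
      ∂(M.visit (neuralPolicy x τ b θ')) ≤ 0 := by
  obtain ⟨-, hd, hs⟩ := h
  have hMk := isMarkovKernel_neuralPolicy hx τ b θ'
  -- The network may have kinks at `θ'`, but the total reward is assumed differentiable there, so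
  -- its gradient has to agree with the right derivative in every direction.
  have key : ∀ v : Params m d,
      inner ℝ (∇ (fun θ => M.totalReward (neuralPolicy x τ b θ)) θ') v
        = (1 - M.discount)⁻¹ * (τ * ∫ p, MDP.advantage (neuralPolicy x τ b θ') q p
          * networkDeriv b θ' v (x p) ∂(M.visit (neuralPolicy x τ b θ'))) := fun v => by
    have h1 := hasDerivWithinAt_totalReward M hQ hM hx hx1 hτ b θ' v hq
    have hl : HasDerivAt (fun t : ℝ => θ' + t • v) v 0 := by
      simpa using ((hasDerivAt_id (0 : ℝ)).smul_const v).const_add θ'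
    have h2 : HasDerivAt (fun t : ℝ => M.totalReward (neuralPolicy x τ b (θ' + t • v)))
        (inner ℝ (∇ (fun θ => M.totalReward (neuralPolicy x τ b θ)) θ') v) 0 := by
      have h3 := hd.hasGradientAt.hasFDerivAt
      have h4 : θ' = θ' + (0 : ℝ) • v := by simp
      have := HasFDerivAt.comp_hasDerivAt_of_eq (0 : ℝ) h3 hl h4
      exact this.congr_deriv (by simp)
    exact (uniqueDiffOn_Ici (0 : ℝ) 0 Set.self_mem_Ici).eq_deriv _ h2.hasDerivWithinAt h1
  set σ := M.visit (neuralPolicy x τ b θ')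
  set Ad := MDP.advantage (neuralPolicy x τ b θ') q
  have hint : ∀ v : Params m d, Integrable (fun p => Ad p * networkDeriv b θ' v (x p)) σ :=
    fun v => by
      refine MDP.integrable_of_abs_le
        (B := 2 * Q * (1 / √(m : ℝ) * ∑ r, |b r| * ‖block v r‖))
        ((MDP.measurable_advantage hq.measurable).mul
        ((measurable_networkDeriv b θ' v).comp hx)) fun p => ?_
      rw [abs_mul]
      exact mul_le_mul (MDP.abs_advantage_le hq.bound p) (abs_networkDeriv_le b θ' v _ (hx1 p))
        (abs_nonneg _) (by positivity)
  have e1 := key (θ - θ')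
  have e2 := key (-(θ - θ'))
  -- Combining the directions `v` and `-v` replaces the one-sided derivatives by the linearization
  -- with `halfStep`, which is linear in the direction and so can be split into `θ` and `θ'` parts.
  have e3 : ∫ p, Ad p * halfLinear b θ' (θ - θ') (x p) ∂σ
      = 2⁻¹ * (∫ p, Ad p * networkDeriv b θ' (θ - θ') (x p) ∂σ
        - ∫ p, Ad p * networkDeriv b θ' (-(θ - θ')) (x p) ∂σ) := by
    rw [← integral_sub (hint _) (hint _), ← integral_const_mul]
    congr 1
    ext p
    rw [← mul_sub, networkDeriv_sub_networkDeriv_neg]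
    ring
  rw [inner_neg_right] at e2
  have e4 := hs θ hθ
  have hpos : 0 < (1 - M.discount)⁻¹ * τ := mul_pos (inv_pos.2 M.one_sub_discount_pos) hτ
  rw [e3]
  nlinarith

end PolicyGradient

/-! ### Linearization error and random features -/

/-- Step function. -/
def gate (y : ℝ) : ℝ := if 0 < y then 1 else 0

lemma gate_nonneg (y : ℝ) : 0 ≤ gate y := by unfold gate; split_ifs <;> norm_num

lemma gate_le_one (y : ℝ) : gate y ≤ 1 := by unfold gate; split_ifs <;> norm_num

lemma abs_gate_le (y : ℝ) : |gate y| ≤ 1 := by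
  rw [abs_of_nonneg (gate_nonneg y)]; exact gate_le_one y

lemma measurable_gate : Measurable gate :=
  Measurable.ite measurableSet_Ioi measurable_const measurable_const

lemma gate_mul_self (y : ℝ) : gate y * y = max y 0 := by
  unfold gate
  split_ifs with h
  · rw [one_mul, max_eq_left h.le]
  · rw [zero_mul, max_eq_right (not_lt.1 h)]

lemma halfStep_mul_self (y : ℝ) : halfStep y * y = max y 0 := by
  unfold halfStep
  split_ifs with h h2
  · rw [one_mul, max_eq_left h.le]
  · simp [h2]
  · rw [zero_mul, max_eq_right (not_lt.1 h)]

/-- The signs of `y` and `z` can disagree, or one of them vanish, only if `z` is at least as far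
from `y` as `0` is. -/
lemma gate_sub_halfStep (y z : ℝ) : |gate y - halfStep z| ≤ if |y| ≤ |z - y| then 1 else 0 := by
  unfold gate halfStep
  by_cases h : |y| ≤ |z - y|
  · rw [if_pos h]
    split_ifs <;> norm_num
  · rw [if_neg h]
    rw [not_le] at h
    rcases lt_trichotomy y 0 with hy | hy | hy
    · rw [abs_of_neg hy] at h
      have := (abs_lt.1 h).2
      simp [hy.not_gt, show ¬ 0 < z by linarith, show z ≠ 0 by linarith]
    · subst hy
      exact absurd h (by simp)
    · rw [abs_of_pos hy] at h
      have := (abs_lt.1 h).1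
      simp [hy, show 0 < z by linarith]

section Linear

variable {m d : ℕ}

/-- Linearization of the network at `W` in the direction `v`. -/
def gateLinear (b : Fin m → ℝ) (W v : Params m d) (x : EuclideanSpace ℝ (Fin d)) : ℝ :=
  (1 / √(m : ℝ)) * ∑ r, b r * (gate (inner ℝ x (block W r)) * inner ℝ x (block v r))

lemma gateLinear_self (b : Fin m → ℝ) (W : Params m d) (x : EuclideanSpace ℝ (Fin d)) :
    gateLinear b W W x = network b W x := by
  simp only [gateLinear, gate_mul_self, network]

/-- Homogeneity again: the value `1/2` at a kink is harmless because it multiplies `0`. -/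
lemma halfLinear_self (b : Fin m → ℝ) (W : Params m d) (x : EuclideanSpace ℝ (Fin d)) :
    halfLinear b W W x = network b W x := by
  simp only [halfLinear, halfStep_mul_self, network]

lemma halfLinear_sub (b : Fin m → ℝ) (W v v' : Params m d) (x : EuclideanSpace ℝ (Fin d)) :
    halfLinear b W (v - v') x = halfLinear b W v x - halfLinear b W v' x := by
  simp only [halfLinear, block_sub, inner_sub_right, mul_sub, Finset.sum_sub_distrib]

lemma gateLinear_add (b : Fin m → ℝ) (W v v' : Params m d) (x : EuclideanSpace ℝ (Fin d)) :
    gateLinear b W (v + v') x = gateLinear b W v x + gateLinear b W v' x := by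
  have : ∀ r, block (v + v') r = block v r + block v' r := fun r => rfl
  simp only [gateLinear, this, inner_add_right, mul_add, Finset.sum_add_distrib]

lemma inner_feature (b : Fin m → ℝ) (θ v : Params m d) (x : EuclideanSpace ℝ (Fin d)) :
    inner ℝ (feature b θ x) v = gateLinear b θ v x := by
  simp only [PiLp.inner_apply, feature, gateLinear, gate, block, Fintype.sum_prod_type,
    Finset.mul_sum]
  refine Finset.sum_congr rfl fun r _ => Finset.sum_congr rfl fun k _ => ?_
  simp only [RCLike.inner_apply, conj_trivial]
  split_ifs <;> ring

/-- Positive homogeneity of the ReLU. It identifies the last term of `uFun` with the network at `θ`.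
-/
lemma inner_feature_self (b : Fin m → ℝ) (θ : Params m d) (x : EuclideanSpace ℝ (Fin d)) :
    inner ℝ (feature b θ x) θ = network b θ x := by
  rw [inner_feature, gateLinear_self]

lemma sum_norm_block_sq (v : Params m d) : ∑ r, ‖block v r‖ ^ 2 = ‖v‖ ^ 2 := by
  simp only [EuclideanSpace.norm_sq_eq, block, Fintype.sum_prod_type]

/-- The gates of a block at `W` and at `θ'` differ only if `x` is in the slab where `|xᵀ[W]_r|` is
at most the displacement of the block. On that slab `|xᵀ[θ]_r|` is itself at most the sum of the two
displacements, so no norm of `W` appears. -/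
lemma abs_gateLinear_sub_halfLinear_le {b : Fin m → ℝ} (hb : ∀ r, |b r| = 1)
    (W θ' θ : Params m d) {x : EuclideanSpace ℝ (Fin d)} (hx : ‖x‖ = 1) :
    |gateLinear b W θ x - halfLinear b θ' θ x| ≤ 1 / √(m : ℝ) * ∑ r,
      (if |inner ℝ (block W r) x| ≤ ‖block (θ' - W) r‖ then 1 else 0) *
        (‖block (θ' - W) r‖ + ‖block (θ - W) r‖) := by
  unfold gateLinear halfLinear
  rw [← mul_sub, abs_mul, abs_of_nonneg (by positivity), ← Finset.sum_sub_distrib]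
  gcongr
  refine (Finset.abs_sum_le_sum_abs _ _).trans (Finset.sum_le_sum fun r _ => ?_)
  rw [← mul_sub, abs_mul, hb, one_mul, ← sub_mul, abs_mul, real_inner_comm x (block W r)]
  have hi : ∀ v : Params m d, |inner ℝ x (block (v - W) r)| ≤ ‖block (v - W) r‖ := fun v => by
    simpa [hx] using abs_real_inner_le_norm x (block (v - W) r)
  have h0 : |inner ℝ x (block θ' r) - inner ℝ x (block W r)| ≤ ‖block (θ' - W) r‖ := by
    rw [← inner_sub_right]; exact hi θ'
  have h1 := gate_sub_halfStep (inner ℝ x (block W r)) (inner ℝ x (block θ' r))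
  by_cases h : |inner ℝ x (block W r)| ≤ ‖block (θ' - W) r‖
  · rw [if_pos h]
    refine mul_le_mul (h1.trans ?_) ?_ (abs_nonneg _) zero_le_one
    · split_ifs <;> norm_num
    · have h2 := hi θ
      rw [block_sub, inner_sub_right] at h2
      rw [block_sub θ W]
      have h3 := abs_sub_abs_le_abs_sub (inner ℝ x (block θ r)) (inner ℝ x (block W r))
      linarith
  · rw [if_neg (fun hh => h (hh.trans h0))] at h1
    rw [if_neg h, le_antisymm h1 (abs_nonneg _)]
    simp

end Linear

/-! ### The gate moment as dual object to random features -/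

section Moment

variable {X : Type*} [MeasurableSpace X] {d : ℕ}

/-- The moment `∫ A(p) 1{wᵀ x(p) > 0} x(p) dσ(p)`. -/
def gateMoment (σ : Measure X) (Ad : X → ℝ) (x : X → EuclideanSpace ℝ (Fin d))
    (w : EuclideanSpace ℝ (Fin d)) : EuclideanSpace ℝ (Fin d) :=
  ∫ p, (Ad p * gate (inner ℝ w (x p))) • x p ∂σ

variable {σ : Measure X} [IsProbabilityMeasure σ] {Ad : X → ℝ} {B : ℝ}
  {x : X → EuclideanSpace ℝ (Fin d)}

lemma norm_gateMoment_integrand_le {X : Type*} {Ad : X → ℝ} {B : ℝ}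
    {x : X → EuclideanSpace ℝ (Fin d)} (hAd : ∀ p, |Ad p| ≤ B) (hx1 : ∀ p, ‖x p‖ = 1)
    (w : EuclideanSpace ℝ (Fin d)) (p : X) : ‖(Ad p * gate (inner ℝ w (x p))) • x p‖ ≤ B := by
  rw [norm_smul, hx1, mul_one, Real.norm_eq_abs, abs_mul]
  calc _ ≤ B * 1 := mul_le_mul (hAd p) (abs_gate_le _) (abs_nonneg _) ((abs_nonneg _).trans (hAd p))
    _ = B := mul_one B

lemma measurable_gate_inner (hx : Measurable x) :
    Measurable fun z : EuclideanSpace ℝ (Fin d) × X => gate (inner ℝ z.1 (x z.2)) :=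
  measurable_gate.comp (measurable_fst.inner (hx.comp measurable_snd))

lemma integrable_gateMoment (hm : Measurable Ad) (hAd : ∀ p, |Ad p| ≤ B) (hx : Measurable x)
    (hx1 : ∀ p, ‖x p‖ = 1) (w : EuclideanSpace ℝ (Fin d)) :
    Integrable (fun p => (Ad p * gate (inner ℝ w (x p))) • x p) σ :=
  Integrable.of_bound ((hm.mul ((measurable_gate_inner hx).comp
    measurable_prodMk_left)).smul hx).aestronglyMeasurable B
    (ae_of_all _ (norm_gateMoment_integrand_le hAd hx1 w))

lemma norm_gateMoment_le (hAd : ∀ p, |Ad p| ≤ B) (hx1 : ∀ p, ‖x p‖ = 1)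
    (w : EuclideanSpace ℝ (Fin d)) : ‖gateMoment σ Ad x w‖ ≤ B := by
  simpa [gateMoment] using norm_integral_le_of_norm_le_const (μ := σ)
    (ae_of_all _ (norm_gateMoment_integrand_le hAd hx1 w))

lemma measurable_gateMoment (hm : Measurable Ad) (hx : Measurable x) :
    Measurable (gateMoment σ Ad x) := by
  have : StronglyMeasurable fun z : EuclideanSpace ℝ (Fin d) × X =>
      (Ad z.2 * gate (inner ℝ z.1 (x z.2))) • x z.2 :=
    (((hm.comp measurable_snd).mul (measurable_gate_inner hx)).smul
      (hx.comp measurable_snd)).stronglyMeasurable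
  exact this.integral_prod_right'.measurable

lemma inner_gateMoment (hm : Measurable Ad) (hAd : ∀ p, |Ad p| ≤ B) (hx : Measurable x)
    (hx1 : ∀ p, ‖x p‖ = 1) (w v : EuclideanSpace ℝ (Fin d)) :
    inner ℝ (gateMoment σ Ad x w) v
      = ∫ p, Ad p * (gate (inner ℝ w (x p)) * inner ℝ (x p) v) ∂σ := by
  rw [real_inner_comm, gateMoment, ← integral_inner (integrable_gateMoment hm hAd hx hx1 w) v]
  simp only [inner_smul_right, real_inner_comm v, mul_assoc]

/-- The gate moment represents the pairing of `Ad` with a linearized network as a functional of the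
direction `v`. The next lemma is the counterpart for infinite width, obtained by exchanging the
integrals over `w` and `p`. -/
lemma integral_mul_gateLinear {m : ℕ} (hm : Measurable Ad) (hAd : ∀ p, |Ad p| ≤ B)
    (hx : Measurable x) (hx1 : ∀ p, ‖x p‖ = 1) (b : Fin m → ℝ) (W v : Params m d) :
    ∫ p, Ad p * gateLinear b W v (x p) ∂σ
      = 1 / √(m : ℝ) * ∑ r, b r * inner ℝ (gateMoment σ Ad x (block W r)) (block v r) := by
  have hi : ∀ r, Integrable (fun p => Ad p * (gate (inner ℝ (block W r) (x p)) *
      inner ℝ (x p) (block v r))) σ := fun r => by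
    have := (integrable_gateMoment (σ := σ) hm hAd hx hx1 (block W r)).const_inner (𝕜 := ℝ)
      (block v r)
    simpa only [inner_smul_right, real_inner_comm (block v r), mul_assoc] using this
  simp only [inner_gateMoment hm hAd hx hx1, ← integral_const_mul]
  rw [← integral_finsetSum _ fun r _ => (hi r).const_mul (b r), ← integral_const_mul]
  congr 1
  ext p
  rw [gateLinear, mul_left_comm, Finset.mul_sum]
  congr 1
  refine Finset.sum_congr rfl fun r _ => ?_
  rw [real_inner_comm (x p) (block W r)]
  ring

lemma integral_mul_integral_gate {μ : Measure (EuclideanSpace ℝ (Fin d))} [IsProbabilityMeasure μ]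
    (hm : Measurable Ad) (hAd : ∀ p, |Ad p| ≤ B) (hx : Measurable x) (hx1 : ∀ p, ‖x p‖ = 1)
    {ι : EuclideanSpace ℝ (Fin d) → EuclideanSpace ℝ (Fin d)} (hι : Measurable ι) {R : ℝ}
    (hR : ∀ w, ‖ι w‖ ≤ R) :
    ∫ p, Ad p * (∫ w, gate (inner ℝ w (x p)) * inner ℝ (x p) (ι w) ∂μ) ∂σ
      = ∫ w, inner ℝ (gateMoment σ Ad x w) (ι w) ∂μ := by
  simp only [inner_gateMoment hm hAd hx hx1, ← integral_const_mul]
  refine integral_integral_swap ?_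
  refine Integrable.of_bound (C := B * R) ?_ (ae_of_all _ fun z => ?_)
  · refine Measurable.aestronglyMeasurable ?_
    exact (hm.comp measurable_fst).mul (((measurable_gate_inner hx).comp measurable_swap).mul
      ((hx.comp measurable_fst).inner (hι.comp measurable_snd)))
  · have h1 : |inner ℝ (x z.1) (ι z.2)| ≤ R := by
      refine (abs_real_inner_le_norm _ _).trans ?_
      rw [hx1, one_mul]; exact hR _
    simp only [Function.uncurry, Real.norm_eq_abs, abs_mul]
    refine mul_le_mul (hAd _) ?_ (by positivity) ((abs_nonneg _).trans (hAd z.1))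
    calc _ ≤ 1 * R := mul_le_mul (abs_gate_le _) h1 (abs_nonneg _) zero_le_one
      _ = R := one_mul R

/-- Empirical norm of the gate moment. -/
def empNorm {m : ℕ} (h : EuclideanSpace ℝ (Fin d) → EuclideanSpace ℝ (Fin d)) (W : Params m d) :
    ℝ := √((1 / m : ℝ) * ∑ r, ‖h (block W r)‖ ^ 2)

/-- Direction in the ball aligned with the gate moment. -/
lemma exists_aligned_direction {m : ℕ} {b : Fin m → ℝ} (hb : ∀ r, |b r| = 1)
    (h : EuclideanSpace ℝ (Fin d) → EuclideanSpace ℝ (Fin d)) (W : Params m d) {R : ℝ}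
    (hR : 0 ≤ R) : ∃ v : Params m d, ‖v‖ ≤ R ∧
      1 / √(m : ℝ) * ∑ r, b r * inner ℝ (h (block W r)) (block v r) = R * empNorm h W := by
  set N : ℝ := √(∑ r, ‖h (block W r)‖ ^ 2) with hN
  have hN2 : N ^ 2 = ∑ r, ‖h (block W r)‖ ^ 2 := Real.sq_sqrt (by positivity)
  have hN0 : 0 ≤ N := Real.sqrt_nonneg _
  have hb2 : ∀ r, b r * b r = 1 := fun r => by rw [← abs_mul_abs_self, hb, one_mul]
  -- Equality case of Cauchy–Schwarz, the signs `b` being cancelled by `b r * b r = 1`. If `N = 0`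
  -- the quotient is `0`, so `v = 0`, and both sides of the claim vanish.
  let v : Params m d := WithLp.toLp 2 fun rk => (R / N) * b rk.1 * h (block W rk.1) rk.2
  have hv : ∀ r, block v r = ((R / N) * b r) • h (block W r) := fun r => rfl
  refine ⟨v, ?_, ?_⟩
  · rw [← abs_of_nonneg hR, ← abs_of_nonneg (norm_nonneg v), ← sq_le_sq, ← sum_norm_block_sq]
    have : ∀ r, ‖block v r‖ ^ 2 = (R / N) ^ 2 * ‖h (block W r)‖ ^ 2 := fun r => by
      rw [hv, norm_smul, Real.norm_eq_abs, abs_mul, hb, mul_one, mul_pow, sq_abs]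
    simp only [this]
    rw [← Finset.mul_sum, ← hN2, ← mul_pow]
    by_cases h0 : N = 0
    · simp [h0]; positivity
    · rw [div_mul_cancel₀ _ h0]
  · have : ∀ r, b r * inner ℝ (h (block W r)) (block v r) = (R / N) * ‖h (block W r)‖ ^ 2 :=
      fun r => by
        rw [hv, inner_smul_right, real_inner_self_eq_norm_sq]
        linear_combination (R / N * ‖h (block W r)‖ ^ 2) * hb2 r
    simp only [this]
    rw [← Finset.mul_sum, ← hN2, empNorm, ← hN2, Real.sqrt_mul (by positivity),
      Real.sqrt_sq hN0, Real.sqrt_div zero_le_one, Real.sqrt_one]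
    by_cases h0 : N = 0
    · simp [h0]
    · field_simp

end Moment

/-! ### Deterministic bound on the optimality gap of a stationary point -/

section SlabSum

lemma sum_mul_add_le {ι : Type*} [Fintype ι] {p u v : ι → ℝ} {R : ℝ} (hR : 0 ≤ R)
    (hu : ∑ i, u i ^ 2 ≤ R ^ 2) (hv : ∑ i, v i ^ 2 ≤ R ^ 2) :
    ∑ i, p i * (u i + v i) ≤ 2 * R * √(∑ i, p i ^ 2) := by
  have h1 := Real.sum_mul_le_sqrt_mul_sqrt Finset.univ p u
  have h2 := Real.sum_mul_le_sqrt_mul_sqrt Finset.univ p v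
  have h3 : √(∑ i, u i ^ 2) ≤ R := Real.sqrt_le_iff.2 ⟨hR, hu⟩
  have h4 : √(∑ i, v i ^ 2) ≤ R := Real.sqrt_le_iff.2 ⟨hR, hv⟩
  simp only [mul_add, Finset.sum_add_distrib]
  nlinarith [Real.sqrt_nonneg (∑ i, p i ^ 2)]

/-- Number of indices with norm at most `t`, as a real number. -/
def smallCount {m d : ℕ} (t : ℝ) (W : Params m d) : ℝ :=
  ∑ r, if ‖block W r‖ ≤ t then 1 else 0

/-- Regularity bounds `p r` by `c * u r / ‖block W r‖`, but the inverse square norm of a Gaussian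
vector is not integrable for `d = 2`. Blocks of norm at most `t` are therefore only counted, with `p
r ≤ 1`, and the others use the norm bound `t`. -/
lemma sum_slab_sq_le {m d : ℕ} {W : Params m d} {p u : Fin m → ℝ} {c R t : ℝ} (hc : 0 ≤ c)
    (ht : 0 < t) (hp0 : ∀ r, 0 ≤ p r) (hp1 : ∀ r, p r ≤ 1)
    (hp : ∀ r, block W r ≠ 0 → p r ≤ c * u r / ‖block W r‖) (hu0 : ∀ r, 0 ≤ u r)
    (hu : ∑ r, u r ^ 2 ≤ R ^ 2) :
    ∑ r, p r ^ 2 ≤ smallCount t W + c ^ 2 * R ^ 2 / t ^ 2 := by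
  have h : ∀ r, p r ^ 2 ≤ (if ‖block W r‖ ≤ t then 1 else 0) + c ^ 2 / t ^ 2 * u r ^ 2 := by
    intro r
    split_ifs with h
    · have : p r ^ 2 ≤ 1 := pow_le_one₀ (hp0 r) (hp1 r)
      have : 0 ≤ c ^ 2 / t ^ 2 * u r ^ 2 := by positivity
      linarith
    · rw [not_le] at h
      have h0 : block W r ≠ 0 := fun h0 => by simp [h0] at h; linarith
      have h2 : p r ≤ c * u r / t :=
        (hp r h0).trans (div_le_div_of_nonneg_left (mul_nonneg hc (hu0 r)) ht h.le)
      calc p r ^ 2 ≤ (c * u r / t) ^ 2 := pow_le_pow_left₀ (hp0 r) h2 2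
        _ = _ := by rw [div_pow, mul_pow]; ring
  calc _ ≤ ∑ r, ((if ‖block W r‖ ≤ t then 1 else 0) + c ^ 2 / t ^ 2 * u r ^ 2) :=
        Finset.sum_le_sum fun r _ => h r
    _ ≤ _ := by
      rw [Finset.sum_add_distrib, ← Finset.mul_sum, smallCount, mul_div_right_comm]
      gcongr

end SlabSum

section Gap

variable {S A : Type*} [MeasurableSpace S] [MeasurableSpace A] {m d : ℕ}
  {x : S × A → EuclideanSpace ℝ (Fin d)}

/-- Every slab of half-width `u ≥ 0` has small probability. -/
lemma RegularVisits.visit_slab_le {M : MDP S A} {c : ℝ} (h : RegularVisits M x c)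
    (π : Kernel S A) [IsMarkovKernel π] {y : EuclideanSpace ℝ (Fin d)}
    (hy : y ≠ 0) {u : ℝ} (hu : 0 ≤ u) :
    (M.visit π).real {p | |inner ℝ y (x p)| ≤ u} ≤ c * u / ‖y‖ := by
  rw [MDP.visit_eq_compProd]
  have hc : Continuous fun u' : ℝ => c * u' / ‖y‖ := by fun_prop
  -- The assumption covers `u > 0` only; `u = 0` also occurs, for blocks that have not moved, and
  -- follows by letting the width decrease.
  refine ge_of_tendsto ((hc.tendsto u).mono_left (nhdsWithin_le_nhds (s := Set.Ioi u)))
    (eventually_mem_nhdsWithin.mono fun u' hu' => ?_)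
  refine le_trans ?_ (h π π inferInstance inferInstance y hy u' (hu.trans_lt hu')).1
  exact measureReal_mono fun p (hp : _ ≤ u) => le_trans hp (le_of_lt hu')

/-- Integrating the pointwise bound turns slab indicators into probabilities. Cauchy–Schwarz against
the displacements, whose squares sum to at most `R ^ 2`, leaves the sum of squared probabilities,
bounded by `sum_slab_sq_le`. -/
lemma integral_abs_gateLinear_sub_halfLinear_le {M : MDP S A} {c : ℝ} (hc : 0 ≤ c)
    (h : RegularVisits M x c) (hx : Measurable x) (hx1 : ∀ p, ‖x p‖ = 1)
    (π : Kernel S A) [IsMarkovKernel π] {b : Fin m → ℝ} (hb : ∀ r, |b r| = 1)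
    {W θ' θ : Params m d} {R t : ℝ} (hR : 0 ≤ R) (ht : 0 < t) (hball : ‖θ' - W‖ ≤ R)
    (hθ : ‖θ - W‖ ≤ R) :
    ∫ p, |gateLinear b W θ (x p) - halfLinear b θ' θ (x p)| ∂(M.visit π)
      ≤ 1 / √(m : ℝ) * (2 * R * √(smallCount t W + c ^ 2 * R ^ 2 / t ^ 2)) := by
  set σ := M.visit π
  have hms : ∀ r, MeasurableSet {p | |inner ℝ (block W r) (x p)| ≤ ‖block (θ' - W) r‖} := fun r =>
    measurableSet_le (measurable_const.inner hx).abs measurable_const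
  have hite : ∀ r p, (if |inner ℝ (block W r) (x p)| ≤ ‖block (θ' - W) r‖ then (1 : ℝ) else 0)
      = Set.indicator {p | |inner ℝ (block W r) (x p)| ≤ ‖block (θ' - W) r‖} 1 p := fun r p => by
    simp [Set.indicator_apply]
  have hint : ∀ r, Integrable (fun p => (if |inner ℝ (block W r) (x p)| ≤ ‖block (θ' - W) r‖
      then (1 : ℝ) else 0) * (‖block (θ' - W) r‖ + ‖block (θ - W) r‖)) σ := fun r => by
    simp only [hite]
    exact ((integrable_const (1 : ℝ)).indicator (hms r)).mul_const _
  calc _ ≤ ∫ p, 1 / √(m : ℝ) * ∑ r, (if |inner ℝ (block W r) (x p)| ≤ ‖block (θ' - W) r‖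
          then (1 : ℝ) else 0) * (‖block (θ' - W) r‖ + ‖block (θ - W) r‖) ∂σ :=
        integral_mono_of_nonneg (ae_of_all _ fun _ => abs_nonneg _)
          ((integrable_finsetSum _ fun r _ => hint r).const_mul _)
          (ae_of_all _ fun p => abs_gateLinear_sub_halfLinear_le hb W θ' θ (hx1 p))
    _ = 1 / √(m : ℝ) * ∑ r, σ.real {p | |inner ℝ (block W r) (x p)| ≤ ‖block (θ' - W) r‖} *
          (‖block (θ' - W) r‖ + ‖block (θ - W) r‖) := by
        rw [integral_const_mul, integral_finsetSum _ fun r _ => hint r]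
        congr 1
        refine Finset.sum_congr rfl fun r _ => ?_
        simp only [hite]
        rw [integral_mul_const, integral_indicator_one (hms r)]
    _ ≤ _ := by
        have hsq : ∀ v : Params m d, ‖v - W‖ ≤ R → ∑ r, ‖block (v - W) r‖ ^ 2 ≤ R ^ 2 :=
          fun v hv => by rw [sum_norm_block_sq]; exact pow_le_pow_left₀ (norm_nonneg _) hv 2
        gcongr
        refine (sum_mul_add_le hR (hsq _ hball) (hsq _ hθ)).trans ?_
        gcongr
        exact sum_slab_sq_le hc ht (fun r => measureReal_nonneg) (fun r => measureReal_le_one)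
          (fun r hr => h.visit_slab_le π hr (norm_nonneg _)) (fun r => norm_nonneg _) (hsq _ hball)

/-- The optimality gap expressed through the advantage and a function `g` of density ratios. -/
lemma optimality_gap_eq {M : MDP S A} {Q : ℝ} (hM : M.RewardBound Q)
    {π πopt : Kernel S A} [IsMarkovKernel π] [IsMarkovKernel πopt] {q : S × A → ℝ}
    (hq : M.IsActionValue π M.meanReward Q q) (hac : M.visit πopt ≪ M.visit π) :
    Integrable (fun p => ((M.visit πopt).rnDeriv (M.visit π) p).toReal
      - ((M.stateVisit πopt).rnDeriv (M.stateVisit π) p.1).toReal) (M.visit π) ∧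
    (1 - M.discount) * (M.totalReward πopt - M.totalReward π)
      = ∫ p, MDP.advantage π q p * (((M.visit πopt).rnDeriv (M.visit π) p).toReal
      - ((M.stateVisit πopt).rnDeriv (M.stateVisit π) p.1).toReal) ∂(M.visit π) := by
  have hi1 : Integrable (fun p => ((M.visit πopt).rnDeriv (M.visit π) p).toReal) (M.visit π) :=
    Measure.integrable_toReal_rnDeriv
  have hi2 : Integrable (fun s => ((M.stateVisit πopt).rnDeriv (M.stateVisit π) s).toReal)
      (M.stateVisit π) := Measure.integrable_toReal_rnDeriv
  have hi2' : Integrable (fun p : S × A =>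
      ((M.stateVisit πopt).rnDeriv (M.stateVisit π) p.1).toReal) (M.visit π) := by
    have : M.stateVisit π = (M.visit π).map Prod.fst := by
      rw [MDP.visit_eq_compProd]; exact (Measure.fst_compProd _ _).symm
    have h : Integrable (fun s => ((M.stateVisit πopt).rnDeriv (M.stateVisit π) s).toReal)
      ((M.visit π).map Prod.fst) := this ▸ hi2
    exact h.comp_measurable measurable_fst
  have hAm := MDP.measurable_advantage (π := π) hq.measurable
  have hAb := MDP.abs_advantage_le (π := π) hq.bound
  have hb : ∀ {f : S × A → ℝ}, Integrable f (M.visit π) →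
      Integrable (fun p => MDP.advantage π q p * f p) (M.visit π) := fun hf =>
    hf.bdd_mul hAm.aestronglyMeasurable (ae_of_all _ hAb)
  refine ⟨hi1.sub hi2', ?_⟩
  rw [M.totalReward_eq _ hM, M.totalReward_eq _ hM,
    hq.performance_difference M.measurable_meanReward (M.abs_meanReward_le hM)]
  simp only [mul_sub]
  rw [integral_sub (hb hi1) (hb hi2'), MDP.integral_visit _ _ (hb hi2')]
  -- The state ratio is constant in the action, and the advantage has mean zero under its own
  -- policy, so this term contributes nothing.
  simp only [integral_mul_const, MDP.integral_advantage_policy hq.measurable hq.bound, sub_self,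
    zero_mul, integral_zero, sub_zero]
  rw [← integral_rnDeriv_smul hac]
  simp only [smul_eq_mul, mul_comm]

lemma norm_le_of_abs_coord_le {v : EuclideanSpace ℝ (Fin d)} {R : ℝ} (hd : 0 < d) (hR : 0 ≤ R)
    (h : ∀ k, |v k| ≤ R / √(d : ℝ)) : ‖v‖ ≤ R := by
  rw [EuclideanSpace.norm_eq, Real.sqrt_le_iff]
  refine ⟨hR, ?_⟩
  calc ∑ k, ‖v k‖ ^ 2 ≤ ∑ _k : Fin d, (R / √(d : ℝ)) ^ 2 :=
        Finset.sum_le_sum fun k _ => pow_le_pow_left₀ (norm_nonneg _) (h k) 2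
    _ = R ^ 2 := by
        have : (d : ℝ) ≠ 0 := by positivity
        rw [Finset.sum_const, Finset.card_univ, Fintype.card_fin, div_pow,
          Real.sq_sqrt (Nat.cast_nonneg d), nsmul_eq_mul]
        field_simp

instance (ι : Type*) [Fintype ι] (d : ℕ) : IsProbabilityMeasure (gaussianInit ι d) :=
  Measure.isProbabilityMeasure_map (by fun_prop)

lemma measurable_network_comp {X : Type*} [MeasurableSpace X]
    {x : X → EuclideanSpace ℝ (Fin d)} (hx : Measurable x) (b : Fin m → ℝ) (θ : Params m d) :
    Measurable fun p => network b θ (x p) :=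
  continuous_network.measurable.comp (measurable_const.prodMk (measurable_const.prodMk hx))

lemma abs_network_le (b : Fin m → ℝ) (θ : Params m d) {y : EuclideanSpace ℝ (Fin d)}
    (hy : ‖y‖ = 1) : |network b θ y| ≤ 1 / √(m : ℝ) * ∑ r, |b r| * ‖block θ r‖ := by
  have h0 : network b (0 : Params m d) y = 0 := by
    have : ∀ r, block (0 : Params m d) r = 0 := fun r => rfl
    simp [network, this]
  have := abs_network_sub_le b θ 0 y hy
  have hb : ∀ r, block (0 : Params m d) r = 0 := fun r => rfl
  simpa [h0, hb] using this

lemma measurable_integral_gate {X : Type*} [MeasurableSpace X]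
    {μ : Measure (EuclideanSpace ℝ (Fin d))} [IsProbabilityMeasure μ]
    {x : X → EuclideanSpace ℝ (Fin d)} (hx : Measurable x)
    {ι : EuclideanSpace ℝ (Fin d) → EuclideanSpace ℝ (Fin d)} (hι : Measurable ι) :
    Measurable fun p => ∫ w, gate (inner ℝ w (x p)) * inner ℝ (x p) (ι w) ∂μ := by
  have : StronglyMeasurable fun z : X × EuclideanSpace ℝ (Fin d) =>
      gate (inner ℝ z.2 (x z.1)) * inner ℝ (x z.1) (ι z.2) :=
    (((measurable_gate_inner hx).comp measurable_swap).mul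
      ((hx.comp measurable_fst).inner (hι.comp measurable_snd))).stronglyMeasurable
  exact this.integral_prod_right'.measurable

lemma abs_integral_gate_le {X : Type*}
    {μ : Measure (EuclideanSpace ℝ (Fin d))} [IsProbabilityMeasure μ]
    {x : X → EuclideanSpace ℝ (Fin d)} (hx1 : ∀ p, ‖x p‖ = 1)
    {ι : EuclideanSpace ℝ (Fin d) → EuclideanSpace ℝ (Fin d)} {R : ℝ}
    (hι : ∀ w, ‖ι w‖ ≤ R) (p : X) :
    |∫ w, gate (inner ℝ w (x p)) * inner ℝ (x p) (ι w) ∂μ| ≤ R := by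
  refine MDP.abs_integral_le_of_abs_le fun w => ?_
  rw [abs_mul]
  have h1 : |inner ℝ (x p) (ι w)| ≤ R := by
    refine (abs_real_inner_le_norm _ _).trans ?_
    rw [hx1, one_mul]; exact hι _
  calc _ ≤ 1 * R := mul_le_mul (abs_gate_le _) h1 (abs_nonneg _) zero_le_one
    _ = R := one_mul R

variable [Fintype A] [MeasurableSingletonClass A]

/-- The deterministic core: density-ratio identity, stationarity, linearization and duality
combined. The function `Ad` is fixed before `f` and `W` enters only through the moment comparison
and `smallCount`, both of which are later controlled uniformly in `Ad`. -/
theorem optimality_gap_le [Nonempty A] {M : MDP S A} {Q : ℝ} (hQ : 0 < Q) (hd : 0 < d)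
    (hM : M.RewardBound Q) (hx : Measurable x) (hx1 : ∀ p, ‖x p‖ = 1) {c : ℝ} (hc : 0 ≤ c)
    (hreg : RegularVisits M x c) {πopt : Kernel S A} [IsMarkovKernel πopt] {τ : ℝ} (hτ : 0 < τ)
    {b : Fin m → ℝ} (hb : ∀ r, |b r| = 1) {W θ' : Params m d} {R : ℝ} (hR : 0 ≤ R)
    (hst : IsStationaryPoint M x τ b W R θ')
    (hac : M.visit πopt ≪ M.visit (neuralPolicy x τ b θ')) {t : ℝ} (ht : 0 < t) :
    ∃ Ad : S × A → ℝ, Measurable Ad ∧ (∀ p, |Ad p| ≤ 2 * Q) ∧ ∀ f ∈ FRInfty x b W R,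
    Integrable (fun p => f p - uFun M x τ πopt b θ' p) (M.visit (neuralPolicy x τ b θ')) ∧
    (1 - M.discount) * (M.totalReward πopt - M.totalReward (neuralPolicy x τ b θ'))
      ≤ 2 * Q * ∫ p, |f p - uFun M x τ πopt b θ' p| ∂(M.visit (neuralPolicy x τ b θ'))
        + R * (∫ w, ‖gateMoment (M.visit (neuralPolicy x τ b θ')) Ad x w‖ ∂(gaussianInit (Fin d) d)
          - empNorm (gateMoment (M.visit (neuralPolicy x τ b θ')) Ad x) W)
        + 2 * Q * (1 / √(m : ℝ) * (2 * R * √(smallCount t W + c ^ 2 * R ^ 2 / t ^ 2))) := by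
  have hMk := isMarkovKernel_neuralPolicy hx τ b θ'
  obtain ⟨q, hq⟩ := M.exists_isActionValue (neuralPolicy x τ b θ') M.measurable_meanReward
    (M.abs_meanReward_le hM) hQ.le
  set π := neuralPolicy x τ b θ' with hπ
  set σ := M.visit π with hσ
  set Ad := MDP.advantage π q with hAd
  have hAm : Measurable Ad := MDP.measurable_advantage hq.measurable
  have hAb : ∀ p, |Ad p| ≤ 2 * Q := MDP.abs_advantage_le hq.bound
  refine ⟨Ad, hAm, hAb, fun f hf => ?_⟩
  obtain ⟨ι, hιm, hιb, hf⟩ := hf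
  have hιR : ∀ w, ‖ι w‖ ≤ R := fun w => norm_le_of_abs_coord_le hd hR (hιb w)
  set h := gateMoment σ Ad x with hh
  have hAI : ∀ {f : S × A → ℝ}, Integrable f σ → Integrable (fun p => Ad p * f p) σ := fun hf =>
    hf.bdd_mul hAm.aestronglyMeasurable (ae_of_all _ hAb)
  obtain ⟨hri, hgap⟩ := optimality_gap_eq hM hq hac
  -- The competitor `W + v` depends on the advantage at `θ'`; this is allowed, since stationarity
  -- holds against every point of the ball.
  obtain ⟨v, hvR, hv⟩ := exists_aligned_direction hb h W hR
  set θ := W + v with hθ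
  have hθB : θ ∈ Metric.closedBall W R := by simpa [hθ] using hvR
  have hst1 := hst.integral_advantage_le hQ.le hM hx hx1 hτ hq hθB
  have hnet : ∀ ϑ : Params m d, Integrable (fun p => network b ϑ (x p)) σ := fun ϑ =>
    MDP.integrable_of_abs_le (measurable_network_comp hx b ϑ)
      fun p => abs_network_le b ϑ (hx1 p)
  set g : S × A → ℝ := fun p => ∫ w, gate (inner ℝ w (x p)) * inner ℝ (x p) (ι w)
    ∂(gaussianInit (Fin d) d) with hg
  have hfg : ∀ p, f p = network b W (x p) + g p := fun p => by
    rw [hf]; rfl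
  have hgi : Integrable g σ := MDP.integrable_of_abs_le (measurable_integral_gate hx hιm)
    (abs_integral_gate_le hx1 hιR)
  have hfi : Integrable f σ := ((hnet W).add hgi).congr (ae_of_all _ fun p => (hfg p).symm)
  have huf : ∀ p, uFun M x τ πopt b θ' p = (((M.visit πopt).rnDeriv σ p).toReal
      - ((M.stateVisit πopt).rnDeriv (M.stateVisit π) p.1).toReal) + network b θ' (x p) :=
    fun p => by rw [uFun, inner_feature_self]
  have hui : Integrable (uFun M x τ πopt b θ') σ :=
    (hri.add (hnet θ')).congr (ae_of_all _ fun p => (huf p).symm)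
  refine ⟨hfi.sub hui, ?_⟩
  have hhalf : ∀ v, Integrable (fun p => halfLinear b θ' v (x p)) σ := fun v => by
    have hm : Measurable fun p => halfLinear b θ' v (x p) := by
      unfold halfLinear
      refine (Finset.measurable_sum _ fun r _ => Measurable.const_mul ?_ _).const_mul _
      exact (measurable_halfStep.comp (hx.inner measurable_const)).mul (hx.inner measurable_const)
    refine MDP.integrable_of_abs_le (B := 1 / √(m : ℝ) * ∑ r, |b r| * ‖block v r‖ ) hm fun p => ?_
    have h1 := networkDeriv_sub_networkDeriv_neg b θ' v (x p)
    have h2 := abs_networkDeriv_le b θ' v (x p) (hx1 p)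
    have h3 := abs_networkDeriv_le b θ' (-v) (x p) (hx1 p)
    simp only [block_neg, norm_neg] at h3
    rw [abs_le] at h2 h3 ⊢
    constructor <;> linarith [h2.1, h2.2, h3.1, h3.2]
  have hglin : ∀ v, Integrable (fun p => gateLinear b W v (x p)) σ := fun v => by
    have hm : Measurable fun p => gateLinear b W v (x p) := by
      unfold gateLinear
      refine (Finset.measurable_sum _ fun r _ => Measurable.const_mul ?_ _).const_mul _
      exact (measurable_gate.comp (hx.inner measurable_const)).mul (hx.inner measurable_const)
    refine MDP.integrable_of_abs_le (B := 1 / √(m : ℝ) * ∑ r, |b r| * ‖block v r‖ ) hm fun p => ?_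
    unfold gateLinear
    rw [abs_mul, abs_of_nonneg (by positivity)]
    gcongr
    refine (Finset.abs_sum_le_sum_abs _ _).trans (Finset.sum_le_sum fun r _ => ?_)
    rw [abs_mul, abs_mul]
    gcongr
    have := abs_real_inner_le_norm (x p) (block v r)
    rw [hx1, one_mul] at this
    calc _ ≤ 1 * ‖block v r‖ := mul_le_mul (abs_gate_le _) this (abs_nonneg _) zero_le_one
      _ = _ := one_mul _
  -- Approximation error, infinite minus finite width, linearization error, first-order term. The
  -- network at `W` cancels because `gateLinear b W θ` contains it, the network at `θ'` because
  -- `halfLinear b θ' θ'` equals it.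
  have hsplit : ∀ p, Ad p * (((M.visit πopt).rnDeriv σ p).toReal
      - ((M.stateVisit πopt).rnDeriv (M.stateVisit π) p.1).toReal)
      = Ad p * (uFun M x τ πopt b θ' p - f p) + (Ad p * g p - Ad p * gateLinear b W v (x p))
        + Ad p * (gateLinear b W θ (x p) - halfLinear b θ' θ (x p))
        + Ad p * halfLinear b θ' (θ - θ') (x p) := fun p => by
    rw [huf, hfg, hθ, gateLinear_add, gateLinear_self, halfLinear_sub, halfLinear_self]
    ring
  have i1 := hAI (f := fun p => uFun M x τ πopt b θ' p - f p) (hui.sub hfi)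
  have i2 := hAI hgi
  have i3 := hAI (hglin v)
  have i4 := hAI (f := fun p => gateLinear b W θ (x p) - halfLinear b θ' θ (x p))
    ((hglin θ).sub (hhalf θ))
  have i5 := hAI (hhalf (θ - θ'))
  refine (hgap.trans (integral_congr_ae (ae_of_all _ hsplit))).le.trans ?_
  have i23 : Integrable (fun p => Ad p * g p - Ad p * gateLinear b W v (x p)) σ := i2.sub i3
  have i123 : Integrable (fun p => Ad p * (uFun M x τ πopt b θ' p - f p)
      + (Ad p * g p - Ad p * gateLinear b W v (x p))) σ := i1.add i23
  have i1234 : Integrable (fun p => Ad p * (uFun M x τ πopt b θ' p - f p)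
      + (Ad p * g p - Ad p * gateLinear b W v (x p))
      + Ad p * (gateLinear b W θ (x p) - halfLinear b θ' θ (x p))) σ := i123.add i4
  rw [integral_add i1234 i5, integral_add i123 i4, integral_add i1 i23, integral_sub i2 i3]
  have hle : ∀ {k : S × A → ℝ}, Integrable k σ → ∫ p, Ad p * k p ∂σ ≤ 2 * Q * ∫ p, |k p| ∂σ :=
    fun {k} hk => by
      rw [← integral_const_mul]
      refine integral_mono (hAI hk) (hk.abs.const_mul _) fun p => ?_
      calc Ad p * k p ≤ |Ad p| * |k p| := by rw [← abs_mul]; exact le_abs_self _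
        _ ≤ _ := by gcongr; exact hAb p
  have e1 := hle (k := fun p => uFun M x τ πopt b θ' p - f p) (hui.sub hfi)
  have e4 := hle (k := fun p => gateLinear b W θ (x p) - halfLinear b θ' θ (x p))
    ((hglin θ).sub (hhalf θ))
  have e2 : ∫ p, Ad p * g p ∂σ ≤ R * ∫ w, ‖h w‖ ∂(gaussianInit (Fin d) d) := by
    rw [integral_mul_integral_gate hAm hAb hx hx1 hιm hιR, ← integral_const_mul]
    have hhi : Integrable (fun w => ‖h w‖) (gaussianInit (Fin d) d) :=
      (Integrable.of_bound (measurable_gateMoment hAm hx).aestronglyMeasurable (2 * Q)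
        (ae_of_all _ (norm_gateMoment_le hAb hx1))).norm
    have hin : ∀ w, inner ℝ (h w) (ι w) ≤ R * ‖h w‖ := fun w => by
      rw [mul_comm]
      exact (real_inner_le_norm _ _).trans (mul_le_mul_of_nonneg_left (hιR w) (norm_nonneg _))
    -- If the pairing were not integrable its integral would be `0`, and the bound would hold
    -- trivially.
    by_cases hc : Integrable (fun w => inner ℝ (h w) (ι w)) (gaussianInit (Fin d) d)
    · exact integral_mono hc (hhi.const_mul _) hin
    · rw [integral_undef hc]
      exact integral_nonneg fun w => by positivity
  have e3 : ∫ p, Ad p * gateLinear b W v (x p) ∂σ = R * empNorm h W := by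
    rw [integral_mul_gateLinear hAm hAb hx hx1, hv]
  have e5 := integral_abs_gateLinear_sub_halfLinear_le hc hreg hx hx1 π hb hR ht
    (by simpa [dist_eq_norm] using hst.1) (by simpa [dist_eq_norm] using hθB)
  have e6 : ∫ p, |uFun M x τ πopt b θ' p - f p| ∂σ = ∫ p, |f p - uFun M x τ πopt b θ' p| ∂σ := by
    simp only [abs_sub_comm]
  rw [e6] at e1
  have e7 := mul_le_mul_of_nonneg_left e5 (by positivity : 0 ≤ 2 * Q)
  rw [e3, mul_sub]
  linarith

end Gap

/-! ### Existence of the projection onto the function class -/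

section Hilbert

variable {H : Type*} [NormedAddCommGroup H] [InnerProductSpace ℝ H] [CompleteSpace H]

/-- A substitute for weak compactness. The elements of least norm in the sets have increasing
bounded norms, and the midpoint of two of them lies in the larger set, so the parallelogram law
makes them a Cauchy sequence; its limit lies in every set. -/
lemma nonempty_iInter_of_antitone_convex {K : ℕ → Set H} (hK : Antitone K)
    (hne : ∀ n, (K n).Nonempty) (hcl : ∀ n, IsClosed (K n)) (hcv : ∀ n, Convex ℝ (K n)) {B : ℝ}
    (hB : ∀ F ∈ K 0, ‖F‖ ≤ B) : (⋂ n, K n).Nonempty := by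
  have hmin : ∀ n, ∃ F ∈ K n, ∀ G ∈ K n, ‖F‖ ≤ ‖G‖ := fun n => by
    obtain ⟨F, hF, h⟩ := exists_norm_eq_iInf_of_complete_convex (hne n) (hcl n).isComplete
      (hcv n) 0
    refine ⟨F, hF, fun G hG => ?_⟩
    rw [zero_sub, norm_neg] at h
    rw [h]
    have : BddBelow (Set.range fun w : K n => ‖(0 : H) - w‖) :=
      ⟨0, by rintro _ ⟨w, rfl⟩; exact norm_nonneg _⟩
    simpa using ciInf_le this ⟨G, hG⟩
  choose F hF hFmin using hmin
  have hmono : Monotone fun n => ‖F n‖ ^ 2 := fun n k hnk =>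
    pow_le_pow_left₀ (norm_nonneg _) (hFmin n _ (hK hnk (hF k))) 2
  have hbdd : BddAbove (Set.range fun n => ‖F n‖ ^ 2) := ⟨B ^ 2, by
    rintro _ ⟨n, rfl⟩
    exact pow_le_pow_left₀ (norm_nonneg _) (hB _ (hK (Nat.zero_le n) (hF n))) 2⟩
  have hlim := tendsto_atTop_ciSup hmono hbdd
  have hdist : ∀ n k, n ≤ k → ‖F n - F k‖ ^ 2 ≤ 2 * (‖F k‖ ^ 2 - ‖F n‖ ^ 2) := fun n k hnk => by
    have hmid : (1 / 2 : ℝ) • F n + (1 / 2 : ℝ) • F k ∈ K n :=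
      hcv n (hF n) (hK hnk (hF k)) (by norm_num) (by norm_num) (by norm_num)
    have h1 := hFmin n _ hmid
    rw [← smul_add, norm_smul] at h1
    have h2 := parallelogram_law_with_norm ℝ (F n) (F k)
    norm_num at h1
    nlinarith [norm_nonneg (F n)]
  have hcau : CauchySeq F := by
    rw [Metric.cauchySeq_iff']
    intro ε hε
    obtain ⟨N, hN⟩ := (Metric.tendsto_atTop.1 hlim) (ε ^ 2 / 2) (by positivity)
    refine ⟨N, fun n hn => ?_⟩
    have h1 := hdist N n hn
    have h2 := hN N le_rfl
    have h3 : ‖F n‖ ^ 2 ≤ ⨆ n, ‖F n‖ ^ 2 := le_ciSup hbdd n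
    rw [Real.dist_eq, abs_lt] at h2
    rw [dist_eq_norm, norm_sub_rev]
    refine lt_of_pow_lt_pow_left₀ 2 hε.le ?_
    linarith [h2.1]
  obtain ⟨G, hG⟩ := cauchySeq_tendsto_of_complete hcau
  refine ⟨G, Set.mem_iInter.2 fun n => (hcl n).mem_of_tendsto hG ?_⟩
  filter_upwards [eventually_ge_atTop n] with k hk using hK hk (hF k)

/-- The near-minimizers within `1 / (n + 1)` of the infimum form a decreasing sequence of nonempty
bounded closed convex sets in `H`, and a common point is a minimizer. Thus closedness of the image
`T '' K` need not be known. -/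
lemma exists_norm_sub_le_of_bounded_convex {G : Type*} [NormedAddCommGroup G] [NormedSpace ℝ G]
    (T : H →L[ℝ] G) (u : G) {K : Set H} (hne : K.Nonempty) (hcl : IsClosed K) (hcv : Convex ℝ K)
    {B : ℝ} (hB : ∀ F ∈ K, ‖F‖ ≤ B) : ∃ F ∈ K, ∀ F' ∈ K, ‖T F - u‖ ≤ ‖T F' - u‖ := by
  set I := sInf ((fun F => ‖T F - u‖) '' K) with hI
  have hbd : BddBelow ((fun F => ‖T F - u‖) '' K) :=
    ⟨0, by rintro _ ⟨F, -, rfl⟩; exact norm_nonneg _⟩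
  let Ks : ℕ → Set H := fun n => K ∩ T ⁻¹' Metric.closedBall u (I + 1 / (n + 1))
  obtain ⟨F, hF⟩ := nonempty_iInter_of_antitone_convex (K := Ks)
    (fun n k hnk => Set.inter_subset_inter_right _ (Set.preimage_mono
      (Metric.closedBall_subset_closedBall (by gcongr))))
    (fun n => by
      obtain ⟨_, ⟨F, hF, rfl⟩, h⟩ := exists_lt_of_csInf_lt (hne.image (fun F => ‖T F - u‖))
        (lt_add_of_pos_right I (by positivity : (0 : ℝ) < 1 / (n + 1)))
      exact ⟨F, hF, by simpa [dist_eq_norm] using h.le⟩)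
    (fun n => hcl.inter (Metric.isClosed_closedBall.preimage T.continuous))
    (fun n => hcv.inter ((convex_closedBall _ _).linear_preimage T.toLinearMap))
    (fun F hF => hB F hF.1)
  rw [Set.mem_iInter] at hF
  refine ⟨F, (hF 0).1, fun F' hF' => ?_⟩
  have h1 : ‖T F - u‖ ≤ I := by
    have hl : Tendsto (fun n : ℕ => I + 1 / ((n : ℝ) + 1)) atTop (𝓝 (I + 0)) :=
      tendsto_const_nhds.add tendsto_one_div_add_atTop_nhds_zero_nat
    rw [add_zero] at hl
    exact ge_of_tendsto' hl fun n => by simpa [dist_eq_norm] using (hF n).2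
  exact h1.trans (csInf_le hbd ⟨F', hF', rfl⟩)

end Hilbert

section Projection

variable {X : Type*} {d : ℕ} {μ : Measure (EuclideanSpace ℝ (Fin d))}
  {x : X → EuclideanSpace ℝ (Fin d)}

/-- Infinite-width feature function with weight `ι`. -/
def gateIntegral (μ : Measure (EuclideanSpace ℝ (Fin d))) (x : X → EuclideanSpace ℝ (Fin d))
    (ι : EuclideanSpace ℝ (Fin d) → EuclideanSpace ℝ (Fin d)) (p : X) : ℝ :=
  ∫ w, gate (inner ℝ w (x p)) * inner ℝ (x p) (ι w) ∂μ

lemma gateIntegral_congr {ι ι' : EuclideanSpace ℝ (Fin d) → EuclideanSpace ℝ (Fin d)}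
    (h : ι =ᵐ[μ] ι') : gateIntegral μ x ι = gateIntegral μ x ι' := by
  ext p
  refine integral_congr_ae (h.mono fun w hw => ?_)
  simp only [hw]

lemma integrable_gateIntegral
    {ι : EuclideanSpace ℝ (Fin d) → EuclideanSpace ℝ (Fin d)} (hι : Integrable ι μ) (p : X) :
    Integrable (fun w => gate (inner ℝ w (x p)) * inner ℝ (x p) (ι w)) μ :=
  (hι.const_inner (𝕜 := ℝ) (x p)).bdd_mul
    (measurable_gate.comp (measurable_id.inner measurable_const)).aestronglyMeasurable
    (ae_of_all _ fun _ => abs_gate_le _)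

lemma abs_gateIntegral_le (hx1 : ∀ p, ‖x p‖ = 1)
    {ι : EuclideanSpace ℝ (Fin d) → EuclideanSpace ℝ (Fin d)} (hι : Integrable ι μ) (p : X) :
    |gateIntegral μ x ι p| ≤ ∫ w, ‖ι w‖ ∂μ := by
  refine abs_integral_le_integral_abs.trans (integral_mono (integrable_gateIntegral hι p).abs
    hι.norm fun w => ?_)
  simp only [abs_mul]
  have h1 : |inner ℝ (x p) (ι w)| ≤ ‖ι w‖ := by
    simpa [hx1] using abs_real_inner_le_norm (x p) (ι w)
  calc _ ≤ 1 * ‖ι w‖ := mul_le_mul (abs_gate_le _) h1 (abs_nonneg _) zero_le_one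
    _ = _ := one_mul _

/-- The closed convex set of square-integrable weights with coordinates bounded by `r`. -/
def weightBox (μ : Measure (EuclideanSpace ℝ (Fin d))) (r : ℝ) :
    Set (Lp (EuclideanSpace ℝ (Fin d)) 2 μ) := {F | ∀ᵐ w ∂μ, ∀ k, |F w k| ≤ r}

lemma convex_weightBox (r : ℝ) : Convex ℝ (weightBox μ r) := by
  intro F hF G hG a b ha hb hab
  filter_upwards [hF, hG, Lp.coeFn_add (a • F) (b • G), Lp.coeFn_smul a F, Lp.coeFn_smul b G]
    with w h1 h2 h3 h4 h5 k
  rw [h3, Pi.add_apply, h4, h5]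
  simp only [Pi.smul_apply, PiLp.add_apply, PiLp.smul_apply, smul_eq_mul]
  calc |a * F w k + b * G w k| ≤ a * |F w k| + b * |G w k| := by
        refine (abs_add_le _ _).trans ?_
        rw [abs_mul, abs_mul, abs_of_nonneg ha, abs_of_nonneg hb]
    _ ≤ a * r + b * r := by gcongr; exacts [h1 k, h2 k]
    _ = r := by rw [← add_mul, hab, one_mul]

lemma isClosed_weightBox (r : ℝ) : IsClosed (weightBox μ r) := by
  refine IsSeqClosed.isClosed fun Fs F hFs hlim => ?_
  have h1 : TendstoInMeasure μ (fun n => (Fs n : _ → EuclideanSpace ℝ (Fin d))) atTop F :=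
    tendstoInMeasure_of_tendsto_Lp hlim
  obtain ⟨ns, -, h2⟩ := h1.exists_seq_tendsto_ae
  have h3 : ∀ᵐ w ∂μ, ∀ n k, |Fs n w k| ≤ r := ae_all_iff.2 fun n => hFs n
  filter_upwards [h2, h3] with w hw1 hw2 k
  have h4 : Tendsto (fun n => |Fs (ns n) w k|) atTop (𝓝 |F w k|) :=
    (((EuclideanSpace.proj (𝕜 := ℝ) k).continuous.tendsto _).comp hw1).abs
  exact le_of_tendsto' h4 fun n => hw2 _ k

variable [MeasurableSpace X] {σ : Measure X} [IsProbabilityMeasure σ] [IsProbabilityMeasure μ]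

lemma integrable_coe_Lp (F : Lp (EuclideanSpace ℝ (Fin d)) 2 μ) : Integrable F μ :=
  (Lp.memLp F).integrable (by norm_num)

lemma integral_norm_coe_Lp_le (F : Lp (EuclideanSpace ℝ (Fin d)) 2 μ) : ∫ w, ‖F w‖ ∂μ ≤ ‖F‖ := by
  have h := eLpNorm_le_eLpNorm_of_exponent_le (p := 1) (q := 2) (by norm_num)
    (Lp.aestronglyMeasurable F)
  rw [Lp.norm_def, integral_norm_eq_lintegral_enorm (Lp.aestronglyMeasurable F),
    ← eLpNorm_one_eq_lintegral_enorm]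
  exact ENNReal.toReal_mono (Lp.eLpNorm_ne_top F) h

lemma memLp_gateIntegral (hx : Measurable x) (hx1 : ∀ p, ‖x p‖ = 1)
    (F : Lp (EuclideanSpace ℝ (Fin d)) 2 μ) : MemLp (gateIntegral μ x F) 2 σ :=
  MemLp.of_bound (measurable_integral_gate hx
    (Lp.stronglyMeasurable F).measurable).aestronglyMeasurable ‖F‖ (ae_of_all _ fun p =>
      (abs_gateIntegral_le hx1 (integrable_coe_Lp F) p).trans (integral_norm_coe_Lp_le F))

/-- The operator `ι ↦ gateIntegral ι` from `L²(μ)` to `L²(σ)`. -/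
def gateOperator (σ : Measure X) [IsProbabilityMeasure σ]
    (μ : Measure (EuclideanSpace ℝ (Fin d))) [IsProbabilityMeasure μ] (hx : Measurable x)
    (hx1 : ∀ p, ‖x p‖ = 1) : Lp (EuclideanSpace ℝ (Fin d)) 2 μ →L[ℝ] Lp ℝ 2 σ :=
  LinearMap.mkContinuous
    { toFun := fun F => (memLp_gateIntegral (σ := σ) hx hx1 F).toLp _
      map_add' := fun F G => by
        rw [← MemLp.toLp_add]
        refine MemLp.toLp_congr _ _ (ae_of_all _ fun p => ?_)
        rw [gateIntegral_congr (Lp.coeFn_add F G), Pi.add_apply, gateIntegral, gateIntegral,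
          gateIntegral, ← integral_add (integrable_gateIntegral (integrable_coe_Lp F) p)
          (integrable_gateIntegral (integrable_coe_Lp G) p)]
        simp only [Pi.add_apply, inner_add_right, mul_add]
      map_smul' := fun a F => by
        rw [RingHom.id_apply, ← MemLp.toLp_const_smul]
        refine MemLp.toLp_congr _ _ (ae_of_all _ fun p => ?_)
        rw [gateIntegral_congr (Lp.coeFn_smul a F), Pi.smul_apply, gateIntegral, gateIntegral,
          smul_eq_mul, ← integral_const_mul]
        simp only [Pi.smul_apply, inner_smul_right, mul_left_comm] }
    1 fun F => by
      rw [one_mul]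
      refine (Lp.norm_le_of_ae_bound (norm_nonneg F) ?_).trans (by simp [measureUnivNNReal])
      filter_upwards [(memLp_gateIntegral (σ := σ) hx hx1 F).coeFn_toLp] with p hp
      simp only [LinearMap.coe_mk, AddHom.coe_mk]
      rw [hp]
      exact (abs_gateIntegral_le hx1 (integrable_coe_Lp F) p).trans (integral_norm_coe_Lp_le F)

end Projection

/-! ### Closest element of the random-feature class -/

section ProjectionClass

lemma mem_FRInfty_iff {S A : Type*} {m d : ℕ} {x : S × A → EuclideanSpace ℝ (Fin d)}
    {b : Fin m → ℝ} {W₀ : Params m d} {R : ℝ} {f : S × A → ℝ} :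
    f ∈ FRInfty x b W₀ R ↔ ∃ ι : EuclideanSpace ℝ (Fin d) → EuclideanSpace ℝ (Fin d),
      Measurable ι ∧ (∀ w k, |ι w k| ≤ R / √(d : ℝ)) ∧
      f = fun p => network b W₀ (x p) + gateIntegral (gaussianInit (Fin d) d) x ι p := by
  constructor
  · rintro ⟨ι, h1, h2, h3⟩
    refine ⟨ι, h1, h2, ?_⟩
    ext p; rw [h3]; rfl
  · rintro ⟨ι, h1, h2, rfl⟩
    refine ⟨ι, h1, h2, fun p => ?_⟩
    rfl

variable {S A : Type*} [MeasurableSpace S] [MeasurableSpace A] {m d : ℕ}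
  {x : S × A → EuclideanSpace ℝ (Fin d)} {σ : Measure (S × A)} [IsProbabilityMeasure σ]

/-- Up to the fixed initial network the class is the image of `weightBox` under the bounded operator
`gateOperator`, so a minimizing weight exists even though the class is not shown to be closed in
`L²(σ)`. -/
theorem exists_closest_FRInfty (hd : 0 < d) (hx : Measurable x) (hx1 : ∀ p, ‖x p‖ = 1)
    (b : Fin m → ℝ) (W₀ : Params m d) {R : ℝ} (hR : 0 ≤ R) {u : S × A → ℝ} (hu : Measurable u) :
    ∃ f ∈ FRInfty x b W₀ R, ∀ g ∈ FRInfty x b W₀ R,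
      eLpNorm (f - u) 2 σ ≤ eLpNorm (g - u) 2 σ := by
  set μ := gaussianInit (Fin d) d
  have hr : 0 ≤ R / √(d : ℝ) := by positivity
  have hιF : ∀ ι : EuclideanSpace ℝ (Fin d) → EuclideanSpace ℝ (Fin d), Measurable ι →
      (∀ w k, |ι w k| ≤ R / √(d : ℝ)) → ∃ F ∈ weightBox μ (R / √(d : ℝ)), F =ᵐ[μ] ι := by
    intro ι hι hb
    have hL : MemLp ι 2 μ := MemLp.of_bound hι.aestronglyMeasurable R
      (ae_of_all _ fun w => norm_le_of_abs_coord_le hd hR (hb w))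
    refine ⟨hL.toLp ι, ?_, hL.coeFn_toLp⟩
    filter_upwards [hL.coeFn_toLp] with w hw k
    rw [hw]; exact hb w k
  have h0mem : (fun p => network b W₀ (x p) + gateIntegral μ x (fun _ => 0) p)
      ∈ FRInfty x b W₀ R := mem_FRInfty_iff.2 ⟨fun _ => 0, measurable_const,
        fun w k => by simpa using hr, rfl⟩
  have hnet : MemLp (fun p => network b W₀ (x p)) 2 σ :=
    MemLp.of_bound (measurable_network_comp hx b W₀).aestronglyMeasurable _
      (ae_of_all _ fun p => abs_network_le b W₀ (hx1 p))
  have hgL : ∀ g ∈ FRInfty x b W₀ R, MemLp g 2 σ := by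
    intro g hg
    obtain ⟨ι, h1, h2, rfl⟩ := mem_FRInfty_iff.1 hg
    exact hnet.add (MemLp.of_bound (measurable_integral_gate hx h1).aestronglyMeasurable R
      (ae_of_all _ (abs_integral_gate_le hx1 fun w => norm_le_of_abs_coord_le hd hR (h2 w))))
  by_cases huL : MemLp u 2 σ
  · set v : S × A → ℝ := fun p => u p - network b W₀ (x p) with hv
    have hvL : MemLp v 2 σ := huL.sub hnet
    have hnorm : ∀ F : Lp (EuclideanSpace ℝ (Fin d)) 2 μ,
        eLpNorm ((fun p => network b W₀ (x p) + gateIntegral μ x F p) - u) 2 σ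
          = ENNReal.ofReal ‖gateOperator σ μ hx hx1 F - hvL.toLp v‖ := fun F => by
      have : gateOperator σ μ hx hx1 F - hvL.toLp v
          = ((memLp_gateIntegral (σ := σ) hx hx1 F).sub hvL).toLp _ :=
        (MemLp.toLp_sub (memLp_gateIntegral (σ := σ) hx hx1 F) hvL).symm
      rw [this, Lp.norm_toLp, ENNReal.ofReal_toReal
        ((memLp_gateIntegral (σ := σ) hx hx1 F).sub hvL).2.ne]
      congr 1
      ext p
      simp only [Pi.sub_apply, hv]
      ring
    obtain ⟨F, hF, hmin⟩ := exists_norm_sub_le_of_bounded_convex (gateOperator σ μ hx hx1)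
      (hvL.toLp v) (K := weightBox μ (R / √(d : ℝ)))
      (by obtain ⟨F, hF, -⟩ := hιF (fun _ => 0) measurable_const (fun w k => by simpa using hr)
          exact ⟨F, hF⟩)
      (isClosed_weightBox _) (convex_weightBox _) (B := R) (fun F hF => by
        refine (Lp.norm_le_of_ae_bound (C := R) hR ?_).trans (by simp [measureUnivNNReal])
        filter_upwards [hF] with w hw using norm_le_of_abs_coord_le hd hR hw)
    classical
    have hms : MeasurableSet {w | ∀ k, |F w k| ≤ R / √(d : ℝ)} := by
      have hFm := (Lp.stronglyMeasurable F).measurable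
      rw [Set.ofPred_forall]
      refine MeasurableSet.iInter fun k => measurableSet_le ?_ measurable_const
      exact ((EuclideanSpace.proj (𝕜 := ℝ) k).continuous.measurable.comp hFm).abs
    -- The minimizer obeys the coordinate bound only almost everywhere, whereas the class demands it
    -- for every `w`; resetting it to `0` elsewhere changes no integral.
    set ι : EuclideanSpace ℝ (Fin d) → EuclideanSpace ℝ (Fin d) := fun w =>
      if w ∈ {w | ∀ k, |F w k| ≤ R / √(d : ℝ)} then F w else 0 with hι
    have hFι : F =ᵐ[μ] ι := by
      filter_upwards [hF] with w hw
      exact (if_pos (show w ∈ {w | ∀ k, |F w k| ≤ R / √(d : ℝ)} from hw)).symm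
    refine ⟨fun p => network b W₀ (x p) + gateIntegral μ x ι p, mem_FRInfty_iff.2 ⟨ι,
      Measurable.ite hms (Lp.stronglyMeasurable F).measurable measurable_const, fun w k => ?_,
      rfl⟩, fun g hg => ?_⟩
    · simp only [hι]
      split_ifs with h
      · exact h k
      · simpa using hr
    · obtain ⟨ι', h1, h2, rfl⟩ := mem_FRInfty_iff.1 hg
      obtain ⟨F', hF', hFι'⟩ := hιF ι' h1 h2
      rw [← gateIntegral_congr hFι, ← gateIntegral_congr hFι', hnorm, hnorm]
      exact ENNReal.ofReal_le_ofReal (hmin F' hF')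
  -- If `u` is not square-integrable, every element of the class is at infinite distance, so any of
  -- them is closest.
  · refine ⟨_, h0mem, fun g hg => ?_⟩
    have : eLpNorm (g - u) 2 σ = ⊤ := by
      by_contra hne
      have hgu : MemLp (g - u) 2 σ :=
        ⟨(hgL g hg).1.sub hu.aestronglyMeasurable, lt_top_iff_ne_top.2 hne⟩
      refine huL ?_
      have := (hgL g hg).sub hgu
      simpa using this
    rw [this]
    exact le_top

/-- Guarantees that the default value `0` of `l2Proj`, which need not belong to the class, is never
taken. -/
lemma l2Proj_mem (hd : 0 < d) (hx : Measurable x) (hx1 : ∀ p, ‖x p‖ = 1)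
    (b : Fin m → ℝ) (W₀ : Params m d) {R : ℝ} (hR : 0 ≤ R) {u : S × A → ℝ} (hu : Measurable u) :
    l2Proj σ (FRInfty x b W₀ R) u ∈ FRInfty x b W₀ R := by
  have h := exists_closest_FRInfty (σ := σ) hd hx hx1 b W₀ hR hu
  rw [l2Proj, dif_pos h]
  exact h.choose_spec.1

end ProjectionClass

/-! ### Gaussian estimates -/

section Gaussian

variable {d m : ℕ}

lemma gaussianReal_slab_le (hd : 0 < d) {s : ℝ} (hs : 0 ≤ s) :
    (gaussianReal 0 (d : ℝ≥0)⁻¹).real {y | |y| ≤ s} ≤ √(d : ℝ) * s := by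
  have hv : ((d : ℝ≥0)⁻¹) ≠ 0 := by positivity
  have hset : {y : ℝ | |y| ≤ s} = Set.Icc (-s) s := by
    ext y; simp [abs_le]
  -- The maximal density is `√(d / 2π)`, and `2π ≥ 4`.
  have hpdf : ∀ y, gaussianPDFReal 0 (d : ℝ≥0)⁻¹ y ≤ √(d : ℝ) / 2 := fun y => by
    rw [gaussianPDFReal_def]
    have h1 : Real.exp (-(y - 0) ^ 2 / (2 * ((d : ℝ≥0)⁻¹ : ℝ≥0))) ≤ 1 := by
      rw [Real.exp_le_one_iff]
      exact div_nonpos_of_nonpos_of_nonneg (by simpa using sq_nonneg y) (by positivity)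
    have h2 : (√(2 * Real.pi * ((d : ℝ≥0)⁻¹ : ℝ≥0)))⁻¹ ≤ √(d : ℝ) / 2 := by
      rw [← Real.sqrt_inv]
      have : √(d : ℝ) / 2 = √((d : ℝ) / 4) := by
        rw [Real.sqrt_div (Nat.cast_nonneg d)]
        congr 1
        rw [show (4 : ℝ) = 2 ^ 2 by norm_num, Real.sqrt_sq (by norm_num)]
      rw [this]
      refine Real.sqrt_le_sqrt ?_
      have hpi := Real.pi_gt_three
      have hd' : (0 : ℝ) < d := by exact_mod_cast hd
      rw [NNReal.coe_inv, NNReal.coe_natCast, mul_inv, inv_inv, div_eq_inv_mul]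
      gcongr
      linarith
    calc _ ≤ (√(2 * Real.pi * ((d : ℝ≥0)⁻¹ : ℝ≥0)))⁻¹ * 1 :=
          mul_le_mul_of_nonneg_left h1 (by positivity)
      _ ≤ _ := by rwa [mul_one]
  rw [measureReal_def, hset, gaussianReal_apply _ hv]
  refine ENNReal.toReal_le_of_le_ofReal (by positivity) ?_
  calc ∫⁻ y in Set.Icc (-s) s, gaussianPDF 0 (d : ℝ≥0)⁻¹ y
      ≤ ∫⁻ _y in Set.Icc (-s) s, ENNReal.ofReal (√(d : ℝ) / 2) :=
        lintegral_mono fun y => ENNReal.ofReal_le_ofReal (hpdf y)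
    _ = ENNReal.ofReal (√(d : ℝ) * s) := by
        rw [setLIntegral_const, Real.volume_Icc, ← ENNReal.ofReal_mul (by positivity)]
        congr 1; ring

/-- Rotation invariance, read off from characteristic functions: the exponents of the independent
coordinates add up to a multiple of `∑ k, x k ^ 2 = 1`. -/
lemma map_inner_gaussianInit {x : EuclideanSpace ℝ (Fin d)} (hx : ‖x‖ = 1) :
    (gaussianInit (Fin d) d).map (fun w => inner ℝ w x) = gaussianReal 0 (d : ℝ≥0)⁻¹ := by
  have : IsProbabilityMeasure ((gaussianInit (Fin d) d).map (fun w => inner ℝ w x)) :=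
    Measure.isProbabilityMeasure_map (by fun_prop)
  refine Measure.ext_of_charFun ?_
  ext t
  rw [charFun_apply_real, integral_map (by fun_prop) (by fun_prop)]
  have h1 : ∫ w, Complex.exp (t * (inner ℝ w x : ℝ) * Complex.I) ∂(gaussianInit (Fin d) d)
      = charFun (gaussianInit (Fin d) d) (t • x) := by
    rw [charFun_apply]
    congr 1; ext w
    rw [inner_smul_right]
    push_cast
    ring_nf
  rw [h1, gaussianInit, charFun_pi]
  simp_rw [charFun_gaussianReal]
  rw [← Complex.exp_sum]
  congr 1
  have hx2 : ∑ k, x k ^ 2 = 1 := by rw [← EuclideanSpace.real_norm_sq_eq, hx, one_pow]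
  have hx3 : ∑ k, (x k : ℂ) ^ 2 = 1 := by exact_mod_cast hx2
  simp only [PiLp.smul_apply, smul_eq_mul, Complex.ofReal_mul, mul_pow, Complex.ofReal_zero,
    mul_zero, zero_mul, zero_sub]
  rw [Finset.sum_neg_distrib, ← Finset.sum_div, ← Finset.mul_sum, ← Finset.mul_sum, hx3, mul_one]

lemma gaussianInit_slab_le (hd : 0 < d) {x : EuclideanSpace ℝ (Fin d)} (hx : ‖x‖ = 1) {s : ℝ}
    (hs : 0 ≤ s) :
    (gaussianInit (Fin d) d).real {w | |inner ℝ w x| ≤ s} ≤ √(d : ℝ) * s := by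
  have h := gaussianReal_slab_le hd hs
  rw [← map_inner_gaussianInit hx, map_measureReal_apply (by fun_prop)
    (measurableSet_le (by fun_prop) measurable_const)] at h
  exact h

lemma integrable_coord_sq (k : Fin d) :
    Integrable (fun w : EuclideanSpace ℝ (Fin d) => w k ^ 2) (gaussianInit (Fin d) d) := by
  rw [gaussianInit, integrable_map_measure (by fun_prop) (by fun_prop)]
  exact integrable_comp_eval (μ := fun _ : Fin d => gaussianReal 0 (d : ℝ≥0)⁻¹) (i := k)
    (f := fun y : ℝ => y ^ 2) (memLp_id_gaussianReal' 2 (by norm_num)).integrable_sq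

lemma integral_coord_sq (k : Fin d) :
    ∫ w, w k ^ 2 ∂(gaussianInit (Fin d) d) = (d : ℝ)⁻¹ := by
  rw [gaussianInit, integral_map (by fun_prop) (by fun_prop)]
  have h := integral_comp_eval (μ := fun _ : Fin d => gaussianReal 0 (d : ℝ≥0)⁻¹) (i := k)
    (f := fun y : ℝ => y ^ 2) (by fun_prop)
  refine h.trans ?_
  have hv := variance_id_gaussianReal (μ := 0) (v := (d : ℝ≥0)⁻¹)
  rw [variance_of_integral_eq_zero (by fun_prop) (by simp)] at hv
  simpa using hv

lemma integral_norm_sq_gaussianInit (hd : 0 < d) :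
    Integrable (fun w : EuclideanSpace ℝ (Fin d) => ‖w‖ ^ 2) (gaussianInit (Fin d) d) ∧
    ∫ w, ‖w‖ ^ 2 ∂(gaussianInit (Fin d) d) = 1 := by
  simp only [EuclideanSpace.real_norm_sq_eq]
  refine ⟨integrable_finsetSum _ fun k _ => integrable_coord_sq k, ?_⟩
  rw [integral_finsetSum _ fun k _ => integrable_coord_sq k]
  simp only [integral_coord_sq, Finset.sum_const, Finset.card_univ, Fintype.card_fin, nsmul_eq_mul]
  exact mul_inv_cancel₀ (by positivity)

/-- Split at `‖w‖ ^ 2 = s⁻¹`. Larger vectors have probability at most `s` by Markov's inequality, as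
the mean of `‖w‖ ^ 2` is `1`; for smaller ones the cone condition gives a slab of half-width `√s`.
-/
lemma gaussianInit_cone_le (hd : 0 < d) {x : EuclideanSpace ℝ (Fin d)} (hx : ‖x‖ = 1) {s : ℝ}
    (hs : 0 < s) :
    (gaussianInit (Fin d) d).real {w | |inner ℝ w x| ≤ s * ‖w‖} ≤ √(d : ℝ) * √s + s := by
  have hsub : {w : EuclideanSpace ℝ (Fin d) | |inner ℝ w x| ≤ s * ‖w‖}
      ⊆ {w | |inner ℝ w x| ≤ √s} ∪ {w | s⁻¹ ≤ ‖w‖ ^ 2} := by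
    intro w hw
    by_contra hc
    simp only [Set.mem_union, Set.mem_ofPred_eq, not_or, not_le] at hc hw
    have h1 : √s < s * ‖w‖ := hc.1.trans_le hw
    have h2 : s < (s * ‖w‖) ^ 2 := (Real.sqrt_lt' ((Real.sqrt_nonneg s).trans_lt h1)).1 h1
    have h3 : s * ‖w‖ ^ 2 < 1 := by
      have := mul_lt_mul_of_pos_left hc.2 hs
      rwa [mul_inv_cancel₀ hs.ne'] at this
    nlinarith
  have hmk := mul_meas_ge_le_integral_of_nonneg (ae_of_all _ fun w => by positivity)
    (integral_norm_sq_gaussianInit hd).1 s⁻¹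
  rw [(integral_norm_sq_gaussianInit hd).2, inv_mul_le_iff₀ hs, mul_one] at hmk
  calc _ ≤ _ := measureReal_mono hsub
    _ ≤ _ := measureReal_union_le _ _
    _ ≤ _ := add_le_add (gaussianInit_slab_le hd hx (Real.sqrt_nonneg s)) hmk

/-- Two independent coordinates have to lie in `[-t, t]`. The exponent `2`, which the final rate
relies on, is where `2 ≤ d` is used. -/
lemma gaussianInit_small_ball_le (hd : 2 ≤ d) {t : ℝ} (ht : 0 ≤ t) :
    (gaussianInit (Fin d) d).real {w | ‖w‖ ≤ t} ≤ d * t ^ 2 := by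
  let k₀ : Fin d := ⟨0, by omega⟩
  let k₁ : Fin d := ⟨1, by omega⟩
  have hk : k₀ ≠ k₁ := by simp [k₀, k₁]
  have hd0 : 0 < d := by omega
  let sl : Set ℝ := {y | |y| ≤ t}
  let s : Fin d → Set ℝ := fun k => if k ∈ ({k₀, k₁} : Finset (Fin d)) then sl else Set.univ
  have hsub : (WithLp.toLp 2 : (Fin d → ℝ) → EuclideanSpace ℝ (Fin d)) ⁻¹' {w | ‖w‖ ≤ t}
      ⊆ Set.univ.pi s := by
    intro w hw k _
    have hw' : |w k| ≤ t := (PiLp.norm_apply_le (WithLp.toLp 2 w) k).trans hw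
    simp only [s]
    split_ifs
    · exact hw'
    · trivial
  rw [gaussianInit, map_measureReal_apply (by fun_prop)
    (measurableSet_le measurable_norm measurable_const)]
  refine (measureReal_mono hsub).trans ?_
  rw [measureReal_def, Measure.pi_pi, ENNReal.toReal_prod]
  have : ∀ k, ((gaussianReal 0 (d : ℝ≥0)⁻¹) (s k)).toReal
      = if k ∈ ({k₀, k₁} : Finset (Fin d)) then (gaussianReal 0 (d : ℝ≥0)⁻¹).real sl else 1 :=
    fun k => by
      simp only [s]
      split_ifs
      · rfl
      · simp
  simp only [this]
  rw [Finset.prod_ite_mem, Finset.univ_inter, Finset.prod_const, Finset.card_pair hk]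
  calc _ ≤ (√(d : ℝ) * t) ^ 2 :=
        pow_le_pow_left₀ measureReal_nonneg (gaussianReal_slab_le hd0 ht) 2
    _ = d * t ^ 2 := by rw [mul_pow, Real.sq_sqrt (Nat.cast_nonneg d)]

/-- The blocks of the Gaussian initialization are independent. -/
lemma measurePreserving_block :
    MeasurePreserving (fun (W : Params m d) (r : Fin m) => block W r)
      (gaussianInit (Fin m × Fin d) d) (Measure.pi fun _ : Fin m => gaussianInit (Fin d) d) := by
  have h1 : MeasurePreserving (MeasurableEquiv.curry (Fin m) (Fin d) ℝ)
      (Measure.pi fun _ : Fin m × Fin d => gaussianReal 0 (d : ℝ≥0)⁻¹)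
      (Measure.pi fun _ : Fin m => Measure.pi fun _ : Fin d => gaussianReal 0 (d : ℝ≥0)⁻¹) := by
    refine ⟨(MeasurableEquiv.curry (Fin m) (Fin d) ℝ).measurable, ?_⟩
    have := Measure.infinitePi_map_curry (ι := Fin m) (κ := Fin d)
      fun _ _ => gaussianReal 0 (d : ℝ≥0)⁻¹
    simpa only [Measure.infinitePi_eq_pi] using this
  have h2 : MeasurePreserving (fun (w : Fin m → Fin d → ℝ) r => WithLp.toLp 2 (w r))
      (Measure.pi fun _ : Fin m => Measure.pi fun _ : Fin d => gaussianReal 0 (d : ℝ≥0)⁻¹)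
      (Measure.pi fun _ : Fin m => gaussianInit (Fin d) d) :=
    measurePreserving_pi _ _ fun r => ⟨by fun_prop, rfl⟩
  have h3 := h2.comp h1
  refine ⟨measurable_pi_lambda _ fun r => (continuous_block r).measurable, ?_⟩
  rw [gaussianInit,
    Measure.map_map (measurable_pi_lambda _ fun r => (continuous_block r).measurable)
    (by fun_prop)]
  exact h3.map_eq

lemma measurePreserving_block_apply (r : Fin m) :
    MeasurePreserving (fun W : Params m d => block W r)
      (gaussianInit (Fin m × Fin d) d) (gaussianInit (Fin d) d) :=
  (measurePreserving_eval (fun _ : Fin m => gaussianInit (Fin d) d) r).comp measurePreserving_block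

lemma integral_prod_block (g : EuclideanSpace ℝ (Fin d) → ℝ) (hg : Measurable g) :
    ∫ W : Params m d, ∏ r, g (block W r) ∂(gaussianInit (Fin m × Fin d) d)
      = (∫ w, g w ∂(gaussianInit (Fin d) d)) ^ m := by
  have h := integral_map (μ := gaussianInit (Fin m × Fin d) d)
    (φ := fun (W : Params m d) (r : Fin m) => block W r)
    (f := fun w : Fin m → EuclideanSpace ℝ (Fin d) => ∏ r, g (w r))
    measurePreserving_block.measurable.aemeasurable
    (Finset.measurable_prod _ fun r _ => hg.comp (measurable_pi_apply r)).aestronglyMeasurable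
  rw [measurePreserving_block.map_eq] at h
  rw [← h, integral_fintype_prod_eq_prod (fun _ => g)]
  simp

lemma measurable_smallCount (t : ℝ) : Measurable fun W : Params m d => smallCount t W := by
  unfold smallCount
  exact Finset.measurable_sum _ fun r _ => Measurable.ite
    (measurableSet_le (continuous_block r).measurable.norm measurable_const)
    measurable_const measurable_const

lemma smallCount_nonneg (t : ℝ) (W : Params m d) : 0 ≤ smallCount t W :=
  Finset.sum_nonneg fun r _ => by split_ifs <;> norm_num

lemma smallCount_le (t : ℝ) (W : Params m d) : smallCount t W ≤ m := by
  refine (Finset.sum_le_card_nsmul _ _ (1 : ℝ) fun r _ => ?_).trans (by simp)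
  split_ifs <;> norm_num

lemma integral_smallCount_le (hd : 2 ≤ d) {t : ℝ} (ht : 0 ≤ t) :
    ∫ W : Params m d, smallCount t W ∂(gaussianInit (Fin m × Fin d) d) ≤ m * (d * t ^ 2) := by
  have hms : MeasurableSet {w : EuclideanSpace ℝ (Fin d) | ‖w‖ ≤ t} :=
    measurableSet_le measurable_norm measurable_const
  have hterm : ∀ r : Fin m, (fun W : Params m d => (if ‖block W r‖ ≤ t then (1 : ℝ) else 0))
      = Set.indicator ((fun W : Params m d => block W r) ⁻¹' {w | ‖w‖ ≤ t}) 1 := fun r => by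
    ext W; simp [Set.indicator_apply]
  unfold smallCount
  have hms' : ∀ r : Fin m, MeasurableSet ((fun W : Params m d => block W r) ⁻¹' {w | ‖w‖ ≤ t}) :=
    fun r => (continuous_block r).measurable hms
  rw [integral_finsetSum _ fun r _ => by
    rw [hterm]; exact (integrable_const (1 : ℝ)).indicator (hms' r)]
  refine (Finset.sum_le_card_nsmul _ _ (d * t ^ 2 : ℝ) fun r _ => ?_).trans (by simp)
  rw [hterm, integral_indicator_one (hms' r),
    (measurePreserving_block_apply r).measureReal_preimage hms.nullMeasurableSet]
  exact gaussianInit_small_ball_le hd ht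

end Gaussian

/-! ### Uniform deviation of products of half-space indicators -/

section Deviation

variable {d m : ℕ}

/-- Deviation of an empirical mean over the blocks from the Gaussian mean. -/
def deviation (Y : EuclideanSpace ℝ (Fin d) → ℝ) (W : Params m d) : ℝ :=
  (1 / m : ℝ) * ∑ r, Y (block W r) - ∫ w, Y w ∂(gaussianInit (Fin d) d)

/-- A Bernstein-type bound: `exp z ≤ 1 + z + z ^ 2` for `|z| ≤ 1`, the linear term has mean zero,
and the variance is at most the second moment. Keeping `v` rather than the sup bound is what makes
chaining profitable. -/
lemma integral_exp_centered_le {X : Type*} [MeasurableSpace X] {μ : Measure X}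
    [IsProbabilityMeasure μ] {Y : X → ℝ} (hY : Measurable Y) (hb : ∀ w, |Y w| ≤ 1) {v : ℝ}
    (hv : ∫ w, Y w ^ 2 ∂μ ≤ v) {l : ℝ} (hl : |l| ≤ 1 / 2) :
    ∫ w, Real.exp (l * (Y w - ∫ w, Y w ∂μ)) ∂μ ≤ Real.exp (l ^ 2 * v) := by
  set e := ∫ w, Y w ∂μ with he
  have hYi : Integrable Y μ := MDP.integrable_of_abs_le hY hb
  have he1 : |e| ≤ 1 := MDP.abs_integral_le_of_abs_le hb
  have hZb : ∀ w, |l * (Y w - e)| ≤ 1 := fun w => by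
    rw [abs_mul]
    have h2 : |Y w - e| ≤ 2 := (abs_sub _ _).trans (by linarith [hb w])
    nlinarith [abs_nonneg l, abs_nonneg (Y w - e)]
  -- The restriction `|l| ≤ 1 / 2` ensures `|l * (Y w - e)| ≤ 1`, as `|Y w - e| ≤ 2`.
  have hpt : ∀ w, Real.exp (l * (Y w - e)) ≤ 1 + l * (Y w - e) + l ^ 2 * (Y w - e) ^ 2 := by
    intro w
    have := (abs_le.1 (Real.abs_exp_sub_one_sub_id_le (hZb w))).2
    rw [mul_pow] at this
    linarith
  have hY2i : Integrable (fun w => Y w ^ 2) μ :=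
    MDP.integrable_of_abs_le (B := 1) (hY.pow_const 2) fun w => by
      rw [abs_pow]; exact pow_le_one₀ (abs_nonneg _) (hb w)
  have h1 : ∫ w, (Y w - e) ∂μ = 0 := by
    rw [integral_sub hYi (integrable_const _)]; simp [he]
  have hZi : Integrable (fun w => Y w - e) μ := hYi.sub (integrable_const _)
  have i1 : Integrable (fun w => Y w ^ 2 - 2 * e * (Y w - e)) μ := hY2i.sub (hZi.const_mul _)
  have hsq : ∀ w, (Y w - e) ^ 2 = Y w ^ 2 - 2 * e * (Y w - e) - e ^ 2 := fun w => by ring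
  have hZ2i : Integrable (fun w => (Y w - e) ^ 2) μ := by
    simp only [hsq]
    exact i1.sub (integrable_const _)
  have h2 : ∫ w, (Y w - e) ^ 2 ∂μ ≤ v := by
    simp only [hsq]
    rw [integral_sub i1 (integrable_const _), integral_sub hY2i (hZi.const_mul _),
      integral_const_mul, h1]
    simp only [integral_const, probReal_univ, one_smul]
    nlinarith [sq_nonneg e]
  have i2 : Integrable (fun w => 1 + l * (Y w - e)) μ := (integrable_const _).add (hZi.const_mul _)
  calc ∫ w, Real.exp (l * (Y w - e)) ∂μ
      ≤ ∫ w, (1 + l * (Y w - e) + l ^ 2 * (Y w - e) ^ 2) ∂μ :=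
        integral_mono_of_nonneg (ae_of_all _ fun w => (Real.exp_pos _).le)
          (i2.add (hZ2i.const_mul _))
          (ae_of_all _ hpt)
    _ = 1 + l ^ 2 * ∫ w, (Y w - e) ^ 2 ∂μ := by
        rw [integral_add i2 (hZ2i.const_mul _),
          integral_add (integrable_const _) (hZi.const_mul _), integral_const_mul,
          integral_const_mul, h1]
        simp
    _ ≤ 1 + l ^ 2 * v := by gcongr
    _ ≤ _ := by linarith [Real.add_one_le_exp (l ^ 2 * v)]

lemma exp_mul_deviation (hm : 0 < m) (Y : EuclideanSpace ℝ (Fin d) → ℝ) (l : ℝ) (W : Params m d) :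
    Real.exp (l * (m * deviation Y W))
      = ∏ r, Real.exp (l * (Y (block W r) - ∫ w, Y w ∂(gaussianInit (Fin d) d))) := by
  rw [← Real.exp_sum, ← Finset.mul_sum, Finset.sum_sub_distrib]
  have : (m : ℝ) ≠ 0 := by positivity
  simp only [deviation, Finset.sum_const, Finset.card_univ, Fintype.card_fin, nsmul_eq_mul]
  congr 2
  field_simp

lemma measurable_deviation {Y : EuclideanSpace ℝ (Fin d) → ℝ} (hY : Measurable Y) :
    Measurable fun W : Params m d => deviation Y W :=
  ((Finset.measurable_sum _ fun r _ =>
    hY.comp (continuous_block r).measurable).const_mul _).sub_const _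

lemma abs_deviation_le (hm : 0 < m) {Y : EuclideanSpace ℝ (Fin d) → ℝ} (hb : ∀ w, |Y w| ≤ 1)
    (W : Params m d) : |deviation Y W| ≤ 2 := by
  have h1 : |∫ w, Y w ∂(gaussianInit (Fin d) d)| ≤ 1 := MDP.abs_integral_le_of_abs_le hb
  have h2 : |(1 / m : ℝ) * ∑ r, Y (block W r)| ≤ 1 := by
    have hm' : (0 : ℝ) < m := by exact_mod_cast hm
    rw [abs_mul, abs_of_pos (by positivity), one_div, inv_mul_le_iff₀ hm', mul_one]
    refine (Finset.abs_sum_le_sum_abs _ _).trans ?_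
    refine (Finset.sum_le_card_nsmul _ _ (1 : ℝ) fun r _ => hb _).trans (by simp)
  refine (abs_sub _ _).trans ?_
  linarith

lemma integrable_exp_deviation (hm : 0 < m) {Y : EuclideanSpace ℝ (Fin d) → ℝ}
    (hY : Measurable Y) (hb : ∀ w, |Y w| ≤ 1) (l : ℝ) :
    Integrable (fun W : Params m d => Real.exp (l * (m * deviation Y W)))
      (gaussianInit (Fin m × Fin d) d) := by
  refine MDP.integrable_of_abs_le (B := Real.exp (|l| * (m * 2)))
    (Real.measurable_exp.comp (((measurable_deviation hY).const_mul _).const_mul _)) fun W => ?_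
  rw [abs_of_pos (Real.exp_pos _)]
  refine Real.exp_le_exp.2 ((le_abs_self _).trans ?_)
  rw [abs_mul, abs_mul, Nat.abs_cast]
  gcongr
  exact abs_deviation_le hm hb W

lemma integral_exp_deviation_le (hm : 0 < m) {Y : EuclideanSpace ℝ (Fin d) → ℝ}
    (hY : Measurable Y) (hb : ∀ w, |Y w| ≤ 1) {v : ℝ}
    (hv : ∫ w, Y w ^ 2 ∂(gaussianInit (Fin d) d) ≤ v) {l : ℝ} (hl : |l| ≤ 1 / 2) :
    ∫ W : Params m d, Real.exp (l * (m * deviation Y W)) ∂(gaussianInit (Fin m × Fin d) d)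
      ≤ Real.exp (m * (l ^ 2 * v)) := by
  simp only [exp_mul_deviation hm]
  rw [integral_prod_block (fun w => Real.exp (l * (Y w - ∫ w, Y w ∂(gaussianInit (Fin d) d))))
    (Real.measurable_exp.comp ((hY.sub_const _).const_mul _)), Real.exp_nat_mul]
  exact pow_le_pow_left₀ (integral_nonneg fun w => (Real.exp_pos _).le)
    (integral_exp_centered_le hY hb hv hl) m

/-- Maximal inequality for a finite family of bounded functions of small variance. -/
theorem exists_maximal_bound (hm : 0 < m) (𝒴 : Finset (EuclideanSpace ℝ (Fin d) → ℝ))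
    (hY : ∀ Y ∈ 𝒴, Measurable Y) (hb : ∀ Y ∈ 𝒴, ∀ w, |Y w| ≤ 1) {v : ℝ}
    (hv : ∀ Y ∈ 𝒴, ∫ w, Y w ^ 2 ∂(gaussianInit (Fin d) d) ≤ v) {L : ℝ}
    (hL : (𝒴.card : ℝ) ≤ Real.exp L) (hL0 : 0 ≤ L) (hv0 : 0 ≤ v) {l : ℝ} (hl0 : 0 < l)
    (hl : l ≤ 1 / 2) :
    ∃ G : Params m d → ℝ, Measurable G ∧ (∀ W, 0 ≤ G W) ∧
      Integrable G (gaussianInit (Fin m × Fin d) d) ∧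
      ∫ W, G W ∂(gaussianInit (Fin m × Fin d) d) ≤ (L + 2 + m * (l ^ 2 * v)) / (l * m) ∧
      ∀ Y ∈ 𝒴, ∀ W, |deviation Y W| ≤ G W := by
  have hm' : (0 : ℝ) < m := by exact_mod_cast hm
  -- Chosen so that `exp a` dominates the mean of the total exponential sum `T`; the `1` absorbs the
  -- factor `2` from the two signs.
  set a : ℝ := L + 1 + m * (l ^ 2 * v) with ha
  have ha0 : 0 ≤ a := by positivity
  have hlm : 0 < l * m := by positivity
  set T : Params m d → ℝ := fun W => ∑ Y ∈ 𝒴, (Real.exp (l * (m * deviation Y W))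
    + Real.exp (-l * (m * deviation Y W))) with hT
  have hTm : Measurable T := Finset.measurable_sum _ fun Y h =>
    (Real.measurable_exp.comp (((measurable_deviation (hY Y h)).const_mul _).const_mul _)).add
      (Real.measurable_exp.comp (((measurable_deviation (hY Y h)).const_mul _).const_mul _))
  have hTi' : ∀ Y ∈ 𝒴, Integrable (fun W : Params m d => Real.exp (l * (m * deviation Y W))
    + Real.exp (-l * (m * deviation Y W))) (gaussianInit (Fin m × Fin d) d) := fun Y h =>
    (integrable_exp_deviation hm (hY Y h) (hb Y h) l).add
      (integrable_exp_deviation hm (hY Y h) (hb Y h) (-l))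
  have hTi : Integrable T (gaussianInit (Fin m × Fin d) d) := integrable_finsetSum _ hTi'
  have hTint : ∫ W, T W ∂(gaussianInit (Fin m × Fin d) d) ≤ Real.exp a := by
    rw [hT, integral_finsetSum _ hTi']
    calc _ ≤ ∑ Y ∈ 𝒴, (2 * Real.exp (m * (l ^ 2 * v))) := by
          refine Finset.sum_le_sum fun Y h => ?_
          rw [integral_add (integrable_exp_deviation hm (hY Y h) (hb Y h) l)
            (integrable_exp_deviation hm (hY Y h) (hb Y h) (-l))]
          have h1 := integral_exp_deviation_le hm (hY Y h) (hb Y h) (hv Y h) (l := l)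
            (by rwa [abs_of_pos hl0])
          have h2 := integral_exp_deviation_le hm (hY Y h) (hb Y h) (hv Y h) (l := -l)
            (by rwa [abs_neg, abs_of_pos hl0])
          rw [neg_sq] at h2
          linarith
      _ = 𝒴.card * 2 * Real.exp (m * (l ^ 2 * v)) := by
          rw [Finset.sum_const, nsmul_eq_mul, mul_assoc]
      _ ≤ Real.exp L * Real.exp 1 * Real.exp (m * (l ^ 2 * v)) := by
          gcongr
          linarith [Real.add_one_le_exp 1]
      _ = Real.exp a := by rw [← Real.exp_add, ← Real.exp_add]
  refine ⟨fun W => (a + Real.exp (-a) * T W) / (l * m),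
    ((hTm.const_mul _).const_add _).div_const _, fun W => ?_,
    ((integrable_const _).add (hTi.const_mul _)).div_const _, ?_, fun Y h W => ?_⟩
  · have : 0 ≤ T W := Finset.sum_nonneg fun Y _ => by positivity
    positivity
  · rw [integral_div, integral_add (integrable_const _) (hTi.const_mul _), integral_const_mul]
    refine div_le_div_of_nonneg_right ?_ hlm.le
    have : Real.exp (-a) * ∫ W, T W ∂(gaussianInit (Fin m × Fin d) d) ≤ 1 := by
      calc _ ≤ Real.exp (-a) * Real.exp a := by gcongr
        _ = 1 := by rw [← Real.exp_add]; simp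
    simp only [integral_const, probReal_univ, one_smul]
    linarith
  · rw [le_div_iff₀ hlm]
    have h1 : Real.exp (l * m * |deviation Y W|) ≤ T W := by
      have h2 : Real.exp (l * m * |deviation Y W|) ≤ Real.exp (l * (m * deviation Y W))
          + Real.exp (-l * (m * deviation Y W)) := by
        rcases abs_cases (deviation Y W) with ⟨h3, -⟩ | ⟨h3, -⟩ <;> rw [h3]
        · rw [mul_assoc]
          linarith [Real.exp_pos (-l * (m * deviation Y W))]
        · rw [show l * m * -deviation Y W = -l * (m * deviation Y W) by ring]
          linarith [Real.exp_pos (l * (m * deviation Y W))]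
      refine h2.trans ?_
      exact Finset.single_le_sum (f := fun Y => Real.exp (l * (m * deviation Y W))
        + Real.exp (-l * (m * deviation Y W))) (fun Y _ => by positivity) h
    -- From `y ≤ a + exp (y - a)` one gets a dominating function that is affine in `T`, hence
    -- integrable with an explicit mean and independent of `Y`.
    have h3 := Real.add_one_le_exp (l * m * |deviation Y W| - a)
    rw [Real.exp_sub, div_eq_inv_mul, ← Real.exp_neg] at h3
    have h4 := mul_le_mul_of_nonneg_left h1 (Real.exp_pos (-a)).le
    linarith

end Deviation

/-! ### Dyadic grids -/

section Grid

variable {d : ℕ}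

/-- Rounding of the coordinates at scale `16⁻ʲ`. -/
def gridCode (j : ℕ) (y : EuclideanSpace ℝ (Fin d)) (k : Fin d) : ℤ := ⌊(16 : ℝ) ^ j * y k⌋

/-- Grid point with a given integer code. -/
def gridPoint (j : ℕ) (z : Fin d → ℤ) : EuclideanSpace ℝ (Fin d) :=
  WithLp.toLp 2 fun k => (z k : ℝ) / 16 ^ j

/-- Indicator of the half-space of a rounded point. -/
def gridGate (j : ℕ) (y w : EuclideanSpace ℝ (Fin d)) : ℝ :=
  gate (inner ℝ w (gridPoint j (gridCode j y)))

lemma norm_sub_gridPoint_le (j : ℕ) (y : EuclideanSpace ℝ (Fin d)) :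
    ‖gridPoint j (gridCode j y) - y‖ ≤ √(d : ℝ) * ((16 : ℝ) ^ j)⁻¹ := by
  rw [EuclideanSpace.norm_eq, Real.sqrt_le_iff]
  refine ⟨by positivity, ?_⟩
  have h : ∀ k, ‖(gridPoint j (gridCode j y) - y) k‖ ^ 2 ≤ (((16 : ℝ) ^ j)⁻¹) ^ 2 := fun k => by
    refine pow_le_pow_left₀ (norm_nonneg _) ?_ 2
    have hp : (0 : ℝ) < 16 ^ j := by positivity
    have h1 := Int.floor_le ((16 : ℝ) ^ j * y k)
    have h2 := Int.lt_floor_add_one ((16 : ℝ) ^ j * y k)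
    have h3 : (gridPoint j (gridCode j y) - y) k
        = ((⌊(16 : ℝ) ^ j * y k⌋ : ℝ) - 16 ^ j * y k) * ((16 : ℝ) ^ j)⁻¹ := by
      simp only [PiLp.sub_apply, gridPoint, gridCode]
      field_simp
    rw [h3, norm_mul, Real.norm_eq_abs, Real.norm_eq_abs, abs_of_pos (inv_pos.2 hp)]
    refine mul_le_of_le_one_left (by positivity) (abs_le.2 ⟨?_, ?_⟩) <;> linarith
  refine (Finset.sum_le_card_nsmul _ _ _ fun k _ => h k).trans (le_of_eq ?_)
  rw [Finset.card_univ, Fintype.card_fin, mul_pow, Real.sq_sqrt (Nat.cast_nonneg d), nsmul_eq_mul]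

lemma gridGate_nonneg (j : ℕ) (y w : EuclideanSpace ℝ (Fin d)) : 0 ≤ gridGate j y w :=
  gate_nonneg _

lemma gridGate_le_one (j : ℕ) (y w : EuclideanSpace ℝ (Fin d)) : gridGate j y w ≤ 1 :=
  gate_le_one _

lemma measurable_gridGate_uncurry (j : ℕ) :
    Measurable fun z : EuclideanSpace ℝ (Fin d) × EuclideanSpace ℝ (Fin d) =>
      gridGate j z.1 z.2 := by
  have h : Measurable fun y : EuclideanSpace ℝ (Fin d) => gridPoint j (gridCode j y) := by
    have hk : ∀ k, Measurable fun y : EuclideanSpace ℝ (Fin d) =>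
        ((gridCode j y k : ℤ) : ℝ) / 16 ^ j := fun k => by
      have h1 : Measurable fun y : EuclideanSpace ℝ (Fin d) => (16 : ℝ) ^ j * y k := by fun_prop
      have h2 : Measurable fun y : EuclideanSpace ℝ (Fin d) => gridCode j y k := h1.floor
      exact ((measurable_from_top (f := fun z : ℤ => (z : ℝ))).comp h2).div_const _
    exact (WithLp.measurable_toLp 2 _).comp (measurable_pi_lambda _ hk)
  have h2 : Measurable fun z : EuclideanSpace ℝ (Fin d) × EuclideanSpace ℝ (Fin d) =>
      (inner ℝ z.2 (gridPoint j (gridCode j z.1)) : ℝ) :=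
    measurable_snd.inner (h.comp measurable_fst)
  exact measurable_gate.comp h2

lemma measurable_gridGate (j : ℕ) (y : EuclideanSpace ℝ (Fin d)) : Measurable (gridGate j y) := by
  have h : Measurable fun w : EuclideanSpace ℝ (Fin d) =>
      (inner ℝ w (gridPoint j (gridCode j y)) : ℝ) := measurable_id.inner measurable_const
  exact measurable_gate.comp h

lemma gate_ne_imp {y z : ℝ} (h : gate y ≠ gate z) : |y| ≤ |z - y| := by
  by_contra hc
  rw [not_le] at hc
  apply h
  unfold gate
  rcases lt_trichotomy y 0 with hy | hy | hy
  · rw [abs_of_neg hy] at hc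
    rw [if_neg hy.not_gt, if_neg (by linarith [(abs_lt.1 hc).2])]
  · subst hy; simp at hc; linarith [abs_nonneg z]
  · rw [abs_of_pos hy] at hc
    rw [if_pos hy, if_pos (by linarith [(abs_lt.1 hc).1])]

/-- Rounding moves `y` by at most `√d * 16⁻ʲ`, so the gate can change only for `w` in a thin cone
around the hyperplane orthogonal to `y`. -/
lemma gridGate_ne_imp {j : ℕ} {y w : EuclideanSpace ℝ (Fin d)}
    (h : gate (inner ℝ w y) ≠ gridGate j y w) :
    |inner ℝ w y| ≤ √(d : ℝ) * ((16 : ℝ) ^ j)⁻¹ * ‖w‖ := by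
  refine (gate_ne_imp h).trans ?_
  rw [← inner_sub_right, mul_comm]
  exact (abs_real_inner_le_norm _ _).trans
    (mul_le_mul_of_nonneg_left (norm_sub_gridPoint_le j y) (norm_nonneg _))

lemma gridCode_mem {y : EuclideanSpace ℝ (Fin d)} (hy : ‖y‖ = 1) (j : ℕ) :
    gridCode j y ∈ Fintype.piFinset fun _ : Fin d => Finset.Icc (-(16 : ℤ) ^ j) (16 ^ j) := by
  rw [Fintype.mem_piFinset]
  intro k
  have h1 : |y k| ≤ 1 := hy ▸ PiLp.norm_apply_le y k
  have hp : (0 : ℝ) < 16 ^ j := by positivity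
  rw [abs_le] at h1
  rw [Finset.mem_Icc, gridCode, Int.le_floor]
  constructor
  · push_cast
    nlinarith
  · have : ⌊(16 : ℝ) ^ j * y k⌋ ≤ ⌊((16 ^ j : ℤ) : ℝ)⌋ :=
      Int.floor_le_floor (by push_cast; nlinarith)
    rwa [Int.floor_intCast] at this

lemma card_gridCodes_le (j : ℕ) :
    (Fintype.piFinset fun _ : Fin d => Finset.Icc (-(16 : ℤ) ^ j) (16 ^ j)).card
      ≤ 16 ^ ((j + 1) * d) := by
  rw [Fintype.card_piFinset]
  simp only [Int.card_Icc, Finset.prod_const, Finset.card_univ, Fintype.card_fin]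
  rw [pow_mul]
  refine Nat.pow_le_pow_left ?_ d
  have h : (1 : ℤ) ≤ 16 ^ j := one_le_pow₀ (by norm_num)
  zify
  rw [Int.toNat_of_nonneg (by linarith), pow_succ]
  linarith

end Grid

/-! ### Chaining -/

section Chaining

variable {d m : ℕ}

/-- Indicator of the intersection of two rounded half-spaces. -/
def pairGate (j : ℕ) (y z w : EuclideanSpace ℝ (Fin d)) : ℝ := gridGate j y w * gridGate j z w

/-- Difference of consecutive roundings. -/
def increment (j : ℕ) (y y' w : EuclideanSpace ℝ (Fin d)) : ℝ :=
  pairGate j y y' w - if j = 0 then 0 else pairGate (j - 1) y y' w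

lemma pairGate_nonneg (j : ℕ) (y y' w : EuclideanSpace ℝ (Fin d)) : 0 ≤ pairGate j y y' w :=
  mul_nonneg (gridGate_nonneg _ _ _) (gridGate_nonneg _ _ _)

lemma pairGate_le_one (j : ℕ) (y y' w : EuclideanSpace ℝ (Fin d)) : pairGate j y y' w ≤ 1 :=
  mul_le_one₀ (gridGate_le_one _ _ _) (gridGate_nonneg _ _ _) (gridGate_le_one _ _ _)

lemma abs_pairGate_le (j : ℕ) (y y' w : EuclideanSpace ℝ (Fin d)) : |pairGate j y y' w| ≤ 1 := by
  rw [abs_of_nonneg (pairGate_nonneg _ _ _ _)]; exact pairGate_le_one _ _ _ _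

lemma measurable_pairGate (j : ℕ) (y y' : EuclideanSpace ℝ (Fin d)) :
    Measurable (pairGate j y y') := (measurable_gridGate j y).mul (measurable_gridGate j y')

lemma abs_increment_le (j : ℕ) (y y' w : EuclideanSpace ℝ (Fin d)) : |increment j y y' w| ≤ 1 := by
  unfold increment
  have h1 := pairGate_nonneg j y y' w
  have h2 := pairGate_le_one j y y' w
  have h3 := pairGate_nonneg (j - 1) y y' w
  have h4 := pairGate_le_one (j - 1) y y' w
  split_ifs <;> rw [abs_le] <;> constructor <;> linarith

lemma measurable_increment (j : ℕ) (y y' : EuclideanSpace ℝ (Fin d)) :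
    Measurable (increment j y y') := by
  unfold increment
  refine (measurable_pairGate j y y').sub ?_
  split_ifs
  · exact measurable_const
  · exact measurable_pairGate _ y y'

lemma sum_increment (n : ℕ) (y y' w : EuclideanSpace ℝ (Fin d)) :
    ∑ j ∈ Finset.range (n + 1), increment j y y' w = pairGate n y y' w := by
  induction n with
  | zero => simp [increment]
  | succ n ih => rw [Finset.sum_range_succ, ih]; simp [increment]

/-- If `w` avoids the coarser of the two cones for both points, each rounded gate agrees with the
exact one at levels `n` and `n + 1`, and the increment vanishes. -/
lemma increment_sq_le (n : ℕ) (y y' w : EuclideanSpace ℝ (Fin d)) :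
    increment (n + 1) y y' w ^ 2
      ≤ Set.indicator {w | |inner ℝ w y| ≤ √(d : ℝ) * ((16 : ℝ) ^ n)⁻¹ * ‖w‖} 1 w
        + Set.indicator {w | |inner ℝ w y'| ≤ √(d : ℝ) * ((16 : ℝ) ^ n)⁻¹ * ‖w‖} 1 w := by
  have key : ∀ z : EuclideanSpace ℝ (Fin d),
      w ∉ {w | |inner ℝ w z| ≤ √(d : ℝ) * ((16 : ℝ) ^ n)⁻¹ * ‖w‖} →
      gridGate (n + 1) z w = gridGate n z w := fun z hz => by
    have h1 : gate (inner ℝ w z) = gridGate n z w := by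
      by_contra h; exact hz (gridGate_ne_imp h)
    have h2 : gate (inner ℝ w z) = gridGate (n + 1) z w := by
      by_contra h
      refine hz ((gridGate_ne_imp h).trans ?_)
      gcongr
      · norm_num
      · exact Nat.le_succ n
    rw [← h1, ← h2]
  have hsq : increment (n + 1) y y' w ^ 2 ≤ 1 := by
    rw [sq_le_one_iff_abs_le_one]; exact abs_increment_le _ _ _ _
  by_cases hy : w ∈ {w | |inner ℝ w y| ≤ √(d : ℝ) * ((16 : ℝ) ^ n)⁻¹ * ‖w‖}
  · rw [Set.indicator_of_mem hy]
    have : (0 : ℝ) ≤ Set.indicator {w | |inner ℝ w y'| ≤ √(d : ℝ) * ((16 : ℝ) ^ n)⁻¹ * ‖w‖} 1 w :=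
      Set.indicator_nonneg (fun _ _ => zero_le_one) w
    simp only [Pi.one_apply]
    linarith
  · by_cases hy' : w ∈ {w | |inner ℝ w y'| ≤ √(d : ℝ) * ((16 : ℝ) ^ n)⁻¹ * ‖w‖}
    · rw [Set.indicator_of_mem hy', Set.indicator_of_notMem hy, zero_add]
      exact hsq
    · rw [Set.indicator_of_notMem hy', Set.indicator_of_notMem hy]
      have : increment (n + 1) y y' w = 0 := by
        simp [increment, pairGate, key y hy, key y' hy']
      simp [this]

/-- A cone of opening `s` has probability of order `√s`, so the grid scale `16⁻ʲ` produces variance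
of order `4⁻ʲ`. For `j = 0` the trivial bound `1` suffices. -/
lemma integral_increment_sq_le (hd : 0 < d) {y y' : EuclideanSpace ℝ (Fin d)} (hy : ‖y‖ = 1)
    (hy' : ‖y'‖ = 1) (j : ℕ) :
    ∫ w, increment j y y' w ^ 2 ∂(gaussianInit (Fin d) d) ≤ 16 * d * ((4 : ℝ) ^ j)⁻¹ := by
  have hd1 : (1 : ℝ) ≤ d := by exact_mod_cast hd
  rcases j with _ | n
  · refine (le_abs_self _).trans ((MDP.abs_integral_le_of_abs_le (B := 1) fun w => ?_).trans ?_)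
    · rw [abs_pow]; exact pow_le_one₀ (abs_nonneg _) (abs_increment_le _ _ _ _)
    · simp; linarith
  · set s : ℝ := √(d : ℝ) * ((16 : ℝ) ^ n)⁻¹ with hs
    have hs0 : 0 < s := by positivity
    have hms : ∀ z : EuclideanSpace ℝ (Fin d), MeasurableSet {w | |inner ℝ w z| ≤ s * ‖w‖} :=
      fun z => measurableSet_le (measurable_id.inner measurable_const).abs
        (measurable_norm.const_mul _)
    have hi : ∀ z : EuclideanSpace ℝ (Fin d), Integrable
        (Set.indicator {w | |inner ℝ w z| ≤ s * ‖w‖} (1 : EuclideanSpace ℝ (Fin d) → ℝ))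
        (gaussianInit (Fin d) d) := fun z => (integrable_const (1 : ℝ)).indicator (hms z)
    have hsqrtd : √(d : ℝ) ≤ d := by
      rw [Real.sqrt_le_left (by positivity)]; nlinarith
    have h4 : (((4 : ℝ) ^ n)⁻¹) ^ 2 = ((16 : ℝ) ^ n)⁻¹ := by
      rw [inv_pow, ← pow_mul, mul_comm, pow_mul]; norm_num
    have h41 : ((4 : ℝ) ^ n)⁻¹ ≤ 1 := inv_le_one_of_one_le₀ (one_le_pow₀ (by norm_num))
    have h40 : 0 < ((4 : ℝ) ^ n)⁻¹ := by positivity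
    have hss : √s ≤ √(d : ℝ) * ((4 : ℝ) ^ n)⁻¹ := by
      rw [Real.sqrt_le_left (by positivity), mul_pow, h4, Real.sq_sqrt (by positivity), hs]
      gcongr
    have hb : √(d : ℝ) * √s + s ≤ 2 * d * ((4 : ℝ) ^ n)⁻¹ := by
      have h5 : √(d : ℝ) * √s ≤ d * ((4 : ℝ) ^ n)⁻¹ := by
        calc _ ≤ √(d : ℝ) * (√(d : ℝ) * ((4 : ℝ) ^ n)⁻¹) := by gcongr
          _ = _ := by rw [← mul_assoc, Real.mul_self_sqrt (by positivity)]
      have h6 : s ≤ d * ((4 : ℝ) ^ n)⁻¹ := by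
        rw [hs, ← h4]
        gcongr
        nlinarith
      linarith
    calc _ ≤ ∫ w, (Set.indicator {w | |inner ℝ w y| ≤ s * ‖w‖} 1 w
          + Set.indicator {w | |inner ℝ w y'| ≤ s * ‖w‖} 1 w) ∂(gaussianInit (Fin d) d) :=
          integral_mono_of_nonneg (ae_of_all _ fun w => sq_nonneg _) ((hi y).add (hi y'))
            (ae_of_all _ fun w => increment_sq_le n y y' w)
      _ = (gaussianInit (Fin d) d).real {w | |inner ℝ w y| ≤ s * ‖w‖}
          + (gaussianInit (Fin d) d).real {w | |inner ℝ w y'| ≤ s * ‖w‖} := by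
          rw [integral_add (hi y) (hi y'), integral_indicator_one (hms y),
            integral_indicator_one (hms y')]
      _ ≤ 2 * d * ((4 : ℝ) ^ n)⁻¹ + 2 * d * ((4 : ℝ) ^ n)⁻¹ :=
          add_le_add ((gaussianInit_cone_le hd hy hs0).trans hb)
            ((gaussianInit_cone_le hd hy' hs0).trans hb)
      _ = _ := by rw [pow_succ, mul_inv]; ring

/-- The finite family of increments at a given level. -/
lemma exists_increment_family (j : ℕ) :
    ∃ 𝒴 : Finset (EuclideanSpace ℝ (Fin d) → ℝ),
      (∀ y y' : EuclideanSpace ℝ (Fin d), ‖y‖ = 1 → ‖y'‖ = 1 → increment j y y' ∈ 𝒴) ∧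
      (∀ Y ∈ 𝒴, ∃ y y' : EuclideanSpace ℝ (Fin d), ‖y‖ = 1 ∧ ‖y'‖ = 1 ∧ Y = increment j y y') ∧
      (𝒴.card : ℝ) ≤ Real.exp (12 * d * (j + 1)) := by
  classical
  let C : ℕ → Finset (Fin d → ℤ) := fun j =>
    Fintype.piFinset fun _ : Fin d => Finset.Icc (-(16 : ℤ) ^ j) (16 ^ j)
  let Φ : ((Fin d → ℤ) × (Fin d → ℤ)) × (Fin d → ℤ) × (Fin d → ℤ) →
      EuclideanSpace ℝ (Fin d) → ℝ := fun z w =>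
    gate (inner ℝ w (gridPoint j z.1.1)) * gate (inner ℝ w (gridPoint j z.1.2)) -
      if j = 0 then 0 else
        gate (inner ℝ w (gridPoint (j - 1) z.2.1)) * gate (inner ℝ w (gridPoint (j - 1) z.2.2))
  let I := ((C j ×ˢ C j) ×ˢ (C (j - 1) ×ˢ C (j - 1))).image Φ
  -- Not every tuple of codes comes from unit vectors; the filter keeps only genuine increments, for
  -- which the variance bound is available.
  let 𝒴 := I.filter fun Y => ∃ y y' : EuclideanSpace ℝ (Fin d),
    ‖y‖ = 1 ∧ ‖y'‖ = 1 ∧ Y = increment j y y'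
  refine ⟨𝒴, fun y y' hy hy' => ?_, fun Y hY => (Finset.mem_filter.1 hY).2, ?_⟩
  · refine Finset.mem_filter.2 ⟨Finset.mem_image.2 ⟨((gridCode j y, gridCode j y'),
      (gridCode (j - 1) y, gridCode (j - 1) y')), ?_, rfl⟩, y, y', hy, hy', rfl⟩
    simp only [Finset.mem_product]
    exact ⟨⟨gridCode_mem hy j, gridCode_mem hy' j⟩, gridCode_mem hy _, gridCode_mem hy' _⟩
  · have h1 : 𝒴.card ≤ 16 ^ (4 * (d * (j + 1))) := by
      refine (Finset.card_filter_le _ _).trans (Finset.card_image_le.trans ?_)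
      simp only [Finset.card_product]
      have hC : (C j).card ≤ 16 ^ (d * (j + 1)) := by
        rw [mul_comm]; exact card_gridCodes_le j
      have hC' : (C (j - 1)).card ≤ 16 ^ (d * (j + 1)) :=
        (card_gridCodes_le (j - 1)).trans (Nat.pow_le_pow_right (by norm_num) (by
          rw [mul_comm]; exact Nat.mul_le_mul_left d (by omega)))
      calc _ ≤ (16 ^ (d * (j + 1)) * 16 ^ (d * (j + 1))) *
            (16 ^ (d * (j + 1)) * 16 ^ (d * (j + 1))) := by gcongr
        _ = _ := by ring
    -- Four codes with at most `16 ^ (d * (j + 1))` values each; since `16 ≤ e³`, the exponent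
    -- becomes `12 * d * (j + 1)`.
    have h2 : (16 : ℝ) ≤ Real.exp 3 := by
      have := Real.exp_one_gt_d9
      have h3 : Real.exp 3 = Real.exp 1 ^ 3 := by rw [← Real.exp_nat_mul]; norm_num
      rw [h3]
      calc (16 : ℝ) ≤ 2.7 ^ 3 := by norm_num
        _ ≤ _ := pow_le_pow_left₀ (by norm_num) (by linarith) 3
    calc (𝒴.card : ℝ) ≤ (16 : ℝ) ^ (4 * (d * (j + 1))) := by exact_mod_cast h1
      _ ≤ Real.exp 3 ^ (4 * (d * (j + 1))) := pow_le_pow_left₀ (by norm_num) h2 _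
      _ = _ := by rw [← Real.exp_nat_mul]; congr 1; push_cast; ring

lemma sum_succ_mul_inv_two_pow_le (n : ℕ) :
    ∑ j ∈ Finset.range n, ((j : ℝ) + 1) * ((2 : ℝ) ^ j)⁻¹ ≤ 4 := by
  have h : ∀ n : ℕ, ∑ j ∈ Finset.range n, ((j : ℝ) + 1) * ((2 : ℝ) ^ j)⁻¹
      = 4 - (2 * n + 4) * ((2 : ℝ) ^ n)⁻¹ := fun n => by
    induction n with
    | zero => norm_num
    | succ n ih =>
      rw [Finset.sum_range_succ, ih, pow_succ, mul_inv]
      push_cast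
      ring
  rw [h]
  have : 0 ≤ (2 * (n : ℝ) + 4) * ((2 : ℝ) ^ n)⁻¹ := by positivity
  linarith

lemma deviation_sum {ι : Type*} (s : Finset ι) (Y : ι → EuclideanSpace ℝ (Fin d) → ℝ)
    (hY : ∀ i ∈ s, Integrable (Y i) (gaussianInit (Fin d) d)) (W : Params m d) :
    deviation (fun w => ∑ i ∈ s, Y i w) W = ∑ i ∈ s, deviation (Y i) W := by
  unfold deviation
  rw [integral_finsetSum _ hY, Finset.sum_comm, Finset.mul_sum, Finset.sum_sub_distrib]

/-- Uniform deviation bound without logarithmic factor, by chaining. -/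
theorem exists_pairGate_deviation_bound (hd : 0 < d) (hm : 0 < m) :
    ∃ G : Params m d → ℝ, Measurable G ∧ (∀ W, 0 ≤ G W) ∧
      Integrable G (gaussianInit (Fin m × Fin d) d) ∧
      ∫ W, G W ∂(gaussianInit (Fin m × Fin d) d) ≤ 144 * d / √(m : ℝ) ∧
      ∀ W (y y' : EuclideanSpace ℝ (Fin d)), ‖y‖ = 1 → ‖y'‖ = 1 →
        |deviation (pairGate (Nat.log 4 m) y y') W| ≤ G W := by
  have hm' : (0 : ℝ) < m := by exact_mod_cast hm
  have hd1 : (1 : ℝ) ≤ d := by exact_mod_cast hd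
  have hsm : 0 < √(m : ℝ) := Real.sqrt_pos.2 hm'
  set J := Nat.log 4 m with hJ
  have hlev : ∀ j ∈ Finset.range (J + 1), ∃ G : Params m d → ℝ, Measurable G ∧ (∀ W, 0 ≤ G W) ∧
      Integrable G (gaussianInit (Fin m × Fin d) d) ∧
      ∫ W, G W ∂(gaussianInit (Fin m × Fin d) d)
        ≤ 36 * d / √(m : ℝ) * (((j : ℝ) + 1) * ((2 : ℝ) ^ j)⁻¹) ∧
      ∀ W (y y' : EuclideanSpace ℝ (Fin d)), ‖y‖ = 1 → ‖y'‖ = 1 →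
        |deviation (increment j y y') W| ≤ G W := by
    intro j hj
    have hjJ : j ≤ J := Nat.lt_succ_iff.1 (Finset.mem_range.1 hj)
    obtain ⟨𝒴, hmem, hrep, hcard⟩ := exists_increment_family j
    have h4 : (4 : ℝ) ^ j ≤ m := by
      have : 4 ^ j ≤ m := (Nat.pow_le_pow_right (by norm_num) hjJ).trans
        (Nat.pow_log_le_self 4 hm.ne')
      exact_mod_cast this
    have h2 : (2 : ℝ) ^ j ≤ √(m : ℝ) := by
      rw [Real.le_sqrt (by positivity) hm'.le, ← pow_mul, mul_comm, pow_mul]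
      norm_num; exact h4
    have hp2 : (0 : ℝ) < 2 ^ j := by positivity
    -- With `l = 2 ^ j / (2 * √m)` the variance contributes exactly `4 * d`, and dividing the
    -- logarithmic size by `l * m` leaves a summable `(j + 1) * 2⁻ʲ / √m`. The constraint `l ≤ 1 /
    -- 2` is `4 ^ j ≤ m`, which is why the chain stops at `Nat.log 4 m`.
    obtain ⟨G, hG1, hG2, hG3, hG4, hG5⟩ := exists_maximal_bound (m := m) (d := d) hm 𝒴
      (fun Y hY => by obtain ⟨y, y', -, -, rfl⟩ := hrep Y hY; exact measurable_increment j y y')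
      (fun Y hY => by obtain ⟨y, y', -, -, rfl⟩ := hrep Y hY; exact abs_increment_le j y y')
      (v := 16 * d * ((4 : ℝ) ^ j)⁻¹)
      (fun Y hY => by
        obtain ⟨y, y', hy, hy', rfl⟩ := hrep Y hY; exact integral_increment_sq_le hd hy hy' j)
      hcard (by positivity) (by positivity) (l := 2 ^ j / (2 * √(m : ℝ))) (by positivity)
      (by rw [div_le_iff₀ (by positivity)]; linarith)
    refine ⟨G, hG1, hG2, hG3, hG4.trans ?_, fun W y y' hy hy' => hG5 _ (hmem y y' hy hy') W⟩
    have hsq : √(m : ℝ) ^ 2 = m := Real.sq_sqrt hm'.le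
    have h44 : (4 : ℝ) ^ j = 2 ^ j * 2 ^ j := by rw [← mul_pow]; norm_num
    have e1 : (m : ℝ) * ((2 ^ j / (2 * √(m : ℝ))) ^ 2 * (16 * d * ((4 : ℝ) ^ j)⁻¹)) = 4 * d := by
      rw [div_pow, mul_pow, hsq, h44]
      field_simp
      ring
    rw [e1, div_le_iff₀ (by positivity)]
    have e2 : 36 * d / √(m : ℝ) * (((j : ℝ) + 1) * ((2 : ℝ) ^ j)⁻¹) *
        (2 ^ j / (2 * √(m : ℝ)) * m) = 18 * d * (j + 1) := by
      nth_rewrite 3 [← hsq]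
      field_simp
      ring
    rw [e2]
    have : (1 : ℝ) ≤ d * (j + 1) := by nlinarith [Nat.cast_nonneg (α := ℝ) j]
    nlinarith [Nat.cast_nonneg (α := ℝ) j]
  choose! G hG1 hG2 hG3 hG4 hG5 using hlev
  refine ⟨fun W => ∑ j ∈ Finset.range (J + 1), G j W, Finset.measurable_sum _ hG1,
    fun W => Finset.sum_nonneg fun j hj => hG2 j hj W, integrable_finsetSum _ hG3, ?_,
    fun W y y' hy hy' => ?_⟩
  · rw [integral_finsetSum _ hG3]
    refine (Finset.sum_le_sum hG4).trans ?_
    rw [← Finset.mul_sum]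
    calc _ ≤ 36 * d / √(m : ℝ) * 4 := by
          gcongr
          exact sum_succ_mul_inv_two_pow_le _
      _ = _ := by ring
  · have : pairGate J y y' = fun w => ∑ j ∈ Finset.range (J + 1), increment j y y' w := by
      ext w; rw [sum_increment]
    rw [this, deviation_sum _ _ fun j _ =>
      MDP.integrable_of_abs_le (measurable_increment j y y') (abs_increment_le j y y')]
    exact (Finset.abs_sum_le_sum_abs _ _).trans
      (Finset.sum_le_sum fun j hj => hG5 j hj W y y' hy hy')

lemma inv_sixteen_pow_log_le (hm : 0 < m) : ((16 : ℝ) ^ Nat.log 4 m)⁻¹ ≤ 16 / √(m : ℝ) := by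
  have hm1 : (1 : ℝ) ≤ m := by exact_mod_cast hm
  have h1 : (m : ℝ) ≤ 4 ^ (Nat.log 4 m + 1) := by
    exact_mod_cast (Nat.lt_pow_succ_log_self (by norm_num) m).le
  have h2 : (1 : ℝ) ≤ 4 ^ Nat.log 4 m := one_le_pow₀ (by norm_num)
  have h3 : (16 : ℝ) ^ Nat.log 4 m = 4 ^ Nat.log 4 m * 4 ^ Nat.log 4 m := by
    rw [← mul_pow]; norm_num
  have h4 : √(m : ℝ) ≤ m := by
    rw [Real.sqrt_le_left (by positivity)]; nlinarith
  rw [pow_succ] at h1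
  rw [inv_le_comm₀ (by positivity) (by positivity), inv_div, h3, div_le_iff₀ (by norm_num)]
  nlinarith

end Chaining

/-! ### Empirical and population norms of the gate moment -/

section MomentGap

variable {X : Type*} [MeasurableSpace X] {d m : ℕ} {σ : Measure X} [IsProbabilityMeasure σ]
  {Ad : X → ℝ} {B : ℝ} {x : X → EuclideanSpace ℝ (Fin d)}

attribute [local irreducible] gridGate

/-- The gate moment with rounded half-spaces. -/
def gridMoment (j : ℕ) (σ : Measure X) (Ad : X → ℝ) (x : X → EuclideanSpace ℝ (Fin d))
    (w : EuclideanSpace ℝ (Fin d)) : EuclideanSpace ℝ (Fin d) :=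
  ∫ p, (Ad p * gridGate j (x p) w) • x p ∂σ

lemma norm_mul_smul_le {g : ℝ} (hg0 : 0 ≤ g) (hg1 : g ≤ 1) {a : ℝ} (ha : |a| ≤ B)
    {y : EuclideanSpace ℝ (Fin d)} (hy : ‖y‖ = 1) : ‖(a * g) • y‖ ≤ B := by
  rw [norm_smul, hy, mul_one, Real.norm_eq_abs, abs_mul, abs_of_nonneg hg0]
  nlinarith [abs_nonneg a]

lemma measurable_gridGate_comp (hx : Measurable x) (j : ℕ) :
    Measurable fun z : X × EuclideanSpace ℝ (Fin d) => gridGate j (x z.1) z.2 :=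
  (measurable_gridGate_uncurry j).comp ((hx.comp measurable_fst).prodMk measurable_snd)

lemma integrable_gridMoment (hm : Measurable Ad) (hAd : ∀ p, |Ad p| ≤ B) (hx : Measurable x)
    (hx1 : ∀ p, ‖x p‖ = 1) (j : ℕ) (w : EuclideanSpace ℝ (Fin d)) :
    Integrable (fun p => (Ad p * gridGate j (x p) w) • x p) σ := by
  have h : Measurable fun p => gridGate j (x p) w :=
    (measurable_gridGate_comp hx j).comp (measurable_id.prodMk measurable_const)
  exact Integrable.of_bound ((hm.mul h).smul hx).aestronglyMeasurable B
    (ae_of_all _ fun p => norm_mul_smul_le (gridGate_nonneg _ _ _) (gridGate_le_one _ _ _)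
      (hAd p) (hx1 p))

lemma norm_gridMoment_le (hAd : ∀ p, |Ad p| ≤ B) (hx1 : ∀ p, ‖x p‖ = 1) (j : ℕ)
    (w : EuclideanSpace ℝ (Fin d)) : ‖gridMoment j σ Ad x w‖ ≤ B := by
  simpa [gridMoment] using norm_integral_le_of_norm_le_const (μ := σ)
    (f := fun p => (Ad p * gridGate j (x p) w) • x p)
    (ae_of_all _ fun p => norm_mul_smul_le (gridGate_nonneg _ _ _) (gridGate_le_one _ _ _)
      (hAd p) (hx1 p))

lemma measurable_gridMoment (hm : Measurable Ad) (hx : Measurable x) (j : ℕ) :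
    Measurable (gridMoment j σ Ad x) := by
  have h : Measurable fun z : EuclideanSpace ℝ (Fin d) × X => gridGate j (x z.2) z.1 :=
    (measurable_gridGate_comp hx j).comp measurable_swap
  have : StronglyMeasurable fun z : EuclideanSpace ℝ (Fin d) × X =>
      (Ad z.2 * gridGate j (x z.2) z.1) • x z.2 :=
    (((hm.comp measurable_snd).mul h).smul (hx.comp measurable_snd)).stronglyMeasurable
  exact this.integral_prod_right'.measurable

/-- Here `w` is fixed and `x` varies: the gates disagree only on a slab of half-width proportional
to `‖w‖`, and regularity divides by `‖w‖`, so the bound is uniform in `w`. This controls the last,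
unchained level. -/
lemma norm_gateMoment_sub_gridMoment_le (hm : Measurable Ad) (hAd : ∀ p, |Ad p| ≤ B)
    (hx : Measurable x) (hx1 : ∀ p, ‖x p‖ = 1) {c : ℝ} (hc : 0 ≤ c)
    (hslab : ∀ y : EuclideanSpace ℝ (Fin d), y ≠ 0 → ∀ u : ℝ, 0 ≤ u →
      σ.real {p | |inner ℝ y (x p)| ≤ u} ≤ c * u / ‖y‖) (j : ℕ) (w : EuclideanSpace ℝ (Fin d)) :
    ‖gateMoment σ Ad x w - gridMoment j σ Ad x w‖ ≤ B * (c * (√(d : ℝ) * ((16 : ℝ) ^ j)⁻¹)) := by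
  have hB : 0 ≤ B := (abs_nonneg _).trans (hAd (nonempty_of_isProbabilityMeasure σ).some)
  by_cases hw : w = 0
  · subst hw
    have : gateMoment σ Ad x 0 - gridMoment j σ Ad x 0 = 0 := by
      simp [gateMoment, gridMoment, gridGate, gate]
    rw [this, norm_zero]
    positivity
  set u : ℝ := √(d : ℝ) * ((16 : ℝ) ^ j)⁻¹ * ‖w‖ with hu
  have hms : MeasurableSet {p | |inner ℝ w (x p)| ≤ u} :=
    measurableSet_le (measurable_const.inner hx).abs measurable_const
  rw [gateMoment, gridMoment, ← integral_sub (integrable_gateMoment hm hAd hx hx1 w)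
    (integrable_gridMoment hm hAd hx hx1 j w)]
  have hpt : ∀ p, ‖(Ad p * gate (inner ℝ w (x p))) • x p - (Ad p * gridGate j (x p) w) • x p‖
      ≤ B * Set.indicator {p | |inner ℝ w (x p)| ≤ u} 1 p := fun p => by
    rw [← sub_smul, ← mul_sub]
    by_cases hp : p ∈ {p | |inner ℝ w (x p)| ≤ u}
    · rw [Set.indicator_of_mem hp, Pi.one_apply, mul_one, norm_smul, hx1, mul_one,
        Real.norm_eq_abs, abs_mul]
      have : |gate (inner ℝ w (x p)) - gridGate j (x p) w| ≤ 1 := by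
        rw [abs_le]
        constructor <;> linarith [gate_nonneg (inner ℝ w (x p)), gate_le_one (inner ℝ w (x p)),
          gridGate_nonneg j (x p) w, gridGate_le_one j (x p) w]
      nlinarith [hAd p, abs_nonneg (Ad p)]
    · have : gate (inner ℝ w (x p)) = gridGate j (x p) w := by
        by_contra h
        exact hp (gridGate_ne_imp h)
      rw [Set.indicator_of_notMem hp, this]
      simp
  have hi : Integrable (Set.indicator {p | |inner ℝ w (x p)| ≤ u} (1 : X → ℝ)) σ :=
    (integrable_const (1 : ℝ)).indicator hms
  refine (norm_integral_le_of_norm_le (hi.const_mul B) (ae_of_all _ hpt)).trans ?_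
  rw [integral_const_mul, integral_indicator_one hms]
  gcongr
  refine (hslab w hw u (by positivity)).trans (le_of_eq ?_)
  rw [hu]
  have : ‖w‖ ≠ 0 := norm_ne_zero_iff.2 hw
  field_simp

/-- Squaring duplicates the integral. All dependence on `w` then sits in `pairGate`, a family
indexed by pairs of unit vectors only. -/
lemma norm_gridMoment_sq (hm : Measurable Ad) (hAd : ∀ p, |Ad p| ≤ B) (hx : Measurable x)
    (hx1 : ∀ p, ‖x p‖ = 1) (j : ℕ) (w : EuclideanSpace ℝ (Fin d)) :
    ‖gridMoment j σ Ad x w‖ ^ 2 = ∫ z : X × X, Ad z.1 * Ad z.2 * inner ℝ (x z.1) (x z.2) *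
      pairGate j (x z.1) (x z.2) w ∂(σ.prod σ) := by
  have hi := integrable_gridMoment (σ := σ) hm hAd hx hx1 j w
  have hB : 0 ≤ B := (abs_nonneg _).trans (hAd (nonempty_of_isProbabilityMeasure σ).some)
  have hg : Measurable fun p => gridGate j (x p) w :=
    (measurable_gridGate_comp hx j).comp (measurable_id.prodMk measurable_const)
  have hprod : Integrable (fun z : X × X => Ad z.1 * Ad z.2 * inner ℝ (x z.1) (x z.2) *
      pairGate j (x z.1) (x z.2) w) (σ.prod σ) := by
    refine MDP.integrable_of_abs_le (B := B * B * 1 * 1) ?_ fun z => ?_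
    · exact (((hm.comp measurable_fst).mul (hm.comp measurable_snd)).mul
        ((hx.comp measurable_fst).inner (hx.comp measurable_snd))).mul
        ((hg.comp measurable_fst).mul (hg.comp measurable_snd))
    · rw [abs_mul, abs_mul, abs_mul]
      have h1 : |inner ℝ (x z.1) (x z.2)| ≤ 1 := by
        simpa [hx1] using abs_real_inner_le_norm (x z.1) (x z.2)
      gcongr
      · exact hAd _
      · exact hAd _
      · exact abs_pairGate_le _ _ _ _
  rw [integral_prod _ hprod, ← real_inner_self_eq_norm_sq]
  conv_lhs => rw [gridMoment]
  have h1 : ∀ v : EuclideanSpace ℝ (Fin d), inner ℝ (∫ p, (Ad p * gridGate j (x p) w) • x p ∂σ) v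
      = ∫ p, Ad p * gridGate j (x p) w * inner ℝ (x p) v ∂σ := fun v => by
    rw [real_inner_comm, ← integral_inner hi v]
    simp only [inner_smul_right, real_inner_comm v]
  rw [h1]
  refine integral_congr_ae (ae_of_all _ fun p => ?_)
  simp only
  rw [real_inner_comm, h1, ← integral_const_mul]
  refine integral_congr_ae (ae_of_all _ fun p' => ?_)
  simp only [pairGate]
  rw [real_inner_comm (x p) (x p')]
  ring

/-- After exchanging integrals the difference is an average over pairs of points of minus the
deviation of `pairGate`, with weights at most `B ^ 2`. The bound is uniform over `σ` and `Ad`, which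
may depend on `W`. -/
lemma integral_norm_gridMoment_sq_sub_le (hm : Measurable Ad) (hAd : ∀ p, |Ad p| ≤ B)
    (hx : Measurable x) (hx1 : ∀ p, ‖x p‖ = 1) (j : ℕ) {W : Params m d} {g : ℝ}
    (hg : ∀ y y' : EuclideanSpace ℝ (Fin d), ‖y‖ = 1 → ‖y'‖ = 1 →
      |deviation (pairGate j y y') W| ≤ g) :
    ∫ w, ‖gridMoment j σ Ad x w‖ ^ 2 ∂(gaussianInit (Fin d) d)
      - (1 / m : ℝ) * ∑ r, ‖gridMoment j σ Ad x (block W r)‖ ^ 2 ≤ B ^ 2 * g := by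
  set μ := gaussianInit (Fin d) d
  have hB : 0 ≤ B := (abs_nonneg _).trans (hAd (nonempty_of_isProbabilityMeasure σ).some)
  set F : X × X → ℝ := fun z => Ad z.1 * Ad z.2 * inner ℝ (x z.1) (x z.2) with hF
  have hFm : Measurable F := ((hm.comp measurable_fst).mul (hm.comp measurable_snd)).mul
    ((hx.comp measurable_fst).inner (hx.comp measurable_snd))
  have hFb : ∀ z, |F z| ≤ B ^ 2 := fun z => by
    have h1 : |inner ℝ (x z.1) (x z.2)| ≤ 1 := by
      simpa [hx1] using abs_real_inner_le_norm (x z.1) (x z.2)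
    rw [hF, abs_mul, abs_mul]
    calc _ ≤ B * B * 1 := by
          gcongr
          · exact hAd _
          · exact hAd _
      _ = B ^ 2 := by ring
  have hPm : Measurable fun q : (X × X) × EuclideanSpace ℝ (Fin d) =>
      pairGate j (x q.1.1) (x q.1.2) q.2 :=
    ((measurable_gridGate_comp hx j).comp
      ((measurable_fst.comp measurable_fst).prodMk measurable_snd)).mul
    ((measurable_gridGate_comp hx j).comp
      ((measurable_snd.comp measurable_fst).prodMk measurable_snd))
  have hFP : ∀ z w, |F z * pairGate j (x z.1) (x z.2) w| ≤ B ^ 2 := fun z w => by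
    rw [abs_mul]
    nlinarith [hFb z, abs_nonneg (F z), abs_pairGate_le j (x z.1) (x z.2) w,
      abs_nonneg (pairGate j (x z.1) (x z.2) w)]
  have hi1 : ∀ w, Integrable (fun z => F z * pairGate j (x z.1) (x z.2) w) (σ.prod σ) := fun w =>
    MDP.integrable_of_abs_le (hFm.mul (hPm.comp (measurable_id.prodMk measurable_const)))
      fun z => hFP z w
  have hIm : Measurable fun z : X × X => ∫ w, pairGate j (x z.1) (x z.2) w ∂μ :=
    (hPm.stronglyMeasurable.integral_prod_right').measurable
  have e1 : ∫ w, ‖gridMoment j σ Ad x w‖ ^ 2 ∂μ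
      = ∫ z, F z * ∫ w, pairGate j (x z.1) (x z.2) w ∂μ ∂(σ.prod σ) := by
    simp only [norm_gridMoment_sq hm hAd hx hx1, ← integral_const_mul]
    refine integral_integral_swap ?_
    refine Integrable.of_bound (C := B ^ 2) ?_ (ae_of_all _ fun q => hFP q.2 q.1)
    exact ((hFm.comp measurable_snd).mul (hPm.comp measurable_swap)).aestronglyMeasurable
  have e2 : (1 / m : ℝ) * ∑ r, ‖gridMoment j σ Ad x (block W r)‖ ^ 2
      = ∫ z, F z * ((1 / m : ℝ) * ∑ r, pairGate j (x z.1) (x z.2) (block W r)) ∂(σ.prod σ) := by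
    simp only [norm_gridMoment_sq hm hAd hx hx1]
    rw [← integral_finsetSum _ fun r _ => hi1 _, ← integral_const_mul]
    congr 1
    ext z
    rw [← Finset.mul_sum, mul_left_comm]
  have i1 : Integrable (fun z => F z * ∫ w, pairGate j (x z.1) (x z.2) w ∂μ) (σ.prod σ) := by
    refine MDP.integrable_of_abs_le (B := B ^ 2) (hFm.mul hIm) fun z => ?_
    rw [← integral_const_mul]
    exact MDP.abs_integral_le_of_abs_le fun w => hFP z w
  have i2 : Integrable (fun z => F z * ((1 / m : ℝ) *
      ∑ r, pairGate j (x z.1) (x z.2) (block W r))) (σ.prod σ) := by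
    have := (integrable_finsetSum Finset.univ
      fun r _ => hi1 (block W r)).const_mul (1 / m : ℝ)
    refine this.congr (ae_of_all _ fun z => ?_)
    simp only
    rw [← Finset.mul_sum, mul_left_comm]
  rw [e1, e2, ← integral_sub i1 i2]
  refine (le_abs_self _).trans (MDP.abs_integral_le_of_abs_le fun z => ?_)
  rw [← mul_sub, abs_mul, abs_sub_comm]
  exact mul_le_mul (hFb z) (hg _ _ (hx1 _) (hx1 _)) (abs_nonneg _) (by positivity)

/-- Jensen bounds the mean norm by the population root mean square, so only the difference of second
moments is needed; `δ` trades this difference of squares for a difference of norms. -/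
theorem integral_norm_gateMoment_sub_empNorm_le (hm : Measurable Ad) (hAd : ∀ p, |Ad p| ≤ B)
    (hx : Measurable x) (hx1 : ∀ p, ‖x p‖ = 1) {c : ℝ} (hc : 0 ≤ c)
    (hslab : ∀ y : EuclideanSpace ℝ (Fin d), y ≠ 0 → ∀ u : ℝ, 0 ≤ u →
      σ.real {p | |inner ℝ y (x p)| ≤ u} ≤ c * u / ‖y‖) (hm0 : 0 < m) {W : Params m d} {g : ℝ}
    (hg : ∀ y y' : EuclideanSpace ℝ (Fin d), ‖y‖ = 1 → ‖y'‖ = 1 →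
      |deviation (pairGate (Nat.log 4 m) y y') W| ≤ g) (hg0 : 0 ≤ g) {δ : ℝ} (hδ : 0 < δ) :
    ∫ w, ‖gateMoment σ Ad x w‖ ∂(gaussianInit (Fin d) d) - empNorm (gateMoment σ Ad x) W
      ≤ δ + B ^ 2 * (g + 64 * c * √(d : ℝ) / √(m : ℝ)) / δ := by
  set μ := gaussianInit (Fin d) d
  set J := Nat.log 4 m with hJ
  have hB : 0 ≤ B := (abs_nonneg _).trans (hAd (nonempty_of_isProbabilityMeasure σ).some)
  have hm' : (0 : ℝ) < m := by exact_mod_cast hm0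
  set h := gateMoment σ Ad x with hh
  set hJ' := gridMoment J σ Ad x with hhJ
  set η : ℝ := B * (c * (√(d : ℝ) * (16 / √(m : ℝ)))) with hη
  have hdiff : ∀ w, ‖h w - hJ' w‖ ≤ η := fun w => by
    refine (norm_gateMoment_sub_gridMoment_le hm hAd hx hx1 hc hslab J w).trans ?_
    rw [hη]
    gcongr
    exact inv_sixteen_pow_log_le hm0
  have hsq : ∀ w, |‖h w‖ ^ 2 - ‖hJ' w‖ ^ 2| ≤ 2 * B * η := fun w => by
    have h1 : |‖h w‖ - ‖hJ' w‖| ≤ η := (abs_norm_sub_norm_le _ _).trans (hdiff w)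
    have h2 : ‖h w‖ ≤ B := norm_gateMoment_le hAd hx1 w
    have h3 : ‖hJ' w‖ ≤ B := norm_gridMoment_le hAd hx1 J w
    rw [sq_sub_sq, abs_mul, abs_of_nonneg (a := ‖h w‖ + ‖hJ' w‖) (by positivity)]
    exact mul_le_mul (by linarith) h1 (abs_nonneg _) (by positivity)
  have hhm : Measurable h := measurable_gateMoment hm hx
  have hhJm : Measurable hJ' := measurable_gridMoment hm hx J
  have hhn : Integrable (fun w => ‖h w‖) μ :=
    (Integrable.of_bound hhm.aestronglyMeasurable B
      (ae_of_all _ (norm_gateMoment_le hAd hx1))).norm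
  have hi : Integrable (fun w => ‖h w‖ ^ 2) μ := by
    refine MDP.integrable_of_abs_le (B := B ^ 2) (hhm.norm.pow_const 2) fun w => ?_
    rw [abs_pow, abs_norm]
    exact pow_le_pow_left₀ (norm_nonneg _) (norm_gateMoment_le hAd hx1 w) 2
  have hiJ : Integrable (fun w => ‖hJ' w‖ ^ 2) μ := by
    refine MDP.integrable_of_abs_le (B := B ^ 2) (hhJm.norm.pow_const 2) fun w => ?_
    rw [abs_pow, abs_norm]
    exact pow_le_pow_left₀ (norm_nonneg _) (norm_gridMoment_le hAd hx1 J w) 2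
  have hD := integral_norm_gridMoment_sq_sub_le (σ := σ) hm hAd hx hx1 J hg
  have h1 : ∫ w, ‖h w‖ ^ 2 ∂μ ≤ ∫ w, ‖hJ' w‖ ^ 2 ∂μ + 2 * B * η := by
    have : ∫ w, ‖h w‖ ^ 2 ∂μ ≤ ∫ w, (‖hJ' w‖ ^ 2 + 2 * B * η) ∂μ :=
      integral_mono hi (hiJ.add (integrable_const _)) fun w => by
        have := (abs_le.1 (hsq w)).2
        simp only
        linarith
    rw [integral_add hiJ (integrable_const _)] at this
    simpa using this
  have h2 : (1 / m : ℝ) * ∑ r, ‖hJ' (block W r)‖ ^ 2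
      ≤ (1 / m : ℝ) * ∑ r, ‖h (block W r)‖ ^ 2 + 2 * B * η := by
    have : ∑ r : Fin m, ‖hJ' (block W r)‖ ^ 2 ≤ ∑ r : Fin m, (‖h (block W r)‖ ^ 2 + 2 * B * η) :=
      Finset.sum_le_sum fun r _ => by linarith [(abs_le.1 (hsq (block W r))).1]
    rw [Finset.sum_add_distrib, Finset.sum_const, Finset.card_univ, Fintype.card_fin,
      nsmul_eq_mul] at this
    calc _ ≤ (1 / m : ℝ) * (∑ r, ‖h (block W r)‖ ^ 2 + m * (2 * B * η)) := by gcongr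
      _ = _ := by field_simp
  have h3 : ∫ w, ‖h w‖ ^ 2 ∂μ - (1 / m : ℝ) * ∑ r, ‖h (block W r)‖ ^ 2
      ≤ B ^ 2 * (g + 64 * c * √(d : ℝ) / √(m : ℝ)) := by
    -- Rounding is undone twice, in the population and in the empirical moment, each at cost `2 * B
    -- * η`.
    have : 4 * B * η = B ^ 2 * (64 * c * √(d : ℝ) / √(m : ℝ)) := by rw [hη]; ring
    rw [mul_add, ← this]
    linarith
  have hJensen : (∫ w, ‖h w‖ ∂μ) ^ 2 ≤ ∫ w, ‖h w‖ ^ 2 ∂μ := by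
    have hv := variance_nonneg (fun w => ‖h w‖) μ
    rw [variance_eq_sub (MemLp.of_bound hhm.norm.aestronglyMeasurable B
      (ae_of_all _ fun w => by
        rw [norm_norm]; exact norm_gateMoment_le hAd hx1 w))] at hv
    have e : ∫ w, ((fun w => ‖h w‖) ^ 2) w ∂μ = ∫ w, ‖h w‖ ^ 2 ∂μ := rfl
    rw [e] at hv
    linarith
  set a := ∫ w, ‖h w‖ ∂μ with ha
  have ha0 : 0 ≤ a := integral_nonneg fun w => norm_nonneg _
  set bb := empNorm h W with hbb
  have hb0 : 0 ≤ bb := Real.sqrt_nonneg _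
  have hbsq : bb ^ 2 = (1 / m : ℝ) * ∑ r, ‖h (block W r)‖ ^ 2 := Real.sq_sqrt (by positivity)
  set D := B ^ 2 * (g + 64 * c * √(d : ℝ) / √(m : ℝ)) with hDdef
  have hD0 : 0 ≤ D := by positivity
  have hab : a ^ 2 - bb ^ 2 ≤ D := by rw [hbsq]; linarith
  have hDδ : 0 ≤ D / δ := by positivity
  -- Either `a` itself is at most `δ`, or `(a - bb) * δ ≤ (a - bb) * (a + bb) ≤ D` whenever `a >
  -- bb`.
  by_cases hle : a ≤ δ
  · linarith
  · rw [not_le] at hle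
    have h5 : (a - bb) * δ ≤ D := by
      by_cases hneg : a ≤ bb
      · nlinarith
      · rw [not_le] at hneg
        nlinarith
    have h6 : a - bb ≤ D / δ := (le_div_iff₀ hδ).2 h5
    linarith

end MomentGap

/-! ### The optimality gap of a stationary point -/

lemma MDP.abs_totalReward_le {S A : Type*} [MeasurableSpace S] [MeasurableSpace A]
    (M : MDP S A) {Q : ℝ} (hM : M.RewardBound Q) (π : Kernel S A) [IsMarkovKernel π] :
    |M.totalReward π| ≤ Q := by
  rw [M.totalReward_eq π hM]
  exact MDP.abs_integral_le_of_abs_le (M.abs_meanReward_le hM)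

section Gap

variable {S A : Type*} [MeasurableSpace S] [Fintype A] [MeasurableSpace A]
  [MeasurableSingletonClass A] {m d : ℕ} {x : S × A → EuclideanSpace ℝ (Fin d)}

/-- The constant in the optimality gap of stationary points. -/
def gapConstant (d : ℕ) (c Q : ℝ) : ℝ :=
  1 + 4 * Q ^ 2 * (144 * d + 64 * c * √(d : ℝ)) + 2 * Q * (d + c ^ 2 + 1)

lemma gapConstant_pos {c Q : ℝ} (hc : 0 ≤ c) (hQ : 0 ≤ Q) : 0 < gapConstant d c Q := by
  unfold gapConstant
  positivity

lemma sqrt_le_linear {X κ : ℝ} (hX : 0 ≤ X) (hκ : 0 < κ) : 2 * √X ≤ X / κ + κ := by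
  have h : X / κ + κ - 2 * √X = (√X - κ) ^ 2 / κ := by
    field_simp
    rw [sub_sq, Real.sq_sqrt hX]
    ring
  have : 0 ≤ (√X - κ) ^ 2 / κ := by positivity
  linarith

/-- The gap at a stationary point is controlled by the approximation error and by a function of the
initial weights of small mean. -/
theorem exists_gap_bound [Nonempty A] {M : MDP S A} {Q : ℝ} (hQ : 0 < Q) (hd : 2 ≤ d)
    (hM : M.RewardBound Q) (hx : Measurable x) (hx1 : ∀ p, ‖x p‖ = 1) {c : ℝ} (hc : 0 ≤ c)
    (hreg : RegularVisits M x c) {πopt : Kernel S A} [IsMarkovKernel πopt] {τ : ℝ} (hτ : 0 < τ)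
    (hm : 0 < m) {R : ℝ} (hR : 1 < R) :
    ∃ Ψ : Params m d → ℝ, Integrable Ψ (gaussianInit (Fin m × Fin d) d) ∧ (∀ W, 0 ≤ Ψ W) ∧
      ∫ W, Ψ W ∂(gaussianInit (Fin m × Fin d) d)
        ≤ gapConstant d c Q * (R ^ (3 / 2 : ℝ) * (m : ℝ) ^ (-(1 / 4) : ℝ)) ∧
      ∀ (b : Fin m → ℝ) (W θ' : Params m d), (∀ r, |b r| = 1) → IsStationaryPoint M x τ b W R θ' →
        M.visit πopt ≪ M.visit (neuralPolicy x τ b θ') → ∀ f ∈ FRInfty x b W R,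
        Integrable (fun p => f p - uFun M x τ πopt b θ' p) (M.visit (neuralPolicy x τ b θ')) ∧
        (1 - M.discount) * (M.totalReward πopt - M.totalReward (neuralPolicy x τ b θ'))
          ≤ 2 * Q * ∫ p, |f p - uFun M x τ πopt b θ' p| ∂(M.visit (neuralPolicy x τ b θ'))
            + Ψ W := by
  have hd0 : 0 < d := by omega
  have hm' : (0 : ℝ) < m := by exact_mod_cast hm
  have hR0 : 0 < R := by linarith
  obtain ⟨G, -, hG0, hGi, hGint, hG⟩ := exists_pairGate_deviation_bound (d := d) hd0 hm
  set μ := gaussianInit (Fin m × Fin d) d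
  set s := √(m : ℝ) with hs
  have hs0 : 0 < s := Real.sqrt_pos.2 hm'
  have hss : s * s = m := Real.mul_self_sqrt hm'.le
  set q := √s with hq
  have hq0 : 0 < q := Real.sqrt_pos.2 hs0
  have hqq : q * q = s := Real.mul_self_sqrt hs0.le
  set ρ := √R with hρ
  have hρ0 : 0 < ρ := Real.sqrt_pos.2 hR0
  have hρρ : ρ * ρ = R := Real.mul_self_sqrt hR0.le
  have hρ1 : 1 ≤ ρ := Real.one_le_sqrt.2 hR.le
  have hrate : R ^ (3 / 2 : ℝ) * (m : ℝ) ^ (-(1 / 4) : ℝ) = R * ρ * q⁻¹ := by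
    have h1 : R ^ (3 / 2 : ℝ) = R * ρ := by
      rw [show (3 / 2 : ℝ) = 1 + 1 / 2 by norm_num, Real.rpow_add hR0, Real.rpow_one,
        hρ, Real.sqrt_eq_rpow]
    have h2 : (m : ℝ) ^ (-(1 / 4) : ℝ) = q⁻¹ := by
      rw [Real.rpow_neg hm'.le, hq, hs, Real.sqrt_eq_rpow, Real.sqrt_eq_rpow,
        ← Real.rpow_mul hm'.le]
      norm_num
    rw [h1, h2]
  -- Truncation level `t ^ 2 = R / √m`: it gives both the mean of `smallCount` and the term `c ^ 2 *
  -- R ^ 2 / t ^ 2` the order `R * √m`.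
  set t := ρ / q with ht
  have ht0 : 0 < t := by positivity
  have ht2 : t ^ 2 = R / s := by rw [ht, div_pow, sq, sq, hρρ, hqq]
  set N : Params m d → ℝ := fun W => smallCount t W with hN
  have hNi : Integrable N μ := MDP.integrable_of_abs_le (measurable_smallCount t) fun W => by
    rw [abs_of_nonneg (smallCount_nonneg t W)]; exact smallCount_le t W
  have hNint : ∫ W, N W ∂μ ≤ d * R * s := by
    refine (integral_smallCount_le hd ht0.le).trans (le_of_eq ?_)
    rw [ht2, ← hss]
    field_simp
  set E := 64 * c * √(d : ℝ) / s with hE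
  have hΨi1 : Integrable (fun W => (G W + E) * q) μ := (hGi.add (integrable_const _)).mul_const _
  have hΨi2 : Integrable (fun W => (N W + c ^ 2 * R * s) / (ρ * q)) μ :=
    (hNi.add (integrable_const _)).div_const _
  have hi1 : Integrable (fun W => R * (q⁻¹ + (2 * Q) ^ 2 * ((G W + E) * q))) μ :=
    ((integrable_const _).add (hΨi1.const_mul _)).const_mul _
  have hi2 : Integrable (fun W => 2 * Q * (R / s * ((N W + c ^ 2 * R * s) / (ρ * q) + ρ * q))) μ :=
    ((hΨi2.add (integrable_const _)).const_mul _).const_mul _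
  -- The first summand is the moment comparison with `δ = m^{-1/4}`. The second is the linearization
  -- error with its square root linearized, so that only the mean of `smallCount` is required.
  refine ⟨fun W => R * (q⁻¹ + (2 * Q) ^ 2 * ((G W + E) * q))
      + 2 * Q * (R / s * ((N W + c ^ 2 * R * s) / (ρ * q) + ρ * q)), hi1.add hi2, fun W => ?_, ?_,
      fun b W θ' hb hst hac f hf => ?_⟩
  · have := hG0 W
    have : 0 ≤ N W := smallCount_nonneg t W
    positivity
  · rw [integral_add hi1 hi2, integral_const_mul, integral_const_mul, integral_const_mul,
      integral_add (integrable_const _) (hΨi1.const_mul _), integral_const_mul, integral_mul_const,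
      integral_add hGi (integrable_const _), integral_add hΨi2 (integrable_const _),
      integral_div (ρ * q), integral_add hNi (integrable_const _), hrate]
    simp only [integral_const, probReal_univ, one_smul]
    have h1 : R * (q⁻¹ + (2 * Q) ^ 2 * ((∫ W, G W ∂μ + E) * q))
        ≤ R * (q⁻¹ + (2 * Q) ^ 2 * ((144 * d / s + E) * q)) := by gcongr
    have h2 : 2 * Q * (R / s * ((∫ W, N W ∂μ + c ^ 2 * R * s) / (ρ * q) + ρ * q))
        ≤ 2 * Q * (R / s * ((d * R * s + c ^ 2 * R * s) / (ρ * q) + ρ * q)) := by gcongr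
    refine (add_le_add h1 h2).trans ?_
    have e1 : R * (q⁻¹ + (2 * Q) ^ 2 * ((144 * d / s + E) * q))
        = (1 + 4 * Q ^ 2 * (144 * d + 64 * c * √(d : ℝ))) * (R * 1 * q⁻¹) := by
      rw [hE, ← hqq]
      field_simp
      ring
    have e2 : 2 * Q * (R / s * ((d * R * s + c ^ 2 * R * s) / (ρ * q) + ρ * q))
        = 2 * Q * (d + c ^ 2 + 1) * (R * ρ * q⁻¹) := by
      rw [← hqq, ← hρρ]
      field_simp
    rw [e1, e2, gapConstant, add_mul (1 + 4 * Q ^ 2 * (144 * d + 64 * c * √(d : ℝ)))]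
    -- The moment term is only of order `R * m^{-1/4}`; `1 ≤ √R` merges it into the common rate.
    gcongr
  · obtain ⟨Ad, hAm, hAb, hAd⟩ :=
      optimality_gap_le hQ hd0 hM hx hx1 hc hreg hτ hb hR0.le hst hac ht0
    obtain ⟨hint, hgap⟩ := hAd f hf
    refine ⟨hint, hgap.trans ?_⟩
    have hMk := isMarkovKernel_neuralPolicy hx τ b θ'
    have hmom := integral_norm_gateMoment_sub_empNorm_le
      (σ := M.visit (neuralPolicy x τ b θ')) hAm hAb hx hx1 hc
      (fun y hy u hu => hreg.visit_slab_le _ hy hu) hm (hG W) (hG0 W) (inv_pos.2 hq0)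
    -- `κ = √R * m^{1/4}` is the typical size of the square root, so linearizing it costs only a
    -- constant.
    have hsqrt := sqrt_le_linear (X := smallCount t W + c ^ 2 * R ^ 2 / t ^ 2) (κ := ρ * q)
      (by have := smallCount_nonneg t W; positivity) (by positivity)
    have e3 : c ^ 2 * R ^ 2 / t ^ 2 = c ^ 2 * R * s := by
      rw [ht2]; field_simp
    rw [e3] at hsqrt ⊢
    rw [div_inv_eq_mul, mul_assoc ((2 * Q) ^ 2)] at hmom
    have h3 : 2 * Q * (1 / s * (2 * R * √(smallCount t W + c ^ 2 * R * s)))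
        ≤ 2 * Q * (R / s * ((N W + c ^ 2 * R * s) / (ρ * q) + ρ * q)) := by
      calc _ = 2 * Q * (R / s * (2 * √(smallCount t W + c ^ 2 * R * s))) := by ring
        _ ≤ _ := by gcongr
    have h4 := mul_le_mul_of_nonneg_left hmom hR0.le
    rw [add_assoc]
    exact add_le_add le_rfl (add_le_add h4 h3)

instance : IsProbabilityMeasure signLaw := ⟨by simp [signLaw, ENNReal.inv_two_add_inv_two]⟩

lemma ae_abs_eq_one_signLaw : ∀ᵐ y ∂signLaw, |y| = 1 := by
  have hms : MeasurableSet {y : ℝ | |y| = 1} :=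
    measurableSet_eq_fun measurable_id.abs measurable_const
  rw [signLaw, ae_add_measure_iff]
  constructor <;> refine Measure.ae_smul_measure ((ae_dirac_iff hms).2 (by simp)) _

lemma ae_abs_eq_one_initLaw (m d : ℕ) : ∀ᵐ z ∂(initLaw m d), ∀ r, |z.2 r| = 1 := by
  rw [ae_all_iff]
  intro r
  have h : MeasurePreserving (fun z : Params m d × (Fin m → ℝ) => z.2 r) (initLaw m d) signLaw :=
    (measurePreserving_eval (fun _ : Fin m => signLaw) r).comp measurePreserving_snd
  exact h.quasiMeasurePreserving.ae ae_abs_eq_one_signLaw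

lemma HasLaw.fst_initLaw {Ω : Type*} [MeasurableSpace Ω] {P : Measure Ω} {W₀ : Ω → Params m d}
    {b : Ω → Fin m → ℝ} (h : HasLaw (fun ω => (W₀ ω, b ω)) (initLaw m d) P) :
    HasLaw W₀ (gaussianInit (Fin m × Fin d) d) P :=
  measurePreserving_fst.fun_comp_hasLaw h

lemma measurable_uFun (M : MDP S A) (hx : Measurable x) (τ : ℝ) (πopt : Kernel S A)
    (b : Fin m → ℝ) (θ : Params m d) : Measurable (uFun M x τ πopt b θ) := by
  unfold uFun
  simp only [inner_feature_self]
  exact ((Measure.measurable_rnDeriv _ _).ennreal_toReal.sub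
    ((Measure.measurable_rnDeriv _ _).comp measurable_fst).ennreal_toReal).add
    (measurable_network_comp hx b θ)

lemma ofReal_integral_abs_le_eLpNorm_two {X : Type*} [MeasurableSpace X] {σ : Measure X}
    [IsProbabilityMeasure σ] {f : X → ℝ} (hf : Integrable f σ) :
    ENNReal.ofReal (∫ p, |f p| ∂σ) ≤ eLpNorm f 2 σ := by
  calc _ = eLpNorm f 1 σ := by
        rw [eLpNorm_one_eq_lintegral_enorm, ← ofReal_integral_norm_eq_lintegral_enorm hf]
        rfl
    _ ≤ _ := eLpNorm_le_eLpNorm_of_exponent_le one_le_two hf.aestronglyMeasurable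

end Gap

end

/-! ### Expectation over the initialization -/

theorem mainTheorem5 (d : ℕ) (hd : 2 ≤ d) (c Qmax : ℝ) (hc : 0 < c) (hQ : 0 < Qmax) :
    ∃ C : ℝ, 0 < C ∧
      ∀ (S : Type*) [MeasurableSpace S] (A : Type*) [Fintype A] [MeasurableSpace A]
        [MeasurableSingletonClass A] (M : MDP S A) (x : S × A → EuclideanSpace ℝ (Fin d)),
        M.RewardBound Qmax → Measurable x → (∀ p, ‖x p‖ = 1) → RegularVisits M x c →
      ∀ (πopt : Kernel S A), M.IsOptimal πopt →
      ∀ (τ : ℝ), 0 < τ → ∀ (m : ℕ), 0 < m → ∀ (R : ℝ), 1 < R →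
      ∀ (Ω : Type*) [MeasurableSpace Ω] (P : Measure Ω) [IsProbabilityMeasure P]
        (W₀ : Ω → Params m d) (b : Ω → Fin m → ℝ) (θ' : Ω → Params m d),
        HasLaw (fun ω => (W₀ ω, b ω)) (initLaw m d) P → Measurable θ' →
        (∀ᵐ ω ∂P, IsStationaryPoint M x τ (b ω) (W₀ ω) R (θ' ω)) →
        (∀ᵐ ω ∂P, M.visit πopt ≪ M.visit (neuralPolicy x τ (b ω) (θ' ω))) →
        Integrable
          (fun ω => M.totalReward πopt - M.totalReward (neuralPolicy x τ (b ω) (θ' ω))) P ∧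
        ((∀ᵐ ω ∂P, ∃ f ∈ FRInfty x (b ω) (W₀ ω) R,
            uFun M x τ πopt (b ω) (θ' ω)
              =ᵐ[M.visit (neuralPolicy x τ (b ω) (θ' ω))] f) →
          (1 - M.discount) *
              ∫ ω, (M.totalReward πopt - M.totalReward (neuralPolicy x τ (b ω) (θ' ω))) ∂P
            ≤ C * (R ^ (3 / 2 : ℝ) * (m : ℝ) ^ (-(1 / 4) : ℝ))) ∧
        ENNReal.ofReal ((1 - M.discount) *
              ∫ ω, (M.totalReward πopt - M.totalReward (neuralPolicy x τ (b ω) (θ' ω))) ∂P)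
            ≤ ENNReal.ofReal (C * (R ^ (3 / 2 : ℝ) * (m : ℝ) ^ (-(1 / 4) : ℝ)))
              + ENNReal.ofReal (2 * Qmax) *
                ∫⁻ ω, eLpNorm
                  (l2Proj (M.visit (neuralPolicy x τ (b ω) (θ' ω)))
                      (FRInfty x (b ω) (W₀ ω) R) (uFun M x τ πopt (b ω) (θ' ω))
                    - uFun M x τ πopt (b ω) (θ' ω))
                  2 (M.visit (neuralPolicy x τ (b ω) (θ' ω))) ∂P := by
  refine ⟨gapConstant d c Qmax, gapConstant_pos hc.le hQ.le, ?_⟩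
  intro S _ A _ _ _ M x hM hx hx1 hreg πopt hopt τ hτ m hm R hR Ω _ P _ W₀ b θ' hlaw hθ' hst hac
  have hπ : IsMarkovKernel πopt := hopt.1
  have hS : Nonempty S := nonempty_of_isProbabilityMeasure M.init
  have hA : Nonempty A := nonempty_of_isProbabilityMeasure (πopt hS.some)
  have hR0 : 0 ≤ R := by linarith
  have hMk := fun ω => isMarkovKernel_neuralPolicy hx τ (b ω) (θ' ω)
  obtain ⟨Ψ, hΨi, hΨ0, hΨint, hΨ⟩ :=
    exists_gap_bound hQ hd hM hx hx1 hc.le hreg (πopt := πopt) hτ hm hR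
  set D : Ω → ℝ := fun ω => M.totalReward πopt - M.totalReward (neuralPolicy x τ (b ω) (θ' ω))
    with hD
  have hbm : AEMeasurable b P := measurable_snd.comp_aemeasurable hlaw.aemeasurable
  have hW := HasLaw.fst_initLaw hlaw
  have hsign : ∀ᵐ ω ∂P, ∀ r, |b ω r| = 1 := by
    have h := ae_abs_eq_one_initLaw m d
    rw [← hlaw.map_eq] at h
    exact ae_of_ae_map hlaw.aemeasurable h
  have hDi : Integrable D P := by
    refine Integrable.of_bound (C := Qmax + Qmax) ?_ (ae_of_all _ fun ω => ?_)
    · exact (aemeasurable_const.sub ((continuous_totalReward_neuralPolicy M hQ.le hM hx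
        τ).measurable.comp_aemeasurable (hbm.prodMk hθ'.aemeasurable))).aestronglyMeasurable
    · exact (abs_sub _ _).trans (add_le_add (M.abs_totalReward_le hM _) (M.abs_totalReward_le hM _))
  have hΨW : Integrable (fun ω => Ψ (W₀ ω)) P := by
    have h := hΨi
    rw [← hW.map_eq] at h
    exact h.comp_aemeasurable hW.aemeasurable
  have hΨWint : ∫ ω, Ψ (W₀ ω) ∂P
      ≤ gapConstant d c Qmax * (R ^ (3 / 2 : ℝ) * (m : ℝ) ^ (-(1 / 4) : ℝ)) :=
    (hW.integral_comp hΨi.aestronglyMeasurable).le.trans hΨint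
  refine ⟨hDi, fun hmem => ?_, ?_⟩
  · rw [← integral_const_mul]
    refine (integral_mono_ae (hDi.const_mul _) hΨW ?_).trans hΨWint
    filter_upwards [hsign, hst, hac, hmem] with ω h1 h2 h3 ⟨f, hf, hfu⟩
    have h := (hΨ (b ω) (W₀ ω) (θ' ω) h1 h2 h3 f hf).2
    have h0 : ∫ p, |f p - uFun M x τ πopt (b ω) (θ' ω) p|
        ∂(M.visit (neuralPolicy x τ (b ω) (θ' ω))) = 0 := by
      refine integral_eq_zero_of_ae ?_
      filter_upwards [hfu] with p hp
      simp [hp]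
    rwa [h0, mul_zero, zero_add] at h
  -- Optimality makes the gap nonnegative, so its expectation can be computed as a Lebesgue integral
  -- in `[0, ∞]`, where the projection error may be infinite.
  · have hD0 : ∀ ω, 0 ≤ (1 - M.discount) * D ω := fun ω =>
      mul_nonneg M.one_sub_discount_pos.le (sub_nonneg.2 (hopt.2 _ (hMk ω)))
    rw [← integral_const_mul, ofReal_integral_eq_lintegral_ofReal (hDi.const_mul _)
      (ae_of_all _ hD0)]
    calc _ ≤ ∫⁻ ω, (ENNReal.ofReal (Ψ (W₀ ω)) + ENNReal.ofReal (2 * Qmax) *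
          eLpNorm (l2Proj (M.visit (neuralPolicy x τ (b ω) (θ' ω)))
            (FRInfty x (b ω) (W₀ ω) R) (uFun M x τ πopt (b ω) (θ' ω))
            - uFun M x τ πopt (b ω) (θ' ω)) 2 (M.visit (neuralPolicy x τ (b ω) (θ' ω)))) ∂P := by
          refine lintegral_mono_ae ?_
          filter_upwards [hsign, hst, hac] with ω h1 h2 h3
          obtain ⟨hi, h⟩ := hΨ (b ω) (W₀ ω) (θ' ω) h1 h2 h3 _
            (l2Proj_mem (σ := M.visit (neuralPolicy x τ (b ω) (θ' ω))) (by omega) hx hx1 (b ω)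
              (W₀ ω) hR0 (measurable_uFun M hx τ πopt (b ω) (θ' ω)))
          refine (ENNReal.ofReal_le_ofReal h).trans (ENNReal.ofReal_add_le.trans ?_)
          rw [add_comm, ENNReal.ofReal_mul (by positivity)]
          gcongr
          exact ofReal_integral_abs_le_eLpNorm_two hi
      _ = ENNReal.ofReal (∫ ω, Ψ (W₀ ω) ∂P) + ENNReal.ofReal (2 * Qmax) * _ := by
          -- Measurability in `ω` is needed for the `Ψ` term only; none is claimed for the
          -- projection error.
          rw [lintegral_add_left' hΨW.aestronglyMeasurable.aemeasurable.ennreal_ofReal,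
            lintegral_const_mul' _ _ ENNReal.ofReal_ne_top,
            ofReal_integral_eq_lintegral_ofReal hΨW (ae_of_all _ fun ω => hΨ0 _)]
      _ ≤ _ := by gcongr
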